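/- Let $(V,\omega)$ be a real symplectic vector space of dimension $2n$ and let $\mathcal J(V,\omega)$ be the set of $J\in\mathrm{End}(V)$ with $J^2=-1$ such that $\omega(u,Jv)$ is an inner product. For such $J$ let $\wedge^{1,0}_J,\wedge^{0,1}_J\subset\mathbb C\otimes V^*$ be the $\pm i$-eigenspaces of $\eta\mapsto\eta\circ J$, and let $\wedge^{p,q}_J\subset\Lambda^{p+q}(\mathbb C\otimes V^*)$ be spanned by the products of $p$ covectors in $\wedge^{1,0}_J$ and $q$ covectors in $\wedge^{0,1}_J$. For $J,J'\in\mathcal J(V,\omega)$ let $-\Phi(J';J):\wedge_J^{1,0}\to\wedge_J^{0,1}$ be the projection with respect to $\mathbb C\otimes V^*=\wedge^{1,0}_{J'}\oplus\wedge^{0,1}_J$, and extend $\Phi(J';J)$ by zero to $\wedge^{0,1}_J$. Fix $J_0\in\mathcal J(V,\omega)$ and a basis $\xi^1,\dots,\xi^n$ of $\wedge^{1,0}_{J_0}$ with $\omega=i\sum_j\xi^j\wedge\bar\xi^j$. Then the matrix $t=(t_{jk})$ defined by $\Phi(J;J_0)\xi^k=\sum_j t_{jk}\bar\xi^j$ gives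 a bijection from $\mathcal J(V,\omega)$ onto the domain $\Omega=\{t\in M_n(\mathbb C): t=t^{T},\ t\bar t<1\}$ (open in the space of symmetric matrices); write $J_t$ for the complex structure with coordinate $t$, and regard $\mathcal J(V,\omega)$ as a complex manifold through this global holomorphic coordinate. For $0\le k\le 2n$ let $\mathcal H^k=\mathcal J(V,\omega)\times\Lambda^k(\mathbb C\otimes V^*)$ with trivial flat connection $\nabla$, let $\mathcal H^{p,q}=\{\wedge^{p,q}_{J}\}_J$ with fibrewise projections $\pi^{p,q}$, put $D=\sum_{p+q=k}\pi^{p,q}\nabla\pi^{p,q}$, let $h$ be the Hermitian metric on $\mathcal H^k$ induced at $J$ by the inner product $\omega(\cdot,J\cdot)$, and let $\theta=\sum_j dt^j\otimes\theta_j$, where $\theta_j$ at $t$ is the action on forms (as a derivation) of the Kodaira--Spencer tensor $\frac{\partial}{\partial s^j}\big|_{s=t}\Phi(J_s;J_t)$. Let $\bar\theta$ be the complex conjugate of $\theta$. Then for every $0\le k\le 2n$: 1. $\mathcal H^k=\bigoplus_{p+q=k}\mathcal H^{p,q}$ is a decomposition into smooth, mutually $h$-orthogonal subbundles, preserved by $D$;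 $\theta$ maps $\mathcal H^{p,q}$ to $\mathcal H^{p-1,q+1}$; and $\nabla=D+\theta+\bar\theta$. 2. $(\mathcal H^k,\theta,D)$ is a flat Higgs bundle over $\mathcal J(V,\omega)$ with Chern connection $D$: $h$ is a smooth Hermitian metric; $(D^{0,1})^2=0$, so that $D^{0,1}$ is a holomorphic structure; $D$ is compatible with $h$, i.e. $D$ is the Chern connection of $(\mathcal H^k,D^{0,1},h)$; $\theta$ is a smooth $\mathrm{End}(\mathcal H^k)$-valued $(1,0)$-form with $D^{0,1}\theta+\theta D^{0,1}=0$ (holomorphy), $D^{1,0}\theta+\theta D^{1,0}=0$ and $\theta\wedge\theta=0$; $\bar\theta$ is the $h$-adjoint of $\theta$; and $(D+\theta+\bar\theta)^2=0$. 3. If $1\le k\le 2n-1$, then $(\mathcal H^k,\theta)$ is admissible: at every point the map $\partial/\partial t^j\mapsto\theta_j\in\mathrm{End}(\mathcal H^k)$ is injective. -/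

import Mathlib

open scoped ComplexOrder

attribute [local instance] Matrix.normedAddCommGroup Matrix.normedSpace

noncomputable section

namespace HiggsJ

/-! ### Connections, Hermitian metrics and Higgs bundles on a trivial smooth bundle

Throughout, `Ω` is an open subset of a complex normed space `E` (a global holomorphic coordinate
domain) and the underlying smooth complex vector bundle is `Ω × W`.  Sections are functions
`u : E → W`, smooth on `Ω`.  Real tangent vectors are elements `v : E`, regarded also as constant
vector fields on `Ω` (which commute). -/

section General

variable {E : Type*} [NormedAddCommGroup E] [NormedSpace ℂ E]
variable {W : Type*} [NormedAddCommGroup W] [NormedSpace ℂ W]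

/-- `u` is `C^∞` on `Ω` (in the real sense). -/
abbrev SmoothOn {F : Type*} [NormedAddCommGroup F] [NormedSpace ℂ F] (u : E → F) (Ω : Set E) :
    Prop :=
  ContDiffOn ℝ ((⊤ : ℕ∞) : WithTop ℕ∞) u Ω

/-- The type of (candidate) connections: `D u t v` is the covariant derivative of the section `u`
at the point `t` in the direction of the real tangent vector `v`. -/
abbrev Conn (E W : Type*) := (E → W) → E → E → W

/-- The trivial flat connection `∇`: differentiation of vector valued functions. -/
def trivialConn : Conn E W := fun u t v => fderiv ℝ u t v

/-- `D` is a smooth connection on the complex vector bundle `Ω × W`. -/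
structure IsConnection (Ω : Set E) (D : Conn E W) : Prop where
  smooth : ∀ u : E → W, SmoothOn u Ω → ∀ v : E, SmoothOn (fun t => D u t v) Ω
  map_add_dir : ∀ u : E → W, SmoothOn u Ω → ∀ t ∈ Ω, ∀ v w : E,
    D u t (v + w) = D u t v + D u t w
  map_smul_dir : ∀ u : E → W, SmoothOn u Ω → ∀ t ∈ Ω, ∀ (r : ℝ) (v : E),
    D u t (r • v) = r • D u t v
  map_add : ∀ u w : E → W, SmoothOn u Ω → SmoothOn w Ω → ∀ t ∈ Ω, ∀ v : E,
    D (fun s => u s + w s) t v = D u t v + D w t v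
  leibniz : ∀ (f : E → ℂ) (u : E → W), SmoothOn f Ω → SmoothOn u Ω →
    ∀ t ∈ Ω, ∀ v : E, D (fun s => f s • u s) t v = (fderiv ℝ f t v) • u t + f t • D u t v

/-- The `(1,0)`-part `D^{1,0}` of `D`: in holomorphic coordinates, `∑ v^j D_{∂/∂t^j}`. -/
def part10 (D : Conn E W) : Conn E W :=
  fun u t v => (1 / 2 : ℂ) • (D u t v - Complex.I • D u t (Complex.I • v))

/-- The `(0,1)`-part `D^{0,1}` of `D`: in holomorphic coordinates, `∑ conj (v^j) D_{∂/∂t̄^j}`. -/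
def part01 (D : Conn E W) : Conn E W :=
  fun u t v => (1 / 2 : ℂ) • (D u t v + Complex.I • D u t (Complex.I • v))

/-- `D ∘ D = 0`, tested on pairs of constant (hence commuting) vector fields. -/
def SquareZero (Ω : Set E) (D : Conn E W) : Prop :=
  ∀ u : E → W, SmoothOn u Ω → ∀ t ∈ Ω, ∀ v w : E,
    D (fun s => D u s w) t v = D (fun s => D u s v) t w

/-- `h` is a smooth Hermitian metric on `Ω × W` (linear in the first argument). -/
structure IsHermitianMetric (Ω : Set E) (h : E → W → W → ℂ) : Prop where
  smooth : ∀ u w : E → W, SmoothOn u Ω → SmoothOn w Ω →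
    SmoothOn (fun t => h t (u t) (w t)) Ω
  add_left : ∀ t ∈ Ω, ∀ a b c : W, h t (a + b) c = h t a c + h t b c
  smul_left : ∀ t ∈ Ω, ∀ (z : ℂ) (a b : W), h t (z • a) b = z * h t a b
  conj_symm : ∀ t ∈ Ω, ∀ a b : W, h t b a = (starRingEnd ℂ) (h t a b)
  pos : ∀ t ∈ Ω, ∀ a : W, a ≠ 0 → 0 < (h t a a).re

/-- `D` is the Chern connection of `(Ω × W, h)` with the holomorphic structure `D^{0,1}`:
`D` is a connection whose `(0,1)`-part is integrable and which is compatible with `h`. -/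
structure IsChernConnection (Ω : Set E) (h : E → W → W → ℂ) (D : Conn E W) : Prop where
  isConnection : IsConnection Ω D
  integrable : SquareZero Ω (part01 D)
  compatible : ∀ u w : E → W, SmoothOn u Ω → SmoothOn w Ω → ∀ t ∈ Ω, ∀ v : E,
    fderiv ℝ (fun s => h s (u s) (w s)) t v = h t (D u t v) (w t) + h t (u t) (D w t v)

/-- `(Ω × W, h, D, θ)` is a flat Higgs bundle, `θ'` being the adjoint of the Higgs field:
`D` is the Chern connection of the Hermitian holomorphic bundle `(Ω × W, D^{0,1}, h)`, `θ` is a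
holomorphic `(1,0)`-form with values in the endomorphisms, `θ ∧ θ = 0`, and `D + θ + θ^*` is flat.
Here `θ t v` is the value of the form `θ` at `t` on the (holomorphic) tangent vector `v`. -/
structure IsFlatHiggsBundle (Ω : Set E) (h : E → W → W → ℂ) (D : Conn E W)
    (θ : E → E → W →ₗ[ℂ] W) (θ' : E → E → W → W) : Prop where
  metric : IsHermitianMetric Ω h
  chern : IsChernConnection Ω h D
  theta_smooth : ∀ (v : E) (a : W), SmoothOn (fun t => θ t v a) Ω
  theta_add : ∀ t ∈ Ω, ∀ v w : E, θ t (v + w) = θ t v + θ t w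
  theta_smul : ∀ t ∈ Ω, ∀ (z : ℂ) (v : E), θ t (z • v) = z • θ t v
  /-- `θ` is holomorphic: `D^{0,1} θ + θ D^{0,1} = 0`. -/
  theta_holomorphic : ∀ u : E → W, SmoothOn u Ω → ∀ t ∈ Ω, ∀ v w : E,
    part01 D (fun s => θ s w (u s)) t v = θ t w (part01 D u t v)
  /-- `D^{1,0} θ + θ D^{1,0} = 0`. -/
  theta_closed : ∀ u : E → W, SmoothOn u Ω → ∀ t ∈ Ω, ∀ v w : E,
    part10 D (fun s => θ s w (u s)) t v - θ t w (part10 D u t v) =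
      part10 D (fun s => θ s v (u s)) t w - θ t v (part10 D u t w)
  /-- `θ ∧ θ = 0`. -/
  theta_sq : ∀ t ∈ Ω, ∀ v w : E, θ t v ∘ₗ θ t w = θ t w ∘ₗ θ t v
  theta_adjoint : ∀ t ∈ Ω, ∀ (v : E) (a b : W), h t (θ t v a) b = h t a (θ' t v b)
  /-- `(D + θ + θ^*)^2 = 0`. -/
  flat : SquareZero Ω (fun u t v => D u t v + θ t v (u t) + θ' t v (u t))

/-- The Higgs field is admissible: `∂/∂t^j ↦ θ_j` is injective at every point. -/
def IsAdmissible (Ω : Set E) (θ : E → E → W →ₗ[ℂ] W) : Prop :=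
  ∀ t ∈ Ω, Function.Injective (θ t)

/-- The projection of `M` onto `p` along `q`, when `M = p ⊕ q`. -/
def projAlong {M : Type*} [AddCommGroup M] [Module ℂ M] (p q : Submodule ℂ M) : M →ₗ[ℂ] M :=
  open Classical in if hpq : IsCompl p q then Submodule.projection p q hpq else 0

end General

/-! ### Linear algebra of complex valued forms on a real vector space -/

section Linear

variable {V : Type*} [NormedAddCommGroup V] [NormedSpace ℝ V]

/-- `ℂ ⊗ V^*`, as the space of complex valued real linear forms on `V`. -/
abbrev Covec (V : Type*) [NormedAddCommGroup V] [NormedSpace ℝ V] := V →L[ℝ] ℂ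

/-- `Λ^k (ℂ ⊗ V^*)`, as the space of complex valued alternating real `k`-forms on `V`. -/
abbrev Form (V : Type*) [NormedAddCommGroup V] [NormedSpace ℝ V] (k : ℕ) := V [⋀^Fin k]→L[ℝ] ℂ

instance [FiniteDimensional ℝ V] : FiniteDimensional ℂ (Covec V) :=
  Module.Finite.of_restrictScalars_finite ℝ ℂ (Covec V)

/-- The set `𝒥(V, ω)` of `ω`-compatible complex structures on `V`. -/
def compatibleJ (ω : LinearMap.BilinForm ℝ V) : Set (V →L[ℝ] V) :=
  {J | (∀ x, J (J x) = -x) ∧ (∀ x y, ω x (J y) = ω y (J x)) ∧ ∀ x, x ≠ 0 → 0 < ω x (J x)}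

/-- `∧_J^{1,0}`: the `i`-eigenspace of `J` on `ℂ ⊗ V^*`. -/
def forms10 (J : V →L[ℝ] V) : Submodule ℂ (Covec V) where
  carrier := {η | ∀ x, η (J x) = Complex.I * η x}
  add_mem' := by
    intro a b ha hb x
    simp only [Set.mem_ofPred_eq] at ha hb
    simp [ha x, hb x, mul_add]
  zero_mem' := by intro x; simp
  smul_mem' := by
    intro c a ha x
    simp only [Set.mem_ofPred_eq] at ha
    simp [ha x, mul_left_comm]

/-- `∧_J^{0,1}`: the `-i`-eigenspace of `J` on `ℂ ⊗ V^*`. -/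
def forms01 (J : V →L[ℝ] V) : Submodule ℂ (Covec V) where
  carrier := {η | ∀ x, η (J x) = -Complex.I * η x}
  add_mem' := by
    intro a b ha hb x
    simp only [Set.mem_ofPred_eq] at ha hb
    simp [ha x, hb x]
    ring
  zero_mem' := by intro x; simp
  smul_mem' := by
    intro c a ha x
    simp only [Set.mem_ofPred_eq] at ha
    simp [ha x, mul_left_comm]

/-- Complex conjugation on `ℂ ⊗ V^*`. -/
def conjCovec (η : Covec V) : Covec V := (Complex.conjCLE : ℂ →L[ℝ] ℂ).comp η

/-- Complex conjugation on `Λ^k (ℂ ⊗ V^*)`. -/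
def conjForm {k : ℕ} (α : Form V k) : Form V k :=
  (Complex.conjCLE : ℂ →L[ℝ] ℂ).compContinuousAlternatingMap α

/-- The wedge product `η ∧ α` of a covector and a `k`-form. -/
def wedge {k : ℕ} (η : Covec V) (α : Form V k) : Form V (k + 1) :=
  ContinuousAlternatingMap.alternatizeUncurryFin (ContinuousLinearMap.smulRight η α)

/-- The wedge product `c 0 ∧ c 1 ∧ … ∧ c (k-1)`. -/
def wedgeAll : {k : ℕ} → (Fin k → Covec V) → Form V k
  | 0, _ => ContinuousAlternatingMap.constOfIsEmpty ℝ V (Fin 0) 1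
  | _ + 1, c => wedge (c 0) (wedgeAll (Fin.tail c))

/-- `∧_J^{p,k-p}`: the span of the products of `p` covectors of type `(1,0)` and `k - p`
covectors of type `(0,1)` (for `p ≤ k`). -/
def formsPQ (J : V →L[ℝ] V) (k p : ℕ) : Submodule ℂ (Form V k) :=
  Submodule.span ℂ {α | ∃ c : Fin k → Covec V,
    (∀ i : Fin k, if (i : ℕ) < p then c i ∈ forms10 J else c i ∈ forms01 J) ∧ α = wedgeAll c}

/-- The projection `π^{p,k-p}` onto `∧_J^{p,k-p}` along the other components of `Λ^k`. -/
def projPQ (J : V →L[ℝ] V) (k p : ℕ) : Form V k →ₗ[ℂ] Form V k :=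
  projAlong (formsPQ J k p) (⨆ p' ∈ (Finset.range (k + 1)).erase p, formsPQ J k p')

/-- The Hermitian inner product on `Λ^k (ℂ ⊗ V^*)` induced by the inner product
`g(x, y) = ω(x, J y)`: in index notation `(1/k!) g^{a₁b₁} ⋯ g^{a_kb_k} α_{a₁…a_k} conj β_{b₁…b_k}`.
Equivalently, the `k`-fold products of a `g`-orthonormal coframe are orthonormal. -/
def formInner [FiniteDimensional ℝ V] (ω : LinearMap.BilinForm ℝ V) (J : V →L[ℝ] V) {k : ℕ}
    (α β : Form V k) : ℂ :=
  let b := Module.finBasis ℝ V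
  let g : Matrix (Fin (Module.finrank ℝ V)) (Fin (Module.finrank ℝ V)) ℝ :=
    Matrix.of fun a c => ω (b a) (J (b c))
  (1 / (k.factorial : ℂ)) * ∑ f : Fin k → Fin (Module.finrank ℝ V),
    ∑ e : Fin k → Fin (Module.finrank ℝ V),
      ((∏ l, g⁻¹ (f l) (e l) : ℝ) : ℂ) * α (fun l => b (f l)) *
        (starRingEnd ℂ) (β fun l => b (e l))

/-- The Kodaira–Nirenberg–Spencer tensor `Φ(J'; J)`: on `∧_J^{1,0}` it is minus the projection to
`∧_J^{0,1}` with respect to `ℂ ⊗ V^* = ∧_{J'}^{1,0} ⊕ ∧_J^{0,1}`, and it is zero on `∧_J^{0,1}`. -/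
def kns [FiniteDimensional ℝ V] (J' J : V →L[ℝ] V) : Covec V →L[ℂ] Covec V :=
  LinearMap.toContinuousLinearMap
    (-(projAlong (forms01 J) (forms10 J') ∘ₗ projAlong (forms10 J) (forms01 J)))

/-- The action on forms of `σ : ℂ ⊗ V^* → ℂ ⊗ V^*`, viewed as the tensor `σ = ∑ σ(b^a) ⊗ b_a`,
where a pure tensor acts by `(η ⊗ x) · α = η ∧ (x ⌋ α)`. -/
def tensorAct [FiniteDimensional ℝ V] (σ : Covec V →L[ℂ] Covec V) :
    (k : ℕ) → Form V k →ₗ[ℂ] Form V k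
  | 0 => 0
  | k + 1 =>
    { toFun := fun α => ∑ a : Fin (Module.finrank ℝ V),
        wedge (σ (Complex.ofRealCLM.comp (LinearMap.toContinuousLinearMap
          ((Module.finBasis ℝ V).coord a)))) (α.curryLeft (Module.finBasis ℝ V a))
      map_add' := by
        intro α β
        rw [← Finset.sum_add_distrib]
        refine Finset.sum_congr rfl fun a _ => ?_
        ext x
        simp [wedge, ContinuousAlternatingMap.alternatizeUncurryFin_apply,
          Finset.sum_add_distrib]
      map_smul' := by
        intro z α
        rw [RingHom.id_apply, Finset.smul_sum]
        refine Finset.sum_congr rfl fun a _ => ?_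
        ext x
        simp [wedge, ContinuousAlternatingMap.alternatizeUncurryFin_apply, Finset.mul_sum]
        refine Finset.sum_congr rfl fun i _ => ?_
        ring }

end Linear

/-! ### The coordinate domain -/

/-- The space of symmetric complex `n × n` matrices. -/
def symMatrices (n : ℕ) : Submodule ℂ (Matrix (Fin n) (Fin n) ℂ) where
  carrier := {A | A.transpose = A}
  add_mem' := by
    intro a b ha hb
    simp only [Set.mem_ofPred_eq] at ha hb ⊢
    rw [Matrix.transpose_add, ha, hb]
  zero_mem' := by simp
  smul_mem' := by
    intro c a ha
    simp only [Set.mem_ofPred_eq] at ha ⊢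
    rw [Matrix.transpose_smul, ha]

/-- The bounded symmetric domain of type III: symmetric `t` with `t t̄ < 1`. -/
def bsd (n : ℕ) : Set (symMatrices n) :=
  {t | (1 - (t : Matrix (Fin n) (Fin n) ℂ) *
    (t : Matrix (Fin n) (Fin n) ℂ).map (starRingEnd ℂ)).PosDef}

section Bundle

variable {V : Type*} [NormedAddCommGroup V] [NormedSpace ℝ V]

/-- `ξ` is a unitary basis of `∧_J^{1,0}`: `ω = i ∑ ξ^j ∧ conj ξ^j`. -/
def IsUnitaryCoframe (ω : LinearMap.BilinForm ℝ V) (J : V →L[ℝ] V) {n : ℕ}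
    (ξ : Fin n → Covec V) : Prop :=
  (∀ j, ξ j ∈ forms10 J) ∧
    ∀ x y, (ω x y : ℂ) = Complex.I * ∑ j, (ξ j x * conjCovec (ξ j) y - ξ j y * conjCovec (ξ j) x)

/-- `t` is the matrix of the KNS tensor `Φ(J'; J)` in the frame `ξ` of `∧_J^{1,0}`:
`Φ(J'; J) ξ^k = ∑_j t_{jk} conj ξ^j`. -/
def IsKNSMatrix [FiniteDimensional ℝ V] (J' J : V →L[ℝ] V) {n : ℕ} (ξ : Fin n → Covec V)
    (t : Matrix (Fin n) (Fin n) ℂ) : Prop :=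
  ∀ k, kns J' J (ξ k) = ∑ j, t j k • conjCovec (ξ j)

variable {E : Type*} [NormedAddCommGroup E] [NormedSpace ℂ E]

/-- The connection `D = ∑_{p+q=k} π^{p,q} ∇ π^{p,q}` on `ℋ^k`, where `𝒥 t` is the complex structure
with coordinate `t`. -/
def hodgeConn (𝒥 : E → V →L[ℝ] V) (k : ℕ) : Conn E (Form V k) := fun u t v =>
  ∑ p ∈ Finset.range (k + 1),
    projPQ (𝒥 t) k p (trivialConn (fun s => projPQ (𝒥 s) k p (u s)) t v)

/-- The Kodaira–Spencer tensor at `t` in the direction of the `(1,0)`-vector `v`: the derivative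
`∑ v^j ∂/∂s^j` at `s = t` of `s ↦ Φ(𝒥 s; 𝒥 t)`. -/
def ksTensor [FiniteDimensional ℝ V] (𝒥 : E → V →L[ℝ] V) (t v : E) : Covec V →L[ℂ] Covec V :=
  part10 trivialConn (fun s => kns (𝒥 s) (𝒥 t)) t v

/-- The Higgs field on `ℋ^k`: the action of the Kodaira–Spencer tensor. -/
def higgsField [FiniteDimensional ℝ V] (𝒥 : E → V →L[ℝ] V) (k : ℕ) (t v : E) :
    Form V k →ₗ[ℂ] Form V k :=
  tensorAct (ksTensor 𝒥 t v) k

/-- The conjugate Higgs field `θ̄`. -/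
def higgsFieldConj [FiniteDimensional ℝ V] (𝒥 : E → V →L[ℝ] V) (k : ℕ) (t v : E)
    (α : Form V k) : Form V k :=
  conjForm (higgsField 𝒥 k t v (conjForm α))

/-- The Hermitian metric on `ℋ^k` induced by `ω` and the complex structures `𝒥 t`. -/
def hodgeMetric [FiniteDimensional ℝ V] (ω : LinearMap.BilinForm ℝ V) (𝒥 : E → V →L[ℝ] V) (k : ℕ)
    (t : E) (α β : Form V k) : ℂ :=
  formInner ω (𝒥 t) α β

end Bundle

end HiggsJ

end

noncomputable section

namespace HiggsJ
-- Wedge products and the derivation action on forms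
section Forms

variable {V : Type*} [NormedAddCommGroup V] [NormedSpace ℝ V]

/-! Fix `k` and let N_t be the derivation of Λ^k extending the projection of ℂ ⊗ V^* onto ∧^{1,0} of
J_t (`grading`). It counts (1,0)-factors, so ∧^{p,k-p} is its p-eigenspace, π^{p,k-p} is a Lagrange
polynomial in N_t, and N_t is real-affine in J_t. The Hodge-theoretic statements thereby become a
calculus of one operator-valued function N.

The family is holomorphic in the sense J'(iv) = J J'(v). With the derivative of J² = -1 this yields
[N, ∂N] = -∂N and [N, ∂̄N] = ∂̄N (`IsHolomorphicFamily.isGradingFamily`). Hence ∇ - ∂N + ∂̄N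
commutes with N and with every π^{p,q}; as ∂N and ∂̄N change the type, it equals D (`hodgeConn_eq`).
The Kodaira–Spencer tensor is the ∂-derivative of the projection onto ∧^{1,0} (`ksTensor_eq`), so θ
= ∂N, θ̄ = -∂̄N and ∇ = D + θ + θ̄. Differentiating the bracket relations once more, with the
symmetry of second derivatives, gives [∂_v N, ∂_w N] = 0 and ∂̄_v ∂_w N = [∂_w N, ∂̄_v N]
(`dz_mul_comm`, `dzbar_dz`), together with [∂̄_v N, ∂̄_w N] = 0. These contain θ ∧ θ = 0, the
holomorphy and closedness of θ, and (D^{0,1})² = 0.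

For the metric, the Gram matrix is G = ΩJ with Ω the matrix of ω, so G⁻¹ = -JΩ⁻¹ is linear in J
(`gram_inv`). The projection onto ∧^{1,0} is self-adjoint, so distinct types are orthogonal; θ and
θ̄ are mutually adjoint; and the variation of G⁻¹ is exactly cancelled by the correction -(θ + θ̄)
in D (`gram_inv_variation`).

A unitary coframe identifies V with ℂ^n, and J_t is multiplication by i transported by z ↦ z + t z̄.
The components of that map are (1,0)-covectors for J_t, so t is the KNS matrix. With w the part of
ZJ commuting with the complex structures, 2ω(x, Jx) = |w|² - |t w̄|²: positivity means t t̄ < 1, and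
symmetry of ω(·, J·) means t = t^T (`exists_coordinate`).

Admissibility: if A : ∧^{1,0} → ∧^{0,1} acts by zero on k-forms, then η ∧ Aη ∧ β = 0 for all
(k-1)-forms β; for k < 2n this forces η ∧ Aη = 0, and the difference of types gives Aη = 0
(`tensorAct_injective`). -/

theorem wedge_apply {k : ℕ} (η : Covec V) (α : Form V k) (x : Fin (k + 1) → V) :
    wedge η α x = ∑ i : Fin (k + 1), (-1) ^ (i : ℕ) * (η (x i) * α (i.removeNth x)) := by
  simp [wedge, ContinuousAlternatingMap.alternatizeUncurryFin_apply, zsmul_eq_mul]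

theorem wedge_add_right {k : ℕ} (η : Covec V) (α β : Form V k) :
    wedge η (α + β) = wedge η α + wedge η β := by
  ext x; simp [wedge_apply, mul_add, Finset.sum_add_distrib]

theorem wedge_smul_right {k : ℕ} (z : ℂ) (η : Covec V) (α : Form V k) :
    wedge η (z • α) = z • wedge η α := by
  ext x; simp only [wedge_apply, ContinuousAlternatingMap.smul_apply, smul_eq_mul, Finset.mul_sum]
  exact Finset.sum_congr rfl fun i _ => by ring

/-- The wedge product with `η` as a linear map. -/
def wedgeRight {k : ℕ} (η : Covec V) : Form V k →ₗ[ℂ] Form V (k + 1) where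
  toFun := wedge η
  map_add' := wedge_add_right η
  map_smul' z := wedge_smul_right z η

theorem wedge_add_left {k : ℕ} (η η' : Covec V) (α : Form V k) :
    wedge (η + η') α = wedge η α + wedge η' α := by
  ext x; simp [wedge_apply, mul_add, add_mul, Finset.sum_add_distrib]

theorem wedge_zero_left {k : ℕ} (α : Form V k) : wedge (0 : Covec V) α = 0 := by
  ext x; simp [wedge_apply]

theorem wedge_zero_right {k : ℕ} (η : Covec V) : wedge η (0 : Form V k) = 0 :=
  (wedgeRight η).map_zero

/-- The double wedge is the alternatization of η(x)η(y)α, which is symmetric in x and y. -/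
theorem wedge_wedge_self {k : ℕ} (η : Covec V) (α : Form V k) : wedge η (wedge η α) = 0 := by
  rw [← ContinuousAlternatingMap.alternatizeUncurryFin_alternatizeUncurryFinCLM_comp_of_symmetric
    (f := ContinuousLinearMap.compL ℝ V ℂ (Form V k)
      (ContinuousLinearMap.smulRight (ContinuousLinearMap.id ℝ ℂ) α) ∘L
        (ContinuousLinearMap.mul ℝ ℂ).bilinearComp η η)]
  · ext x
    simp [wedge_apply, ContinuousAlternatingMap.alternatizeUncurryFin_apply, zsmul_eq_mul,
      Finset.mul_sum, mul_assoc, mul_left_comm]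
  · intro x y
    ext z
    simp [mul_comm (η x)]

theorem wedge_wedge_comm {k : ℕ} (η η' : Covec V) (α : Form V k) :
    wedge η (wedge η' α) = -wedge η' (wedge η α) := by
  rw [eq_neg_iff_add_eq_zero]
  have h := wedge_wedge_self (η + η') α
  rwa [wedge_add_left, wedge_add_left, wedge_add_right, wedge_add_right, wedge_wedge_self, wedge_wedge_self,
    zero_add, add_zero] at h

/-- Moving slot `l` to the front is a cycle of sign (-1)^l. This translates between the contraction
in `tensorAct` and substitution into a slot. -/
theorem form_update {k : ℕ} (α : Form V (k + 1)) (x : Fin (k + 1) → V) (l : Fin (k + 1)) (y : V) :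
    α (Function.update x l y) = (-1) ^ (l : ℕ) * α (Matrix.vecCons y (l.removeNth x)) := by
  have h := AlternatingMap.map_insertNth α.toAlternatingMap l y (l.removeNth x)
  rw [Fin.insertNth_removeNth] at h
  simpa [zsmul_eq_mul] using h

variable [FiniteDimensional ℝ V]

/-- The dual basis covectors of the standard basis of `V`. -/
def coframe (V : Type*) [NormedAddCommGroup V] [NormedSpace ℝ V] [FiniteDimensional ℝ V]
    (a : Fin (Module.finrank ℝ V)) : Covec V :=
  Complex.ofRealCLM.comp (LinearMap.toContinuousLinearMap ((Module.finBasis ℝ V).coord a))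

theorem coframe_apply (a : Fin (Module.finrank ℝ V)) (x : V) :
    coframe V a x = ((Module.finBasis ℝ V).repr x a : ℂ) := rfl

theorem coframe_basis (a c : Fin (Module.finrank ℝ V)) :
    coframe V a (Module.finBasis ℝ V c) = if a = c then 1 else 0 := by
  rw [coframe_apply, Module.Basis.repr_self, Finsupp.single_apply]
  simp only [eq_comm (a := a)]
  split_ifs <;> simp

theorem sum_coframe_smul (η : Covec V) :
    ∑ a, η (Module.finBasis ℝ V a) • coframe V a = η := by
  ext x
  conv_rhs => rw [← (Module.finBasis ℝ V).sum_repr x, map_sum]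
  simp only [map_smul]
  simp [coframe_apply, mul_comm]

theorem form_sum_update {k : ℕ} (α : Form V k) (x : Fin k → V) (l : Fin k) (y : V) :
    α (Function.update x l y) =
      ∑ a, coframe V a y * α (Function.update x l (Module.finBasis ℝ V a)) := by
  conv_lhs => rw [← (Module.finBasis ℝ V).sum_repr y]
  rw [← ContinuousAlternatingMap.coe_toAlternatingMap, AlternatingMap.map_update_sum]
  simp [coframe_apply]

/-- The derivation extending `A` in terms of substitutions. -/
theorem tensorAct_apply (A : Covec V →L[ℂ] Covec V) {k : ℕ} (α : Form V k) (x : Fin k → V) :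
    tensorAct A k α x = ∑ l, ∑ a, A (coframe V a) (x l) *
      α (Function.update x l (Module.finBasis ℝ V a)) := by
  cases k with
  | zero => simp [tensorAct]
  | succ k =>
    have : tensorAct A (k + 1) α x = ∑ a, wedge (A (coframe V a))
        (α.curryLeft (Module.finBasis ℝ V a)) x := by
      simp [tensorAct, coframe]
    rw [this, Finset.sum_comm]
    refine Finset.sum_congr rfl fun a _ => ?_
    rw [wedge_apply]
    refine Finset.sum_congr rfl fun l _ => ?_
    rw [form_update, ContinuousAlternatingMap.curryLeft_apply_apply]
    ring

theorem tensorAct_add (A B : Covec V →L[ℂ] Covec V) (k : ℕ) :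
    tensorAct (A + B) k = tensorAct A k + tensorAct B k := by
  ext α x; simp [tensorAct_apply, add_mul, Finset.sum_add_distrib]

theorem tensorAct_smul (z : ℂ) (A : Covec V →L[ℂ] Covec V) (k : ℕ) :
    tensorAct (z • A) k = z • tensorAct A k := by
  ext α x; simp [tensorAct_apply, Finset.mul_sum, mul_assoc]

/-- `σ ↦` its action on forms, as a linear map. -/
def tensorActₗ (k : ℕ) : (Covec V →L[ℂ] Covec V) →ₗ[ℂ] (Form V k →ₗ[ℂ] Form V k) where
  toFun A := tensorAct A k
  map_add' A B := tensorAct_add A B k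
  map_smul' z A := tensorAct_smul z A k

theorem clm_coframe_expand (A : Covec V →L[ℂ] Covec V) (η : Covec V) (x : V) :
    ∑ a, A (coframe V a) x * η (Module.finBasis ℝ V a) = A η x := by
  conv_rhs => rw [← sum_coframe_smul η]
  simp [mul_comm]

/-- Two substitutions into the same slot compose to `A * B`; substitutions into distinct slots form
a remainder that is unchanged when `A` and `B` are exchanged, hence disappears from commutators. -/
theorem tensorAct_tensorAct_apply (A B : Covec V →L[ℂ] Covec V) {k : ℕ} (α : Form V k)
    (x : Fin k → V) :
    tensorAct A k (tensorAct B k α) x = tensorAct (A * B) k α x +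
      ∑ l, ∑ m ∈ Finset.univ.erase l, ∑ a, ∑ c, A (coframe V a) (x l) * B (coframe V c) (x m) *
        α (Function.update (Function.update x l (Module.finBasis ℝ V a)) m
          (Module.finBasis ℝ V c)) := by
  simp only [tensorAct_apply]
  rw [← Finset.sum_add_distrib]
  refine Finset.sum_congr rfl fun l _ => ?_
  have : ∀ a, A (coframe V a) (x l) * ∑ m, ∑ c, B (coframe V c)
      (Function.update x l (Module.finBasis ℝ V a) m) *
        α (Function.update (Function.update x l (Module.finBasis ℝ V a)) m
          (Module.finBasis ℝ V c)) =
      (∑ c, A (coframe V a) (x l) * B (coframe V c) (Module.finBasis ℝ V a) *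
        α (Function.update x l (Module.finBasis ℝ V c))) +
      ∑ m ∈ Finset.univ.erase l, ∑ c, A (coframe V a) (x l) * B (coframe V c) (x m) *
        α (Function.update (Function.update x l (Module.finBasis ℝ V a)) m
          (Module.finBasis ℝ V c)) := by
    intro a
    rw [← Finset.add_sum_erase _ _ (Finset.mem_univ l), mul_add, Finset.mul_sum, Finset.mul_sum]
    congr 1
    · refine Finset.sum_congr rfl fun c _ => ?_
      simp [mul_assoc]
    · refine Finset.sum_congr rfl fun m hm => ?_
      rw [Finset.mul_sum]
      refine Finset.sum_congr rfl fun c _ => ?_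
      rw [Function.update_of_ne (Finset.ne_of_mem_erase hm), mul_assoc]
  rw [Finset.sum_congr rfl fun a _ => this a, Finset.sum_add_distrib]
  congr 1
  · rw [Finset.sum_comm]
    refine Finset.sum_congr rfl fun c _ => ?_
    rw [← Finset.sum_mul, clm_coframe_expand]
    rfl
  · rw [Finset.sum_comm]

theorem tensorAct_commutator (A B : Covec V →L[ℂ] Covec V) (k : ℕ) (α : Form V k) :
    tensorAct A k (tensorAct B k α) - tensorAct B k (tensorAct A k α) =
      tensorAct (A * B - B * A) k α := by
  have h : tensorAct (A * B - B * A) k = tensorAct (A * B) k - tensorAct (B * A) k :=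
    map_sub (tensorActₗ (V := V) k) _ _
  rw [h]
  ext x
  simp only [ContinuousAlternatingMap.sub_apply, LinearMap.sub_apply, tensorAct_tensorAct_apply]
  rw [add_sub_add_comm, add_eq_left, sub_eq_zero]
  have e : ∀ l : Fin k, Finset.univ.erase l = Finset.univ.filter (fun m => m ≠ l) := by
    intro l; ext; simp
  simp only [e]
  simp only [Finset.sum_filter]
  rw [Finset.sum_comm]
  refine Finset.sum_congr rfl fun m _ => Finset.sum_congr rfl fun l _ => ?_
  by_cases hml : m = l
  · simp [hml]
  · rw [if_pos hml, if_pos (Ne.symm hml), Finset.sum_comm]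
    refine Finset.sum_congr rfl fun c _ => Finset.sum_congr rfl fun a _ => ?_
    rw [Function.update_comm hml]
    ring

theorem tensorAct_wedge (A : Covec V →L[ℂ] Covec V) {k : ℕ} (η : Covec V) (α : Form V k) :
    tensorAct A (k + 1) (wedge η α) = wedge (A η) α + wedge η (tensorAct A k α) := by
  ext x
  simp only [tensorAct_apply, wedge_apply, ContinuousAlternatingMap.add_apply, Finset.mul_sum]
  have : ∀ l : Fin (k + 1), ∑ a, ∑ i : Fin (k + 1), A (coframe V a) (x l) * ((-1) ^ (i : ℕ) *
      (η (Function.update x l (Module.finBasis ℝ V a) i) *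
        α (i.removeNth (Function.update x l (Module.finBasis ℝ V a))))) =
      ∑ i : Fin (k + 1), ∑ a, A (coframe V a) (x l) * ((-1) ^ (i : ℕ) *
      (η (Function.update x l (Module.finBasis ℝ V a) i) *
        α (i.removeNth (Function.update x l (Module.finBasis ℝ V a))))) :=
    fun l => Finset.sum_comm
  simp only [this]
  rw [Finset.sum_comm, ← Finset.sum_add_distrib]
  refine Finset.sum_congr rfl fun i _ => ?_
  -- The slot `i` fed to η produces A η; the remaining slots act on α.
  rw [Fin.sum_univ_succAbove _ i]
  congr 1
  · rw [← clm_coframe_expand A η (x i), Finset.sum_mul, Finset.mul_sum]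
    refine Finset.sum_congr rfl fun a _ => ?_
    simp
    ring
  · refine Finset.sum_congr rfl fun l _ => Finset.sum_congr rfl fun a _ => ?_
    rw [Function.update_of_ne (Fin.succAbove_ne i l).symm, Fin.removeNth_update_succAbove]
    simp only [Fin.removeNth_apply]
    ring

theorem tensorAct_one (k : ℕ) (α : Form V k) : tensorAct 1 k α = (k : ℂ) • α := by
  ext x
  rw [tensorAct_apply]
  have : ∀ l, ∑ a, (1 : Covec V →L[ℂ] Covec V) (coframe V a) (x l) *
      α (Function.update x l (Module.finBasis ℝ V a)) = α x := by
    intro l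
    simpa using (form_sum_update α x l (x l)).symm
  rw [Finset.sum_congr rfl fun l _ => this l]
  simp

/-- Euler's identity, being the action of the identity. It exhibits every form of positive degree as
a combination of products η ∧ β, which drives inductions on the degree. -/
theorem sum_wedge_curryLeft {k : ℕ} (α : Form V (k + 1)) :
    ∑ a, wedge (coframe V a) (α.curryLeft (Module.finBasis ℝ V a)) = ((k + 1 : ℕ) : ℂ) • α := by
  rw [← tensorAct_one]
  simp [tensorAct, coframe]

/-- Contracting the new factor with itself counts the dimension, and contracting it with the k old
slots subtracts k. The nonzero factor for k < dim V makes the coframe wedges jointly injective. -/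
theorem sum_curryLeft_wedge {k : ℕ} (γ : Form V k) :
    ∑ a, (wedge (coframe V a) γ).curryLeft (Module.finBasis ℝ V a) =
      ((Module.finrank ℝ V : ℂ) - k) • γ := by
  ext x
  have h1 : ∀ a, (wedge (coframe V a) γ) (Matrix.vecCons (Module.finBasis ℝ V a) x) =
      γ x - ∑ l, coframe V a (x l) * γ (Function.update x l (Module.finBasis ℝ V a)) := by
    intro a
    rw [wedge_apply, Fin.sum_univ_succ]
    simp only [Matrix.vecCons, Fin.cons_zero, Fin.cons_succ, coframe_basis]
    rw [sub_eq_add_neg, ← Finset.sum_neg_distrib]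
    congr 1
    · simp
    · refine Finset.sum_congr rfl fun l _ => ?_
      cases k with
      | zero => exact l.elim0
      | succ k =>
        rw [form_update]
        have : l.succ.removeNth (Fin.cons (Module.finBasis ℝ V a) x : Fin (k + 2) → V) =
            Matrix.vecCons (Module.finBasis ℝ V a) (l.removeNth x) := by
          ext i
          refine Fin.cases ?_ (fun i => ?_) i <;> simp [Fin.removeNth, Matrix.vecCons]
        rw [this, Fin.val_succ, pow_succ]
        have e : ((-1 : ℂ) ^ (l : ℕ)) * (-1) ^ (l : ℕ) = 1 := by
          rw [← mul_pow]; simp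
        ring
  simp only [ContinuousAlternatingMap.sum_apply, ContinuousAlternatingMap.curryLeft_apply_apply,
    h1, Finset.sum_sub_distrib, ContinuousAlternatingMap.smul_apply, smul_eq_mul]
  rw [Finset.sum_comm]
  simp only [← form_sum_update, Function.update_eq_self]
  simp [sub_mul]

end Forms

/-! ### The type decomposition as an eigenspace decomposition -/

section Types

variable {V : Type*} [NormedAddCommGroup V] [NormedSpace ℝ V]

theorem wedge_mem_formsPQ_succ {J : V →L[ℝ] V} {k p : ℕ} {η : Covec V} (hη : η ∈ forms10 J)
    {α : Form V k} (hα : α ∈ formsPQ J k p) : wedge η α ∈ formsPQ J (k + 1) (p + 1) := by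
  suffices formsPQ J k p ≤ (formsPQ J (k + 1) (p + 1)).comap (wedgeRight η) from this hα
  refine Submodule.span_le.2 ?_
  rintro _ ⟨c, hc, rfl⟩
  refine Submodule.subset_span ⟨Fin.cons η c, fun i => ?_, ?_⟩
  · refine Fin.cases ?_ (fun i => ?_) i
    · simpa using hη
    · simpa using hc i
  · simp [wedgeAll, wedgeRight]

/-- The generators list their (1,0)-factors first, so a new (0,1)-factor has to be anticommuted past
them one at a time: induction on p. -/
theorem wedge_mem_formsPQ {J : V →L[ℝ] V} {k p : ℕ} (hp : p ≤ k) {η : Covec V}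
    (hη : η ∈ forms01 J) {α : Form V k} (hα : α ∈ formsPQ J k p) :
    wedge η α ∈ formsPQ J (k + 1) p := by
  suffices formsPQ J k p ≤ (formsPQ J (k + 1) p).comap (wedgeRight η) from this hα
  refine Submodule.span_le.2 ?_
  rintro _ ⟨c, hc, rfl⟩
  change wedge η (wedgeAll c) ∈ formsPQ J (k + 1) p
  clear hα α
  induction p generalizing k with
  | zero =>
    refine Submodule.subset_span ⟨Fin.cons η c, fun i => ?_, ?_⟩
    · refine Fin.cases ?_ (fun i => ?_) i
      · simpa using hη
      · simpa using hc i
    · simp [wedgeAll]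
  | succ p ih =>
    cases k with
    | zero => omega
    | succ k =>
      rw [wedgeAll, wedge_wedge_comm]
      refine Submodule.neg_mem _ (wedge_mem_formsPQ_succ (by simpa using hc 0) ?_)
      refine ih (by omega) _ fun i => ?_
      simpa [Fin.tail] using hc i.succ

theorem formsPQ_zero_eq_top (J : V →L[ℝ] V) : formsPQ J 0 0 = ⊤ := by
  rw [eq_top_iff]
  intro α _
  have : α = (α 0) • wedgeAll (V := V) (k := 0) ![] := by
    ext x
    simp [wedgeAll, Subsingleton.elim x 0]
  rw [this]
  exact Submodule.smul_mem _ _ (Submodule.subset_span ⟨_, fun i => i.elim0, rfl⟩)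

/-- `η ↦ η ∘ S` on covectors. -/
def pull (S : V →L[ℝ] V) : Covec V →L[ℂ] Covec V :=
  LinearMap.mkContinuous
    { toFun := fun η => η.comp S
      map_add' := fun _ _ => rfl
      map_smul' := fun _ _ => rfl } ‖S‖ fun η => by
        rw [mul_comm]; exact η.opNorm_comp_le S

@[simp] theorem pull_apply (S : V →L[ℝ] V) (η : Covec V) (x : V) : pull S η x = η (S x) := rfl

theorem pull_mul (S T : V →L[ℝ] V) : pull S * pull T = pull (T * S) := rfl

theorem pull_add (S T : V →L[ℝ] V) : pull (S + T) = pull S + pull T := by ext; simp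

theorem pull_neg (S : V →L[ℝ] V) : pull (-S) = -pull S := by ext; simp

theorem pull_one : pull (1 : V →L[ℝ] V) = 1 := rfl

theorem pull_smul (r : ℝ) (S : V →L[ℝ] V) : pull (r • S) = (r : ℂ) • pull S := by ext; simp

/-- The projection `(1 - i J^*) / 2` of `ℂ ⊗ V^*` onto `∧_J^{1,0}` along `∧_J^{0,1}`. -/
def proj10 (J : V →L[ℝ] V) : Covec V →L[ℂ] Covec V := (1 / 2 : ℂ) • (1 - Complex.I • pull J)

theorem proj10_apply (J : V →L[ℝ] V) (η : Covec V) (x : V) :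
    proj10 J η x = (1 / 2 : ℂ) * (η x - Complex.I * η (J x)) := by
  simp [proj10]

theorem proj10_mem {J : V →L[ℝ] V} (hJ : ∀ x, J (J x) = -x) (η : Covec V) :
    proj10 J η ∈ forms10 J := by
  intro x
  rw [proj10_apply, proj10_apply, hJ, map_neg]
  linear_combination (1 / 2 * η (J x)) * Complex.I_sq

theorem sub_proj10_mem {J : V →L[ℝ] V} (hJ : ∀ x, J (J x) = -x) (η : Covec V) :
    η - proj10 J η ∈ forms01 J := by
  intro x
  simp only [sub_apply, proj10_apply, hJ, map_neg]
  linear_combination (1 / 2 * η (J x)) * (Complex.I_sq)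

theorem proj10_of_mem {J : V →L[ℝ] V} {η : Covec V} (h : η ∈ forms10 J) : proj10 J η = η := by
  ext x
  rw [proj10_apply, h x]
  linear_combination (-1 / 2 * η x) * Complex.I_sq

theorem proj10_of_mem01 {J : V →L[ℝ] V} {η : Covec V} (h : η ∈ forms01 J) : proj10 J η = 0 := by
  ext x
  rw [proj10_apply, h x]
  simp only [zero_apply]
  linear_combination (1 / 2 * η x) * Complex.I_sq

theorem isCompl_forms {J : V →L[ℝ] V} (hJ : ∀ x, J (J x) = -x) :
    IsCompl (forms10 J) (forms01 J) := by
  constructor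
  · rw [Submodule.disjoint_def]
    intro η h h'
    rw [← proj10_of_mem h, proj10_of_mem01 h']
  · rw [codisjoint_iff, eq_top_iff]
    intro η _
    rw [← add_sub_cancel (proj10 J η) η]
    exact Submodule.add_mem_sup (proj10_mem hJ η) (sub_proj10_mem hJ η)

variable [FiniteDimensional ℝ V]

theorem iSup_formsPQ {J : V →L[ℝ] V} (hJ : ∀ x, J (J x) = -x) (k : ℕ) :
    ⨆ p : Fin (k + 1), formsPQ J k p = ⊤ := by
  induction k with
  | zero => rw [eq_top_iff, ← formsPQ_zero_eq_top J]; exact le_iSup (fun p : Fin 1 => formsPQ J 0 p) 0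
  | succ k ih =>
    have key : ∀ (η : Covec V) (β : Form V k),
        wedge η β ∈ ⨆ p : Fin (k + 1 + 1), formsPQ J (k + 1) p := by
      intro η β
      suffices (⊤ : Submodule ℂ (Form V k)) ≤
        (⨆ p : Fin (k + 1 + 1), formsPQ J (k + 1) p).comap (wedgeRight η) from this trivial
      rw [← ih]
      refine iSup_le fun p α hα => ?_
      change wedge η α ∈ ⨆ p : Fin (k + 1 + 1), formsPQ J (k + 1) p
      rw [← add_sub_cancel (proj10 J η) η, wedge_add_left]
      refine Submodule.add_mem _ ?_ ?_
      · exact Submodule.mem_iSup_of_mem p.succ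
          (by simpa using wedge_mem_formsPQ_succ (proj10_mem hJ η) hα)
      · exact Submodule.mem_iSup_of_mem p.castSucc
          (by simpa using wedge_mem_formsPQ (by omega) (sub_proj10_mem hJ η) hα)
    rw [eq_top_iff]
    intro α _
    have h := sum_wedge_curryLeft α
    have h0 : ((k + 1 : ℕ) : ℂ) ≠ 0 := Nat.cast_ne_zero.2 (by omega)
    rw [← inv_smul_eq_iff₀ h0] at h
    rw [← h]
    exact Submodule.smul_mem _ _ (Submodule.sum_mem _ fun a _ => key _ _)

/-- By the Leibniz rule the derivation counts the factors fixed by the projection; the (0,1)-factors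
are killed. -/
theorem tensorAct_proj10_of_mem {J : V →L[ℝ] V} {k p : ℕ} (hp : p ≤ k) {α : Form V k}
    (hα : α ∈ formsPQ J k p) : tensorAct (proj10 J) k α = (p : ℂ) • α := by
  suffices formsPQ J k p ≤ Module.End.eigenspace (tensorAct (proj10 J) k) (p : ℂ) from
    Module.End.mem_eigenspace_iff.1 (this hα)
  refine Submodule.span_le.2 ?_
  rintro _ ⟨c, hc, rfl⟩
  rw [SetLike.mem_coe, Module.End.mem_eigenspace_iff]
  clear hα α
  induction k generalizing p with
  | zero => simp [tensorAct, show p = 0 by omega]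
  | succ k ih =>
    rw [wedgeAll, tensorAct_wedge]
    rcases p with _ | p
    · have h0 := hc 0
      simp only [Fin.val_zero, lt_irrefl, if_false] at h0
      rw [proj10_of_mem01 h0, ih (Nat.zero_le k) (Fin.tail c) fun i => by
        simpa [Fin.tail] using hc i.succ]
      simp [wedge_zero_left, wedge_zero_right]
    · have h0 := hc 0
      simp only [Fin.val_zero, Nat.succ_pos, if_true] at h0
      rw [proj10_of_mem h0, ih (p := p) (by omega) (Fin.tail c) fun i => by
        simpa [Fin.tail] using hc i.succ]
      rw [wedge_smul_right, Nat.cast_succ, add_smul, one_smul]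
      exact add_comm _ _

theorem isInternal_formsPQ {J : V →L[ℝ] V} (hJ : ∀ x, J (J x) = -x) (k : ℕ) :
    DirectSum.IsInternal fun p : Fin (k + 1) => formsPQ J k p := by
  rw [DirectSum.isInternal_submodule_iff_iSupIndep_and_iSup_eq_top]
  refine ⟨?_, iSup_formsPQ hJ k⟩
  -- The eigenvalues 0, …, k are distinct in ℂ, so independence comes from that of eigenspaces.
  have h := (Module.End.eigenspaces_iSupIndep (tensorAct (proj10 J) k)).comp
    (f := fun p : Fin (k + 1) => ((p : ℕ) : ℂ))
    (fun p q h => Fin.ext (Nat.cast_injective (R := ℂ) h))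
  exact h.mono fun p α hα => Module.End.mem_eigenspace_iff.2
    (tensorAct_proj10_of_mem (by omega) hα)

/-- The coefficients of the projection `π^{p,k-p}` as a polynomial in the derivation extending
the projection to `∧^{1,0}`. -/
def typePoly (k p : ℕ) : Polynomial ℂ :=
  Lagrange.basis (Finset.range (k + 1)) (fun i : ℕ => (i : ℂ)) p

theorem eval_typePoly {k p q : ℕ} (hp : p ≤ k) (hq : q ≤ k) :
    (typePoly k p).eval (q : ℂ) = if p = q then 1 else 0 := by
  split_ifs with h
  · subst h
    exact Lagrange.eval_basis_self (Nat.cast_injective.injOn) (by simpa [Nat.lt_succ_iff] using hp)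
  · exact Lagrange.eval_basis_of_ne h (by simpa [Nat.lt_succ_iff] using hq)

theorem aeval_typePoly_of_mem {J : V →L[ℝ] V} {k p q : ℕ} (hp : p ≤ k) (hq : q ≤ k)
    {α : Form V k} (hα : α ∈ formsPQ J k q) :
    Polynomial.aeval (tensorAct (proj10 J) k) (typePoly k p) α = if p = q then α else 0 := by
  by_cases h0 : α = 0
  · simp [h0]
  rw [Module.End.aeval_apply_of_hasEigenvector (μ := (q : ℂ))
    ⟨Module.End.mem_eigenspace_iff.2 (tensorAct_proj10_of_mem hq hα), h0⟩, eval_typePoly hp hq]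
  split_ifs <;> simp

theorem forall_of_forall_formsPQ {J : V →L[ℝ] V} (hJ : ∀ x, J (J x) = -x) {k : ℕ}
    (S : Submodule ℂ (Form V k)) (h : ∀ p ≤ k, ∀ α ∈ formsPQ J k p, α ∈ S) (α : Form V k) :
    α ∈ S := by
  have : (⊤ : Submodule ℂ (Form V k)) ≤ S := by
    rw [← iSup_formsPQ hJ k]
    exact iSup_le fun p α hα => h p (by omega) α hα
  exact this trivial

theorem aeval_typePoly_mem {J : V →L[ℝ] V} (hJ : ∀ x, J (J x) = -x) {k p : ℕ} (hp : p ≤ k)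
    (α : Form V k) :
    Polynomial.aeval (tensorAct (proj10 J) k) (typePoly k p) α ∈ formsPQ J k p := by
  refine forall_of_forall_formsPQ hJ ((formsPQ J k p).comap _) (fun q hq β hβ => ?_) α
  rw [Submodule.mem_comap, aeval_typePoly_of_mem hp hq hβ]
  split_ifs with h
  · exact h ▸ hβ
  · exact Submodule.zero_mem _

/-- The converse holds because the Lagrange polynomial evaluates to 1 on an eigenvector of
eigenvalue p, while its values always lie in the span. Type questions thus become eigenvalue
equations. -/
theorem mem_formsPQ_iff {J : V →L[ℝ] V} (hJ : ∀ x, J (J x) = -x) {k p : ℕ} (hp : p ≤ k)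
    {α : Form V k} : α ∈ formsPQ J k p ↔ tensorAct (proj10 J) k α = (p : ℂ) • α := by
  refine ⟨tensorAct_proj10_of_mem hp, fun h => ?_⟩
  by_cases h0 : α = 0
  · rw [h0]; exact Submodule.zero_mem _
  have := aeval_typePoly_mem hJ hp α
  rwa [Module.End.aeval_apply_of_hasEigenvector (μ := (p : ℂ))
    ⟨Module.End.mem_eigenspace_iff.2 h, h0⟩, eval_typePoly hp hp, if_pos rfl, one_smul] at this

theorem isCompl_formsPQ {J : V →L[ℝ] V} (hJ : ∀ x, J (J x) = -x) {k p : ℕ} (hp : p ≤ k) :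
    IsCompl (formsPQ J k p) (⨆ p' ∈ (Finset.range (k + 1)).erase p, formsPQ J k p') := by
  constructor
  · rw [Submodule.disjoint_def]
    intro α h h'
    have h1 := aeval_typePoly_of_mem hp hp h
    rw [if_pos rfl] at h1
    rw [← h1]
    suffices (⨆ p' ∈ (Finset.range (k + 1)).erase p, formsPQ J k p') ≤
      LinearMap.ker (Polynomial.aeval (tensorAct (proj10 J) k) (typePoly k p)) from this h'
    refine iSup₂_le fun q hq β hβ => ?_
    rw [Finset.mem_erase, Finset.mem_range] at hq
    rw [LinearMap.mem_ker, aeval_typePoly_of_mem hp (by omega) hβ, if_neg (Ne.symm hq.1)]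
  · rw [codisjoint_iff, eq_top_iff]
    intro α _
    refine forall_of_forall_formsPQ hJ _ (fun q hq β hβ => ?_) α
    by_cases h : q = p
    · exact Submodule.mem_sup_left (h ▸ hβ)
    · refine Submodule.mem_sup_right (Submodule.mem_iSup_of_mem q
        (Submodule.mem_iSup_of_mem ?_ hβ))
      rw [Finset.mem_erase, Finset.mem_range]
      omega

/-- This removes the choice of complements from the projection: its dependence on J is now
polynomial, whence smoothness and commutation with the connection. -/
theorem projPQ_eq_aeval {J : V →L[ℝ] V} (hJ : ∀ x, J (J x) = -x) {k p : ℕ} (hp : p ≤ k) :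
    projPQ J k p = Polynomial.aeval (tensorAct (proj10 J) k) (typePoly k p) := by
  ext1 α
  rw [← LinearMap.mem_eqLocus]
  refine forall_of_forall_formsPQ hJ _ (fun q hq β hβ => ?_) α
  rw [LinearMap.mem_eqLocus, aeval_typePoly_of_mem hp hq hβ, projPQ, projAlong,
    dif_pos (isCompl_formsPQ hJ hp)]
  split_ifs with h
  · exact Submodule.projection_apply_of_mem_left _ (h ▸ hβ)
  · refine Submodule.projection_apply_of_mem_right _ (Submodule.mem_iSup_of_mem q
        (Submodule.mem_iSup_of_mem ?_ hβ))
    rw [Finset.mem_erase, Finset.mem_range]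
    omega

theorem projPQ_mem {J : V →L[ℝ] V} (hJ : ∀ x, J (J x) = -x) {k p : ℕ} (hp : p ≤ k)
    (α : Form V k) : projPQ J k p α ∈ formsPQ J k p := by
  rw [projPQ_eq_aeval hJ hp]
  exact aeval_typePoly_mem hJ hp α

theorem projPQ_of_mem {J : V →L[ℝ] V} (hJ : ∀ x, J (J x) = -x) {k p q : ℕ} (hp : p ≤ k)
    (hq : q ≤ k) {α : Form V k} (hα : α ∈ formsPQ J k q) :
    projPQ J k p α = if p = q then α else 0 := by
  rw [projPQ_eq_aeval hJ hp, aeval_typePoly_of_mem hp hq hα]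

theorem sum_projPQ {J : V →L[ℝ] V} (hJ : ∀ x, J (J x) = -x) {k : ℕ} (α : Form V k) :
    ∑ p ∈ Finset.range (k + 1), projPQ J k p α = α := by
  have h := forall_of_forall_formsPQ hJ
    (LinearMap.eqLocus (∑ p ∈ Finset.range (k + 1), projPQ J k p) LinearMap.id)
    (fun q hq β hβ => ?_) α
  · simpa [LinearMap.mem_eqLocus] using h
  · rw [LinearMap.mem_eqLocus, LinearMap.sum_apply, Finset.sum_congr rfl fun p hp =>
      projPQ_of_mem hJ (Nat.lt_succ_iff.1 (Finset.mem_range.1 hp)) hq hβ]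
    simp [hq]

end Types

/-! ### Sesquilinear forms on k-forms induced by a matrix -/

section Metric

variable {V : Type*} [NormedAddCommGroup V] [NormedSpace ℝ V] [FiniteDimensional ℝ V]

/-- Square complex matrices indexed by the standard basis of `V`. -/
abbrev FrameMatrix (V : Type*) [NormedAddCommGroup V] [NormedSpace ℝ V] :=
  Matrix (Fin (Module.finrank ℝ V)) (Fin (Module.finrank ℝ V)) ℂ

/-- The component of `α` at the multi-index `f`. -/
def component {k : ℕ} (f : Fin k → Fin (Module.finrank ℝ V)) : Form V k →ₗ[ℂ] ℂ where
  toFun α := α fun l => Module.finBasis ℝ V (f l)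
  map_add' _ _ := rfl
  map_smul' _ _ := rfl

theorem form_ext {k : ℕ} {α β : Form V k} (h : ∀ f, component f α = component f β) : α = β := by
  have := Module.Basis.ext_multilinear (f := α.toMultilinearMap)
    (g := β.toMultilinearMap) (fun _ => Module.finBasis ℝ V) h
  ext x
  exact DFunLike.congr_fun this x

instance (k : ℕ) : FiniteDimensional ℂ (Form V k) :=
  Module.Finite.of_injective (LinearMap.pi fun f : Fin k → Fin (Module.finrank ℝ V) =>
    component f) fun _ _ h => form_ext fun f => congrFun h f

/-- The sesquilinear form on `k`-forms induced by a matrix. -/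
def tensorForm (G : FrameMatrix V) {k : ℕ} (α β : Form V k) : ℂ :=
  ∑ f, ∑ e, (∏ l, G (f l) (e l)) * component f α * (starRingEnd ℂ) (component e β)

/-- The variation of `tensorForm` in the `m`-th slot. -/
def slotForm (G K : FrameMatrix V) {k : ℕ} (m : Fin k) (α β : Form V k) : ℂ :=
  ∑ f, ∑ e, ((∏ l ∈ Finset.univ.erase m, G (f l) (e l)) * K (f m) (e m)) * component f α *
    (starRingEnd ℂ) (component e β)

/-- The matrix of an endomorphism of the space of covectors. -/
def covecMatrix (A : Covec V →L[ℂ] Covec V) : FrameMatrix V :=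
  Matrix.of fun a c => A (coframe V a) (Module.finBasis ℝ V c)

theorem component_tensorAct (A : Covec V →L[ℂ] Covec V) {k : ℕ}
    (f : Fin k → Fin (Module.finrank ℝ V)) (α : Form V k) :
    component f (tensorAct A k α) =
      ∑ m, ∑ a, covecMatrix A a (f m) * component (Function.update f m a) α := by
  change tensorAct A k α _ = _
  rw [tensorAct_apply]
  refine Finset.sum_congr rfl fun m _ => Finset.sum_congr rfl fun a _ => ?_
  simp only [covecMatrix, Matrix.of_apply]
  congr 1
  change α _ = α _
  congr 1
  ext l
  rcases eq_or_ne l m with rfl | h <;> simp [*]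

theorem tensorForm_tensorAct_left (G : FrameMatrix V) (A : Covec V →L[ℂ] Covec V) {k : ℕ}
    (α β : Form V k) :
    tensorForm G (tensorAct A k α) β = ∑ m, slotForm G (covecMatrix A * G) m α β := by
  simp only [tensorForm, slotForm, component_tensorAct]
  have h1 : ∀ f e : Fin k → Fin (Module.finrank ℝ V), (∏ l, G (f l) (e l)) *
      (∑ m, ∑ a, covecMatrix A a (f m) * component (Function.update f m a) α) *
      (starRingEnd ℂ) (component e β) = ∑ m, ∑ a,
        (∏ l ∈ Finset.univ.erase m, G (f l) (e l)) * G (f m) (e m) * covecMatrix A a (f m) *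
        component (Function.update f m a) α * (starRingEnd ℂ) (component e β) := by
    intro f e
    rw [Finset.mul_sum, Finset.sum_mul]
    refine Finset.sum_congr rfl fun m _ => ?_
    rw [Finset.mul_sum, Finset.sum_mul]
    refine Finset.sum_congr rfl fun a _ => ?_
    rw [← Finset.prod_erase_mul _ _ (Finset.mem_univ m)]
    ring
  simp only [h1]
  have h2 : ∀ f : Fin k → Fin (Module.finrank ℝ V), ∑ e : Fin k → Fin (Module.finrank ℝ V),
      ∑ m, ∑ a, (∏ l ∈ Finset.univ.erase m, G (f l) (e l)) * G (f m) (e m) *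
        covecMatrix A a (f m) * component (Function.update f m a) α *
          (starRingEnd ℂ) (component e β) =
      ∑ m, ∑ a, ∑ e : Fin k → Fin (Module.finrank ℝ V),
      (∏ l ∈ Finset.univ.erase m, G (f l) (e l)) * G (f m) (e m) *
        covecMatrix A a (f m) * component (Function.update f m a) α *
          (starRingEnd ℂ) (component e β) := by
    intro f
    rw [Finset.sum_comm]
    exact Finset.sum_congr rfl fun m _ => Finset.sum_comm
  simp only [h2]
  rw [Finset.sum_comm]
  refine Finset.sum_congr rfl fun m _ => ?_
  have h3 : ∀ f e : Fin k → Fin (Module.finrank ℝ V),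
      (∏ l ∈ Finset.univ.erase m, G (f l) (e l)) * (covecMatrix A * G) (f m) (e m) *
        component f α * (starRingEnd ℂ) (component e β) =
      ∑ c, (∏ l ∈ Finset.univ.erase m, G (f l) (e l)) * (covecMatrix A (f m) c * G c (e m)) *
        component f α * (starRingEnd ℂ) (component e β) := by
    intro f e
    rw [Matrix.mul_apply, Finset.mul_sum, Finset.sum_mul, Finset.sum_mul]
  simp only [h3]
  have h4 : ∀ f : Fin k → Fin (Module.finrank ℝ V), ∑ e : Fin k → Fin (Module.finrank ℝ V),
      ∑ c, (∏ l ∈ Finset.univ.erase m, G (f l) (e l)) * (covecMatrix A (f m) c * G c (e m)) *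
        component f α * (starRingEnd ℂ) (component e β) =
      ∑ c, ∑ e : Fin k → Fin (Module.finrank ℝ V),
      (∏ l ∈ Finset.univ.erase m, G (f l) (e l)) * (covecMatrix A (f m) c * G c (e m)) *
        component f α * (starRingEnd ℂ) (component e β) := fun f => Finset.sum_comm
  simp only [h4]
  refine (Finset.sum_product' _ _ _).symm.trans
    (Eq.trans ?_ (Finset.sum_product' Finset.univ Finset.univ _))
  -- The value of `f` at `m` and the summation index `a` trade places; this involution turns
  -- substitution into α into multiplication of `G` by the matrix of `A`.
  refine Finset.sum_nbij' (fun p => (Function.update p.1 m p.2, p.1 m))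
    (fun p => (Function.update p.1 m p.2, p.1 m)) (by simp) (by simp) (by simp) (by simp) ?_
  rintro ⟨f, a⟩ -
  refine Finset.sum_congr rfl fun e _ => ?_
  have h5 : ∏ l ∈ Finset.univ.erase m, G (Function.update f m a l) (e l) =
      ∏ l ∈ Finset.univ.erase m, G (f l) (e l) :=
    Finset.prod_congr rfl fun l hl => by rw [Function.update_of_ne (Finset.ne_of_mem_erase hl)]
  simp only [h5, Function.update_self]
  ring

theorem tensorForm_conj {G : FrameMatrix V} (hG : G.IsHermitian) {k : ℕ} (α β : Form V k) :
    (starRingEnd ℂ) (tensorForm G α β) = tensorForm G β α := by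
  simp only [tensorForm, map_sum, map_mul, map_prod, Complex.conj_conj]
  rw [Finset.sum_comm]
  refine Finset.sum_congr rfl fun f _ => Finset.sum_congr rfl fun e _ => ?_
  have : ∀ a c, (starRingEnd ℂ) (G a c) = G c a := fun a c => hG.apply c a
  simp only [this]
  ring

theorem slotForm_conj {G : FrameMatrix V} (hG : G.IsHermitian) (K : FrameMatrix V) {k : ℕ}
    (m : Fin k) (α β : Form V k) :
    (starRingEnd ℂ) (slotForm G K m α β) = slotForm G K.conjTranspose m β α := by
  simp only [slotForm, map_sum, map_mul, map_prod, Complex.conj_conj]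
  rw [Finset.sum_comm]
  refine Finset.sum_congr rfl fun f _ => Finset.sum_congr rfl fun e _ => ?_
  have : ∀ a c, (starRingEnd ℂ) (G a c) = G c a := fun a c => hG.apply c a
  simp only [this, Matrix.conjTranspose_apply, RCLike.star_def]
  ring

theorem tensorForm_tensorAct_right {G : FrameMatrix V} (hG : G.IsHermitian)
    (B : Covec V →L[ℂ] Covec V) {k : ℕ} (α β : Form V k) :
    tensorForm G α (tensorAct B k β) =
      ∑ m, slotForm G (G * (covecMatrix B).conjTranspose) m α β := by
  rw [← tensorForm_conj hG, tensorForm_tensorAct_left, map_sum]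
  refine Finset.sum_congr rfl fun m _ => ?_
  rw [slotForm_conj hG, Matrix.conjTranspose_mul, hG.eq]

/-- `B` is adjoint to `A` for the sesquilinear form induced by `G`. -/
theorem tensorForm_adjoint {G : FrameMatrix V} (hG : G.IsHermitian)
    {A B : Covec V →L[ℂ] Covec V}
    (h : covecMatrix A * G = G * (covecMatrix B).conjTranspose) {k : ℕ} (α β : Form V k) :
    tensorForm G (tensorAct A k α) β = tensorForm G α (tensorAct B k β) := by
  rw [tensorForm_tensorAct_left, tensorForm_tensorAct_right hG, h]

theorem tensorForm_add_left (G : FrameMatrix V) {k : ℕ} (α α' β : Form V k) :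
    tensorForm G (α + α') β = tensorForm G α β + tensorForm G α' β := by
  simp [tensorForm, mul_add, add_mul, Finset.sum_add_distrib]

theorem tensorForm_smul_left (G : FrameMatrix V) {k : ℕ} (z : ℂ) (α β : Form V k) :
    tensorForm G (z • α) β = z * tensorForm G α β := by
  simp only [tensorForm, map_smul, smul_eq_mul, Finset.mul_sum]
  exact Finset.sum_congr rfl fun f _ => Finset.sum_congr rfl fun e _ => by ring

/-- Writing G = CᵀC turns the form into a sum of squares |S_r|², with S the transform of the
components of α by the k-fold tensor power of C. -/
theorem tensorForm_pos {G g : Matrix (Fin (Module.finrank ℝ V)) (Fin (Module.finrank ℝ V)) ℝ}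
    (hG : G.PosSemidef) (hg : G * g = 1) {k : ℕ} {α : Form V k} (hα : α ≠ 0) :
    0 < (tensorForm (G.map Complex.ofReal) α α).re := by
  obtain ⟨N, C, hC⟩ := Matrix.posSemidef_iff_eq_sum_vecMulVec.1 hG
  have hC' : ∀ a c, ((G a c : ℝ) : ℂ) = ∑ r, (C r a : ℂ) * (C r c : ℂ) := by
    intro a c
    rw [hC, Matrix.sum_apply]
    push_cast
    simp [Matrix.vecMulVec_apply]
  set S : (Fin k → Fin N) → ℂ := fun r => ∑ f, (∏ l, (C (r l) (f l) : ℂ)) * component f α with hS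
  have h1 : tensorForm (G.map Complex.ofReal) α α = ∑ r, S r * (starRingEnd ℂ) (S r) := by
    simp only [hS, map_sum, Finset.sum_mul_sum]
    rw [Finset.sum_comm, tensorForm]
    refine Finset.sum_congr rfl fun f _ => ?_
    rw [Finset.sum_comm]
    refine Finset.sum_congr rfl fun e _ => ?_
    simp only [Matrix.map_apply, hC', Finset.prod_univ_sum, Fintype.piFinset_univ,
      Finset.prod_mul_distrib, Finset.sum_mul, map_mul, map_prod, Complex.conj_ofReal]
    exact Finset.sum_congr rfl fun r _ => by ring
  have h2 : (tensorForm (G.map Complex.ofReal) α α).re = ∑ r, Complex.normSq (S r) := by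
    rw [h1, Complex.re_sum]
    exact Finset.sum_congr rfl fun r _ => by rw [Complex.mul_conj, Complex.ofReal_re]
  rw [h2]
  refine lt_of_le_of_ne (Finset.sum_nonneg fun r _ => Complex.normSq_nonneg _) fun h0 => hα ?_
  rw [eq_comm, Finset.sum_eq_zero_iff_of_nonneg fun r _ => Complex.normSq_nonneg _] at h0
  have h3 : ∀ r, S r = 0 := fun r => Complex.normSq_eq_zero.1 (h0 r (Finset.mem_univ r))
  refine form_ext fun e => ?_
  rw [map_zero]
  -- The matrix gᵀCᵀ is a left inverse of C, as Gg = 1. Its tensor power recovers α from S, so S = 0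
  -- forces α = 0.
  have h4 : ∀ a c, ∑ r, (∑ b, (g b c : ℂ) * C r b) * (C r a : ℂ) = if a = c then 1 else 0 := by
    intro a c
    have := congrFun (congrFun hg a) c
    rw [Matrix.mul_apply, Matrix.one_apply] at this
    have h5 := congrArg (Complex.ofReal) this
    have h7 : ((if a = c then (1 : ℝ) else 0 : ℝ) : ℂ) = if a = c then 1 else 0 := by
      split_ifs <;> simp
    rw [h7] at h5
    push_cast at h5
    simp only [hC'] at h5
    rw [← h5]
    simp only [Finset.sum_mul]
    rw [Finset.sum_comm]
    exact Finset.sum_congr rfl fun r _ => Finset.sum_congr rfl fun b _ => by ring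
  have h6 : ∑ r, (∏ l, ∑ b, (g b (e l) : ℂ) * C (r l) b) * S r = component e α := by
    simp only [hS, Finset.mul_sum]
    rw [Finset.sum_comm]
    have : ∀ f : Fin k → Fin (Module.finrank ℝ V), ∑ r : Fin k → Fin N,
        (∏ l, ∑ b, (g b (e l) : ℂ) * C (r l) b) * ((∏ l, (C (r l) (f l) : ℂ)) * component f α) =
        (∏ l, if f l = e l then 1 else 0) * component f α := by
      intro f
      simp only [← mul_assoc, ← Finset.prod_mul_distrib, ← Finset.sum_mul]
      simp only [← h4, Finset.prod_univ_sum, Fintype.piFinset_univ]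
    simp only [this]
    rw [Finset.sum_eq_single e]
    · simp
    · intro f _ hf
      obtain ⟨l, hl⟩ := Function.ne_iff.1 hf
      rw [Finset.prod_eq_zero (Finset.mem_univ l) (if_neg hl), zero_mul]
    · simp
  rw [← h6]
  simp [h3]

/-- The Gram matrix of `ω(·, J ·)` in the standard basis of `V`. -/
def gram (ω : LinearMap.BilinForm ℝ V) (J : V →L[ℝ] V) :
    Matrix (Fin (Module.finrank ℝ V)) (Fin (Module.finrank ℝ V)) ℝ :=
  Matrix.of fun a c => ω (Module.finBasis ℝ V a) (J (Module.finBasis ℝ V c))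

theorem formInner_eq (ω : LinearMap.BilinForm ℝ V) (J : V →L[ℝ] V) {k : ℕ} (α β : Form V k) :
    formInner ω J α β =
      (1 / (k.factorial : ℂ)) * tensorForm ((gram ω J)⁻¹.map Complex.ofReal) α β := by
  simp only [formInner, tensorForm, Matrix.map_apply]
  push_cast
  rfl

theorem gram_posDef {ω : LinearMap.BilinForm ℝ V} {J : V →L[ℝ] V} (hJ : J ∈ compatibleJ ω) :
    (gram ω J).PosDef := by
  refine Matrix.PosDef.of_dotProduct_mulVec_pos ?_ fun x hx => ?_
  · ext a c
    simpa [gram] using hJ.2.1 _ _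
  · set y := (Module.finBasis ℝ V).equivFun.symm x with hy
    have : star x ⬝ᵥ (gram ω J).mulVec x = ω y (J y) := by
      rw [hy]
      simp only [gram, dotProduct, Matrix.mulVec, Module.Basis.equivFun_symm_apply, Finset.mul_sum,
        Matrix.of_apply, map_sum, LinearMap.sum_apply, map_smul, LinearMap.smul_apply, smul_eq_mul,
        Pi.star_apply, star_trivial]
      rw [Finset.sum_comm]
      exact Finset.sum_congr rfl fun _ _ => Finset.sum_congr rfl fun _ _ => by ring
    rw [this]
    exact hJ.2.2 y ((LinearEquiv.map_ne_zero_iff _).2 hx)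

end Metric

/-! ### Wirtinger calculus for vector valued functions -/

section Analysis

variable {E : Type*} [NormedAddCommGroup E] [NormedSpace ℂ E]
variable {W : Type*} [NormedAddCommGroup W] [NormedSpace ℂ W]
variable {F : Type*} [NormedAddCommGroup F] [NormedSpace ℂ F]

/-- The combination `(D_v + c D_{iv}) / 2`; it is `D^{1,0}` for `c = -i` and `D^{0,1}` for
`c = i`. -/
def wirtinger (c : ℂ) (D : Conn E W) : Conn E W :=
  fun u t v => (1 / 2 : ℂ) • (D u t v + c • D u t (Complex.I • v))

theorem part10_eq_wirtinger (D : Conn E W) : part10 D = wirtinger (-Complex.I) D := by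
  funext u t v
  simp [part10, wirtinger, sub_eq_add_neg]

theorem part01_eq_wirtinger (D : Conn E W) : part01 D = wirtinger Complex.I D := rfl

/-- The derivative `∂_v`. -/
abbrev dz (f : E → F) (t v : E) : F := part10 trivialConn f t v

/-- The derivative `∂̄_v`. -/
abbrev dzbar (f : E → F) (t v : E) : F := part01 trivialConn f t v

theorem dz_add_dzbar (f : E → F) (t v : E) : dz f t v + dzbar f t v = fderiv ℝ f t v := by
  simp only [dz, dzbar, part10, part01, trivialConn]
  module

theorem I_smul_I_smul (v : E) : Complex.I • Complex.I • v = -v := by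
  rw [smul_smul, Complex.I_mul_I, neg_one_smul]

theorem dz_add_dir (f : E → F) (t v w : E) : dz f t (v + w) = dz f t v + dz f t w := by
  simp only [dz, part10, trivialConn, smul_add, map_add]
  module

theorem dzbar_add_dir (f : E → F) (t v w : E) : dzbar f t (v + w) = dzbar f t v + dzbar f t w := by
  simp only [dzbar, part01, trivialConn, smul_add, map_add]
  module

theorem dz_I_smul (f : E → F) (t v : E) : dz f t (Complex.I • v) = Complex.I • dz f t v := by
  simp only [dz, part10, trivialConn, I_smul_I_smul, map_neg]
  match_scalars <;> first
    | ring1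
    | linear_combination (1 / 2 : ℂ) * Complex.I_sq

theorem dzbar_I_smul (f : E → F) (t v : E) :
    dzbar f t (Complex.I • v) = -Complex.I • dzbar f t v := by
  simp only [dzbar, part01, trivialConn, I_smul_I_smul, map_neg]
  match_scalars <;> first
    | ring1
    | linear_combination (1 / 2 : ℂ) * Complex.I_sq

theorem dz_real_smul (f : E → F) (t v : E) (r : ℝ) : dz f t (r • v) = r • dz f t v := by
  simp only [dz, part10, trivialConn, map_smul, smul_comm Complex.I r v]
  simp only [← Complex.coe_smul]
  module

theorem dzbar_real_smul (f : E → F) (t v : E) (r : ℝ) : dzbar f t (r • v) = r • dzbar f t v := by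
  simp only [dzbar, part01, trivialConn, map_smul, smul_comm Complex.I r v]
  simp only [← Complex.coe_smul]
  module

theorem dz_smul_dir (f : E → F) (t v : E) (z : ℂ) : dz f t (z • v) = z • dz f t v := by
  have : z • v = z.re • v + z.im • (Complex.I • v) := by
    conv_lhs => rw [← Complex.re_add_im z]
    rw [add_smul, mul_smul]
    rfl
  rw [this, dz_add_dir, dz_real_smul, dz_real_smul, dz_I_smul]
  conv_rhs => rw [← Complex.re_add_im z]
  rw [add_smul, mul_smul]
  rfl

variable {Ω : Set E}

theorem SmoothOn.contDiffAt (hΩ : IsOpen Ω) {f : E → F} (hf : SmoothOn f Ω) {t : E} (ht : t ∈ Ω) :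
    ContDiffAt ℝ ((⊤ : ℕ∞) : WithTop ℕ∞) f t :=
  ContDiffOn.contDiffAt hf (hΩ.mem_nhds ht)

theorem SmoothOn.differentiableAt (hΩ : IsOpen Ω) {f : E → F} (hf : SmoothOn f Ω) {t : E}
    (ht : t ∈ Ω) : DifferentiableAt ℝ f t :=
  (hf.contDiffAt hΩ ht).differentiableAt (by simp)

theorem SmoothOn.fderiv_apply (hΩ : IsOpen Ω) {f : E → F} (hf : SmoothOn f Ω) (v : E) :
    SmoothOn (fun t => fderiv ℝ f t v) Ω :=
  (ContDiffOn.fderiv_of_isOpen hf hΩ (by simp)).clm_apply contDiffOn_const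

theorem SmoothOn.csmul {f : E → F} (hf : SmoothOn f Ω) (z : ℂ) : SmoothOn (fun t => z • f t) Ω :=
  ContDiffOn.const_smul z hf

theorem SmoothOn.wirtinger (hΩ : IsOpen Ω) {f : E → F} (hf : SmoothOn f Ω) (c : ℂ) (v : E) :
    SmoothOn (fun t => wirtinger c trivialConn f t v) Ω :=
  SmoothOn.csmul (ContDiffOn.add (hf.fderiv_apply hΩ v)
    (SmoothOn.csmul (hf.fderiv_apply hΩ _) c)) _

theorem SmoothOn.dz (hΩ : IsOpen Ω) {f : E → F} (hf : SmoothOn f Ω) (v : E) :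
    SmoothOn (fun t => dz f t v) Ω := by
  simpa only [HiggsJ.dz, part10_eq_wirtinger] using hf.wirtinger hΩ _ v

theorem SmoothOn.dzbar (hΩ : IsOpen Ω) {f : E → F} (hf : SmoothOn f Ω) (v : E) :
    SmoothOn (fun t => dzbar f t v) Ω := hf.wirtinger hΩ _ v

theorem hasFDerivAt_clm_apply {A : E → W →L[ℂ] F} {u : E → W} {t : E} (hA : DifferentiableAt ℝ A t)
    (hu : DifferentiableAt ℝ u t) (v : E) :
    fderiv ℝ (fun s => A s (u s)) t v = fderiv ℝ A t v (u t) + A t (fderiv ℝ u t v) := by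
  have h := ((ContinuousLinearMap.restrictScalarsL ℂ W F ℝ ℝ).hasFDerivAt.comp t
    hA.hasFDerivAt).clm_apply hu.hasFDerivAt
  have h2 := congrArg (fun L : E →L[ℝ] F => L v) h.fderiv
  refine Eq.trans h2 ?_
  simp [add_comm]

theorem SmoothOn.clm_apply {A : E → W →L[ℂ] F} {u : E → W} (hA : SmoothOn A Ω)
    (hu : SmoothOn u Ω) : SmoothOn (fun s => A s (u s)) Ω :=
  ContDiffOn.clm_apply ((ContinuousLinearMap.restrictScalarsL ℂ W F ℝ ℝ).contDiff.comp_contDiffOn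
    hA) hu

theorem wirtinger_clm_apply (c : ℂ) {A : E → W →L[ℂ] F} {u : E → W} {t : E}
    (hA : DifferentiableAt ℝ A t) (hu : DifferentiableAt ℝ u t) (v : E) :
    wirtinger c trivialConn (fun s => A s (u s)) t v =
      wirtinger c trivialConn A t v (u t) + A t (wirtinger c trivialConn u t v) := by
  simp only [wirtinger, trivialConn, hasFDerivAt_clm_apply hA hu, map_smul, map_add,
    smul_apply, add_apply]
  module

theorem wirtinger_mul (c : ℂ) {A B : E → W →L[ℂ] W} {t : E}
    (hA : DifferentiableAt ℝ A t) (hB : DifferentiableAt ℝ B t) (v : E) :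
    wirtinger c trivialConn (fun s => A s * B s) t v =
      wirtinger c trivialConn A t v * B t + A t * wirtinger c trivialConn B t v := by
  have h : ∀ v, fderiv ℝ (fun s => A s * B s) t v =
      fderiv ℝ A t v * B t + A t * fderiv ℝ B t v := by
    intro v
    rw [fderiv_fun_mul' hA hB]
    simp [add_comm]
  simp only [wirtinger, trivialConn, h]
  simp only [smul_add, add_mul, mul_add, smul_mul_assoc, mul_smul_comm]
  abel

theorem wirtinger_sub (c : ℂ) {f g : E → F} {t : E}
    (hf : DifferentiableAt ℝ f t) (hg : DifferentiableAt ℝ g t) (v : E) :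
    wirtinger c trivialConn (fun s => f s - g s) t v =
      wirtinger c trivialConn f t v - wirtinger c trivialConn g t v := by
  simp only [wirtinger, trivialConn, fderiv_fun_sub hf hg, sub_apply]
  module

theorem wirtinger_congr (c : ℂ) {f g : E → F} {t : E} (h : f =ᶠ[nhds t] g) (v : E) :
    wirtinger c trivialConn f t v = wirtinger c trivialConn g t v := by
  simp only [wirtinger, trivialConn, h.fderiv_eq]

theorem fderiv_fderiv_comm (hΩ : IsOpen Ω) {f : E → F} (hf : SmoothOn f Ω) {t : E} (ht : t ∈ Ω)
    (v w : E) : fderiv ℝ (fun s => fderiv ℝ f s w) t v = fderiv ℝ (fun s => fderiv ℝ f s v) t w := by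
  have h1 : DifferentiableAt ℝ (fderiv ℝ f) t :=
    ((hf.contDiffAt hΩ ht).fderiv_right (m := 1) (by norm_cast)).differentiableAt (by simp)
  have h2 : IsSymmSndFDerivAt ℝ f t :=
    (hf.contDiffAt hΩ ht).isSymmSndFDerivAt (by
      simp only [minSmoothness_of_isRCLikeNormedField]; exact WithTop.coe_le_coe.2 (le_top : (2 : ℕ∞) ≤ ⊤))
  have h3 : ∀ v w, fderiv ℝ (fun s => fderiv ℝ f s w) t v = fderiv ℝ (fderiv ℝ f) t v w := by
    intro v w
    rw [fderiv_clm_apply h1 (differentiableAt_const w)]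
    simp
  rw [h3, h3]
  exact h2 v w

/-- Both operators have constant coefficients, so only the symmetry of the real second derivative is
involved. One parameter covers ∂ and ∂̄ alike. -/
theorem wirtinger_comm (hΩ : IsOpen Ω) (c d : ℂ) {f : E → F} (hf : SmoothOn f Ω) {t : E}
    (ht : t ∈ Ω) (v w : E) :
    wirtinger c trivialConn (fun s => wirtinger d trivialConn f s w) t v =
      wirtinger d trivialConn (fun s => wirtinger c trivialConn f s v) t w := by
  have h : ∀ (d : ℂ) (v w : E), fderiv ℝ (fun s => wirtinger d trivialConn f s w) t v =
      (1 / 2 : ℂ) • (fderiv ℝ (fun s => fderiv ℝ f s w) t v +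
        d • fderiv ℝ (fun s => fderiv ℝ f s (Complex.I • w)) t v) := by
    intro d v w
    have h1 := (hf.fderiv_apply hΩ w).differentiableAt hΩ ht
    have h2 := (hf.fderiv_apply hΩ (Complex.I • w)).differentiableAt hΩ ht
    exact congrArg (fun L : E →L[ℝ] F => L v)
      ((h1.hasFDerivAt.add (h2.hasFDerivAt.const_smul d)).const_smul (1 / 2 : ℂ)).fderiv
  simp only [wirtinger, trivialConn] at h ⊢
  simp only [h, fderiv_fderiv_comm hΩ hf ht v w, fderiv_fderiv_comm hΩ hf ht (Complex.I • v) w,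
    fderiv_fderiv_comm hΩ hf ht v (Complex.I • w),
    fderiv_fderiv_comm hΩ hf ht (Complex.I • v) (Complex.I • w)]
  module

end Analysis

/-! ### The Higgs equations for an abstract family of grading operators -/

section Grading

variable {E : Type*} [NormedAddCommGroup E] [NormedSpace ℂ E]
variable {W : Type*} [NormedAddCommGroup W] [NormedSpace ℂ W]

theorem eq_of_sub_eq_neg_sub {M : Type*} [AddCommGroup M] [Module ℂ M] {a b : M}
    (h : a - b = -(a - b)) : a = b := by
  have h2 : (2 : ℂ) • (a - b) = 0 := by
    rw [two_smul]; nth_rewrite 1 [h]; exact neg_add_cancel _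
  exact sub_eq_zero.1 ((smul_eq_zero.1 h2).resolve_left two_ne_zero)

theorem wirtinger_add (c : ℂ) {f g : E → W} {t : E}
    (hf : DifferentiableAt ℝ f t) (hg : DifferentiableAt ℝ g t) (v : E) :
    wirtinger c trivialConn (fun s => f s + g s) t v =
      wirtinger c trivialConn f t v + wirtinger c trivialConn g t v := by
  simp only [wirtinger, trivialConn, fderiv_fun_add hf hg, add_apply]
  module

theorem wirtinger_const_smul (c : ℂ) {z : ℂ} {f : E → W} {t : E} (hf : DifferentiableAt ℝ f t)
    (v : E) : wirtinger c trivialConn (fun s => z • f s) t v =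
      z • wirtinger c trivialConn f t v := by
  simp only [wirtinger, trivialConn, fderiv_fun_const_smul hf, smul_apply]
  module

/-- `N` is a smooth family of endomorphisms of `W` over `Ω` (the grading operators of a family of
Hodge decompositions) such that `∂N` lowers and `∂̄N` raises the degree by one. -/
structure IsGradingFamily (Ω : Set E) (N : E → W →L[ℂ] W) : Prop where
  isOpen : IsOpen Ω
  smooth : SmoothOn N Ω
  lower : ∀ t ∈ Ω, ∀ v : E, N t * dz N t v - dz N t v * N t = -dz N t v
  raise : ∀ t ∈ Ω, ∀ v : E, N t * dzbar N t v - dzbar N t v * N t = dzbar N t v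

/-- The connection `∇ - ∂N + ∂̄N`. -/
def gradedConn (N : E → W →L[ℂ] W) : Conn E W :=
  fun u t v => fderiv ℝ u t v - dz N t v (u t) + dzbar N t v (u t)

namespace IsGradingFamily

variable {Ω : Set E} {N : E → W →L[ℂ] W} (H : IsGradingFamily Ω N)
include H

theorem differentiableAt {t : E} (ht : t ∈ Ω) : DifferentiableAt ℝ N t :=
  H.smooth.differentiableAt H.isOpen ht

theorem differentiableAt_dz {t : E} (ht : t ∈ Ω) (v : E) :
    DifferentiableAt ℝ (fun s => dz N s v) t :=
  (H.smooth.dz H.isOpen v).differentiableAt H.isOpen ht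

theorem differentiableAt_dzbar {t : E} (ht : t ∈ Ω) (v : E) :
    DifferentiableAt ℝ (fun s => dzbar N s v) t :=
  (H.smooth.dzbar H.isOpen v).differentiableAt H.isOpen ht

/-- The relation [N, f] = e f is differentiated by the Leibniz rule. -/
theorem derivation_bracket {c e : ℂ} {δ : Conn E (W →L[ℂ] W)} (hδ : δ = wirtinger c trivialConn)
    {f : E → W →L[ℂ] W} {t : E} (ht : t ∈ Ω) (hf : DifferentiableAt ℝ f t)
    (hb : ∀ s ∈ Ω, N s * f s - f s * N s = e • f s) (v : E) :
    δ N t v * f t - f t * δ N t v + (N t * δ f t v - δ f t v * N t) = e • δ f t v := by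
  subst hδ
  have hN := H.differentiableAt ht
  have h1 := wirtinger_congr c (Filter.eventuallyEq_of_mem (H.isOpen.mem_nhds ht) hb) v
  rw [wirtinger_const_smul c hf,
    wirtinger_sub c (f := fun s => N s * f s) (g := fun s => f s * N s) (hN.mul hf) (hf.mul hN),
    wirtinger_mul c hN hf, wirtinger_mul c hf hN] at h1
  rw [← h1]
  abel

theorem dz_dz_comm {t : E} (ht : t ∈ Ω) (v w : E) :
    dz (fun s => dz N s w) t v = dz (fun s => dz N s v) t w := by
  have := wirtinger_comm H.isOpen (-Complex.I) (-Complex.I) H.smooth ht v w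
  simpa only [dz, part10_eq_wirtinger] using this

theorem dzbar_dzbar_comm {t : E} (ht : t ∈ Ω) (v w : E) :
    dzbar (fun s => dzbar N s w) t v = dzbar (fun s => dzbar N s v) t w :=
  wirtinger_comm H.isOpen Complex.I Complex.I H.smooth ht v w

theorem dzbar_dz_comm {t : E} (ht : t ∈ Ω) (v w : E) :
    dzbar (fun s => dz N s w) t v = dz (fun s => dzbar N s v) t w := by
  have := wirtinger_comm H.isOpen Complex.I (-Complex.I) H.smooth ht v w
  simpa only [dz, dzbar, part10_eq_wirtinger, part01_eq_wirtinger] using this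

theorem dz_dz_bracket {t : E} (ht : t ∈ Ω) (v w : E) :
    dz N t v * dz N t w - dz N t w * dz N t v + (N t * dz (fun s => dz N s w) t v -
      dz (fun s => dz N s w) t v * N t) = (-1 : ℂ) • dz (fun s => dz N s w) t v :=
  H.derivation_bracket (part10_eq_wirtinger _) ht (H.differentiableAt_dz ht w)
    (fun s hs => by rw [H.lower s hs, neg_one_smul]) v

theorem dzbar_dz_bracket {t : E} (ht : t ∈ Ω) (v w : E) :
    dzbar N t v * dz N t w - dz N t w * dzbar N t v + (N t * dzbar (fun s => dz N s w) t v -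
      dzbar (fun s => dz N s w) t v * N t) = (-1 : ℂ) • dzbar (fun s => dz N s w) t v :=
  H.derivation_bracket (part01_eq_wirtinger _) ht (H.differentiableAt_dz ht w)
    (fun s hs => by rw [H.lower s hs, neg_one_smul]) v

theorem dz_dzbar_bracket {t : E} (ht : t ∈ Ω) (v w : E) :
    dz N t v * dzbar N t w - dzbar N t w * dz N t v + (N t * dz (fun s => dzbar N s w) t v -
      dz (fun s => dzbar N s w) t v * N t) = (1 : ℂ) • dz (fun s => dzbar N s w) t v :=
  H.derivation_bracket (part10_eq_wirtinger _) ht (H.differentiableAt_dzbar ht w)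
    (fun s hs => by rw [H.raise s hs, one_smul]) v

theorem dzbar_dzbar_bracket {t : E} (ht : t ∈ Ω) (v w : E) :
    dzbar N t v * dzbar N t w - dzbar N t w * dzbar N t v +
      (N t * dzbar (fun s => dzbar N s w) t v - dzbar (fun s => dzbar N s w) t v * N t) =
        (1 : ℂ) • dzbar (fun s => dzbar N s w) t v :=
  H.derivation_bracket (part01_eq_wirtinger _) ht (H.differentiableAt_dzbar ht w)
    (fun s hs => by rw [H.raise s hs, one_smul]) v

/-- In the differentiated relation the second derivatives are symmetric in v and w, so the
commutator is symmetric too; being antisymmetric, it vanishes. -/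
theorem dz_mul_comm {t : E} (ht : t ∈ Ω) (v w : E) :
    dz N t v * dz N t w = dz N t w * dz N t v := by
  have h1 := H.dz_dz_bracket ht v w
  have h2 := H.dz_dz_bracket ht w v
  rw [H.dz_dz_comm ht v w] at h1
  have h3 := add_right_cancel (h1.trans h2.symm)
  exact eq_of_sub_eq_neg_sub (by rw [neg_sub]; exact h3)

theorem dzbar_mul_comm {t : E} (ht : t ∈ Ω) (v w : E) :
    dzbar N t v * dzbar N t w = dzbar N t w * dzbar N t v := by
  have h1 := H.dzbar_dzbar_bracket ht v w
  have h2 := H.dzbar_dzbar_bracket ht w v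
  rw [H.dzbar_dzbar_comm ht v w] at h1
  have h3 := add_right_cancel (h1.trans h2.symm)
  exact eq_of_sub_eq_neg_sub (by rw [neg_sub]; exact h3)

/-- With X the mixed derivative, ∂̄ of the lowering relation and ∂ of the raising relation give [N,
X] = -X - [∂̄_v N, ∂_w N] and [N, X] = X - [∂_w N, ∂̄_v N]; their difference determines X. -/
theorem dzbar_dz {t : E} (ht : t ∈ Ω) (v w : E) :
    dzbar (fun s => dz N s w) t v = dz N t w * dzbar N t v - dzbar N t v * dz N t w := by
  have h1 := H.dzbar_dz_bracket ht v w
  have h2 := H.dz_dzbar_bracket ht w v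
  rw [← H.dzbar_dz_comm ht v w, one_smul] at h2
  rw [neg_one_smul] at h1
  generalize dzbar (fun s => dz N s w) t v = X at h1 h2 ⊢
  generalize dzbar N t v * dz N t w = a at h1 h2 ⊢
  generalize dz N t w * dzbar N t v = b at h1 h2 ⊢
  have h3 : (2 : ℂ) • X = (2 : ℂ) • (b - a) := by
    have h4 : N t * X - X * N t = -X - (a - b) := by rw [← h1]; abel
    rw [h4] at h2
    rw [two_smul, two_smul]
    nth_rewrite 1 [← h2]
    abel
  exact smul_right_injective _ (two_ne_zero (α := ℂ)) h3

/-- The correction -∂N + ∂̄N has commutator -∂N - ∂̄N with N, which cancels the derivative of N. -/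
theorem gradedConn_grading {u : E → W} (hu : SmoothOn u Ω) {t : E} (ht : t ∈ Ω) (v : E) :
    gradedConn N (fun s => N s (u s)) t v = N t (gradedConn N u t v) := by
  have h1 := DFunLike.congr_fun (H.lower t ht v) (u t)
  have h2 := DFunLike.congr_fun (H.raise t ht v) (u t)
  simp only [sub_apply, neg_apply, mul_apply_eq_comp] at h1 h2
  rw [gradedConn, gradedConn, hasFDerivAt_clm_apply (H.differentiableAt ht)
    (hu.differentiableAt H.isOpen ht), ← dz_add_dzbar]
  simp only [map_add, map_sub, add_apply]
  rw [sub_eq_iff_eq_add] at h1 h2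
  rw [h1, h2]
  abel

theorem smoothOn_gradedConn {u : E → W} (hu : SmoothOn u Ω) (v : E) :
    SmoothOn (fun t => gradedConn N u t v) Ω :=
  ((hu.fderiv_apply H.isOpen v).sub ((H.smooth.dz H.isOpen v).clm_apply hu)).add
    ((H.smooth.dzbar H.isOpen v).clm_apply hu)

theorem smoothOn_pow (n : ℕ) : SmoothOn (fun t => N t ^ n) Ω :=
  H.smooth.pow n

theorem gradedConn_pow (n : ℕ) {u : E → W} (hu : SmoothOn u Ω) {t : E} (ht : t ∈ Ω) (v : E) :
    gradedConn N (fun s => (N s ^ n) (u s)) t v = (N t ^ n) (gradedConn N u t v) := by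
  induction n with
  | zero => simp
  | succ n ih =>
    simp only [pow_succ', mul_apply_eq_comp]
    rw [H.gradedConn_grading ((H.smoothOn_pow n).clm_apply hu) ht, ih]

theorem isConnection_gradedConn : IsConnection Ω (gradedConn N) where
  smooth u hu v := H.smoothOn_gradedConn hu v
  map_add_dir u hu t ht v w := by
    simp only [gradedConn, map_add, dz_add_dir, dzbar_add_dir, add_apply]
    abel
  map_smul_dir u hu t ht r v := by
    simp only [gradedConn, map_smul, dz_real_smul, dzbar_real_smul, smul_apply, smul_add, smul_sub]
  map_add u w hu hw t ht v := by
    simp only [gradedConn, map_add]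
    rw [fderiv_fun_add (hu.differentiableAt H.isOpen ht) (hw.differentiableAt H.isOpen ht)]
    simp only [add_apply]
    abel
  leibniz f u hf hu t ht v := by
    simp only [gradedConn, map_smul]
    rw [fderiv_fun_smul (hf.differentiableAt H.isOpen ht) (hu.differentiableAt H.isOpen ht)]
    simp only [add_apply, smul_apply, ContinuousLinearMap.smulRight_apply, smul_add, smul_sub]
    abel

omit H in
theorem part10_gradedConn (u : E → W) (t v : E) :
    part10 (gradedConn N) u t v = dz u t v - dz N t v (u t) := by
  have h : part10 (gradedConn N) u t v = (1 / 2 : ℂ) • (gradedConn N u t v -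
    Complex.I • gradedConn N u t (Complex.I • v)) := rfl
  rw [h]
  simp only [gradedConn, ← dz_add_dzbar, dz_I_smul, dzbar_I_smul, smul_apply]
  match_scalars <;> first
    | ring1
    | linear_combination (1 / 2 : ℂ) * Complex.I_sq
    | linear_combination (-1 / 2 : ℂ) * Complex.I_sq

omit H in
theorem part01_gradedConn (u : E → W) (t v : E) :
    part01 (gradedConn N) u t v = dzbar u t v + dzbar N t v (u t) := by
  have h : part01 (gradedConn N) u t v = (1 / 2 : ℂ) • (gradedConn N u t v +
    Complex.I • gradedConn N u t (Complex.I • v)) := rfl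
  rw [h]
  simp only [gradedConn, ← dz_add_dzbar, dz_I_smul, dzbar_I_smul, smul_apply]
  match_scalars <;> first
    | ring1
    | linear_combination (1 / 2 : ℂ) * Complex.I_sq
    | linear_combination (-1 / 2 : ℂ) * Complex.I_sq

variable {D : Conn E W}
  (hD : ∀ u : E → W, SmoothOn u Ω → ∀ t ∈ Ω, ∀ v : E, D u t v = gradedConn N u t v)
include hD

/-- The connection `hodgeConn` is known to agree with `gradedConn` only on smooth sections and at
points of Ω, so the results are proved for any `D` with this agreement. -/
theorem isConnection : IsConnection Ω D where
  smooth u hu v := (H.smoothOn_gradedConn hu v).congr fun t ht => hD u hu t ht v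
  map_add_dir u hu t ht v w := by
    simp only [hD u hu t ht]
    exact H.isConnection_gradedConn.map_add_dir u hu t ht v w
  map_smul_dir u hu t ht r v := by
    simp only [hD u hu t ht]
    exact H.isConnection_gradedConn.map_smul_dir u hu t ht r v
  map_add u w hu hw t ht v := by
    rw [hD _ (hu.add hw) t ht, hD u hu t ht, hD w hw t ht]
    exact H.isConnection_gradedConn.map_add u w hu hw t ht v
  leibniz f u hf hu t ht v := by
    rw [hD (fun s => f s • u s) (ContDiffOn.smul hf hu) t ht, hD u hu t ht]
    exact H.isConnection_gradedConn.leibniz f u hf hu t ht v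

omit H in
theorem part10_eq {u : E → W} (hu : SmoothOn u Ω) {t : E} (ht : t ∈ Ω) (v : E) :
    part10 D u t v = dz u t v - dz N t v (u t) := by
  rw [← part10_gradedConn, part10, part10, hD u hu t ht, hD u hu t ht]

omit H in
theorem part01_eq {u : E → W} (hu : SmoothOn u Ω) {t : E} (ht : t ∈ Ω) (v : E) :
    part01 D u t v = dzbar u t v + dzbar N t v (u t) := by
  rw [← part01_gradedConn, part01, part01, hD u hu t ht, hD u hu t ht]

omit hD in
theorem dzbar_clm_apply {A : E → W →L[ℂ] W} {u : E → W} (hA : SmoothOn A Ω) (hu : SmoothOn u Ω)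
    {t : E} (ht : t ∈ Ω) (v : E) : dzbar (fun s => A s (u s)) t v =
      dzbar A t v (u t) + A t (dzbar u t v) :=
  wirtinger_clm_apply Complex.I (hA.differentiableAt H.isOpen ht) (hu.differentiableAt H.isOpen ht) v

omit hD in
theorem dz_clm_apply {A : E → W →L[ℂ] W} {u : E → W} (hA : SmoothOn A Ω) (hu : SmoothOn u Ω)
    {t : E} (ht : t ∈ Ω) (v : E) : dz (fun s => A s (u s)) t v =
      dz A t v (u t) + A t (dz u t v) := by
  have := wirtinger_clm_apply (-Complex.I) (hA.differentiableAt H.isOpen ht)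
    (hu.differentiableAt H.isOpen ht) v
  simpa only [dz, part10_eq_wirtinger] using this

theorem squareZero_part01 : SquareZero Ω (part01 D) := by
  intro u hu t ht v w
  have h : ∀ v w, part01 D (fun s => part01 D u s w) t v =
      dzbar (fun s => dzbar u s w) t v + dzbar (fun s => dzbar N s w) t v (u t) +
        (dzbar N t w (dzbar u t v) + dzbar N t v (dzbar u t w)) +
        (dzbar N t v * dzbar N t w) (u t) := by
    intro v w
    have h1 := hu.dzbar H.isOpen w
    have h2 := (H.smooth.dzbar H.isOpen w).clm_apply hu
    have h3 : SmoothOn (fun s => part01 D u s w) Ω :=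
      (h1.add h2).congr fun s hs => part01_eq hD hu hs w
    rw [part01_eq hD h3 ht, part01_eq hD hu ht]
    have h4 : dzbar (fun s => part01 D u s w) t v =
        dzbar (fun s => dzbar u s w + dzbar N s w (u s)) t v :=
      wirtinger_congr _ (Filter.eventuallyEq_of_mem (H.isOpen.mem_nhds ht)
        fun s hs => part01_eq hD hu hs w) v
    have h5 : dzbar (fun s => dzbar u s w + dzbar N s w (u s)) t v =
        dzbar (fun s => dzbar u s w) t v + dzbar (fun s => dzbar N s w (u s)) t v :=
      wirtinger_add _ (h1.differentiableAt H.isOpen ht) (h2.differentiableAt H.isOpen ht) v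
    rw [h4, h5, H.dzbar_clm_apply (H.smooth.dzbar H.isOpen w) hu ht]
    simp only [map_add, mul_apply_eq_comp]
    abel
  -- Every group in the expansion is symmetric in v and w: second derivatives by Schwarz, the
  -- quadratic term because the ∂̄N commute, the first order terms visibly.
  rw [h v w, h w v, H.dzbar_mul_comm ht v w, H.dzbar_dzbar_comm ht v w,
    add_comm (dzbar N t w (dzbar u t v))]
  congr 3
  exact wirtinger_comm H.isOpen Complex.I Complex.I hu ht v w

/-- The (0,1)-part acts on the field ∂_w N as ∂̄_v + [∂̄_v N, ·], and `dzbar_dz` says that this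
annihilates ∂_w N. -/
theorem holomorphic {u : E → W} (hu : SmoothOn u Ω) {t : E} (ht : t ∈ Ω) (v w : E) :
    part01 D (fun s => dz N s w (u s)) t v = dz N t w (part01 D u t v) := by
  have h1 := H.smooth.dz H.isOpen w
  rw [part01_eq hD (h1.clm_apply hu) ht, part01_eq hD hu ht, H.dzbar_clm_apply h1 hu ht,
    H.dzbar_dz ht]
  simp only [map_add, mul_apply_eq_comp, sub_apply]
  abel

theorem closed {u : E → W} (hu : SmoothOn u Ω) {t : E} (ht : t ∈ Ω) (v w : E) :
    part10 D (fun s => dz N s w (u s)) t v - dz N t w (part10 D u t v) =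
      part10 D (fun s => dz N s v (u s)) t w - dz N t v (part10 D u t w) := by
  -- The commutator of ∂_v N and ∂_w N vanishes, so only the symmetric second derivative of N
  -- remains.
  have h : ∀ v w, part10 D (fun s => dz N s w (u s)) t v - dz N t w (part10 D u t v) =
      dz (fun s => dz N s w) t v (u t) := by
    intro v w
    have h1 := H.smooth.dz H.isOpen w
    have h2 := DFunLike.congr_fun (H.dz_mul_comm ht v w) (u t)
    rw [part10_eq hD (h1.clm_apply hu) ht, part10_eq hD hu ht, H.dz_clm_apply h1 hu ht]
    simp only [map_sub, mul_apply_eq_comp] at h2 ⊢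
    rw [h2]
    abel
  rw [h, h, H.dz_dz_comm ht]

omit hD in
theorem flat {D' : Conn E W}
    (hD' : ∀ u : E → W, SmoothOn u Ω → ∀ t ∈ Ω, ∀ v : E, D' u t v = fderiv ℝ u t v) :
    SquareZero Ω D' := by
  intro u hu t ht v w
  have h : ∀ v w, D' (fun s => D' u s w) t v = fderiv ℝ (fun s => fderiv ℝ u s w) t v := by
    intro v w
    have h3 : SmoothOn (fun s => D' u s w) Ω :=
      (hu.fderiv_apply H.isOpen w).congr fun s hs => hD' u hu s hs w
    rw [hD' _ h3 t ht, (Filter.eventuallyEq_of_mem (H.isOpen.mem_nhds ht)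
        fun s hs => hD' u hu s hs w).fderiv_eq]
  rw [h, h, fderiv_fderiv_comm H.isOpen hu ht]

end IsGradingFamily

end Grading

/-! ### Polynomials in the grading operator and affine functions of J -/

section Polynomial

variable {E : Type*} [NormedAddCommGroup E] [NormedSpace ℂ E]
variable {W : Type*} [NormedAddCommGroup W] [NormedSpace ℂ W]
variable {Ω : Set E} {N : E → W →L[ℂ] W}

theorem gradedConn_const_smul (hN : IsGradingFamily Ω N) (z : ℂ) {u : E → W} (hu : SmoothOn u Ω)
    {t : E} (ht : t ∈ Ω) (v : E) :
    gradedConn N (fun s => z • u s) t v = z • gradedConn N u t v := by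
  simp only [gradedConn]
  rw [fderiv_fun_const_smul (hu.differentiableAt hN.isOpen ht)]
  simp only [smul_apply, map_smul]
  module

theorem IsGradingFamily.aeval (H : IsGradingFamily Ω N) (q : Polynomial ℂ) :
    SmoothOn (fun s => Polynomial.aeval (N s) q) Ω ∧
    ∀ u : E → W, SmoothOn u Ω → ∀ t ∈ Ω, ∀ v : E,
      gradedConn N (fun s => Polynomial.aeval (N s) q (u s)) t v =
        Polynomial.aeval (N t) q (gradedConn N u t v) := by
  induction q using Polynomial.induction_on' with
  | add p q hp hq =>
    simp only [map_add, add_apply]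
    refine ⟨hp.1.add hq.1, fun u hu t ht v => ?_⟩
    rw [H.isConnection_gradedConn.map_add _ _ (hp.1.clm_apply hu) (hq.1.clm_apply hu) t ht,
      hp.2 u hu t ht, hq.2 u hu t ht]
  | monomial n z =>
    simp only [Polynomial.aeval_monomial, ← Algebra.smul_def, smul_apply]
    refine ⟨(H.smoothOn_pow n).csmul z, fun u hu t ht v => ?_⟩
    rw [gradedConn_const_smul H z ((H.smoothOn_pow n).clm_apply hu) ht, H.gradedConn_pow n hu ht]

/-- The projection, the grading operator, the inverse Gram matrix and the defect of symmetry all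
depend on t through real-affine functions of J_t; their smoothness and derivatives are obtained from
this statement. -/
theorem smoothOn_and_fderiv_affine {G : Type*} [NormedAddCommGroup G] [NormedSpace ℝ G]
    [FiniteDimensional ℝ G] (hΩ : IsOpen Ω) {J : E → G}
    (hJ : ContDiffOn ℝ ((⊤ : ℕ∞) : WithTop ℕ∞) J Ω) (Λ : G → W)
    (hadd : ∀ S T, Λ (S + T) = Λ S + Λ T) (hsmul : ∀ (r : ℝ) S, Λ (r • S) = (r : ℂ) • Λ S)
    {f : E → W} (a : W) (z : ℂ) (hf : ∀ s, f s = a + z • Λ (J s)) :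
    SmoothOn f Ω ∧ ∀ t ∈ Ω, ∀ v, fderiv ℝ f t v = z • Λ (fderiv ℝ J t v) := by
  let L : G →L[ℝ] W := LinearMap.toContinuousLinearMap
    { toFun := Λ, map_add' := hadd, map_smul' := hsmul }
  have hL : ∀ S, L S = Λ S := fun _ => rfl
  obtain rfl : f = fun s => a + z • L (J s) := funext hf
  constructor
  · exact contDiffOn_const.add (SmoothOn.csmul (L.contDiff.comp_contDiffOn hJ) z)
  · intro t ht v
    have hd : DifferentiableAt ℝ J t :=
      (hJ.contDiffAt (hΩ.mem_nhds ht)).differentiableAt (by simp)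
    have h := ((L.hasFDerivAt.comp t hd.hasFDerivAt).const_smul z).const_add a
    exact congrArg (fun L : E →L[ℝ] W => L v) h.fderiv

end Polynomial

/-! ### Holomorphic families of compatible complex structures -/

section Family

variable {V : Type*} [NormedAddCommGroup V] [NormedSpace ℝ V] [FiniteDimensional ℝ V]
variable {E : Type*} [NormedAddCommGroup E] [NormedSpace ℂ E]

/-- A holomorphic family of compatible complex structures on `(V, ω)`. -/
structure IsHolomorphicFamily (ω : LinearMap.BilinForm ℝ V) (Ω : Set E) (𝒥 : E → V →L[ℝ] V) :
    Prop where
  isOpen : IsOpen Ω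
  smooth : ContDiffOn ℝ ((⊤ : ℕ∞) : WithTop ℕ∞) 𝒥 Ω
  mem : ∀ t ∈ Ω, 𝒥 t ∈ compatibleJ ω
  holomorphic : ∀ t ∈ Ω, ∀ v : E, fderiv ℝ 𝒥 t (Complex.I • v) = 𝒥 t * fderiv ℝ 𝒥 t v

/-- The `(1,0)`-derivative of the projection to `∧^{1,0}`, for a family of complex structures with
derivative `X` at `J`. -/
def ksOf (J X : V →L[ℝ] V) : Covec V →L[ℂ] Covec V :=
  -(Complex.I / 4) • pull X - (1 / 4 : ℂ) • pull (J * X)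

/-- The complex conjugate of `ksOf`. -/
def ksOfConj (J X : V →L[ℝ] V) : Covec V →L[ℂ] Covec V :=
  (Complex.I / 4) • pull X - (1 / 4 : ℂ) • pull (J * X)

/-- The action of `A` on forms as a continuous linear map. -/
def tensorActL (k : ℕ) (A : Covec V →L[ℂ] Covec V) : Form V k →L[ℂ] Form V k :=
  LinearMap.toContinuousLinearMap (tensorAct A k)

@[simp] theorem tensorActL_apply (k : ℕ) (A : Covec V →L[ℂ] Covec V) (α : Form V k) :
    tensorActL k A α = tensorAct A k α := rfl

theorem tensorActL_add (k : ℕ) (A B : Covec V →L[ℂ] Covec V) :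
    tensorActL k (A + B) = tensorActL k A + tensorActL k B := by
  ext1 α; simp [tensorAct_add]

theorem tensorActL_smul (k : ℕ) (z : ℂ) (A : Covec V →L[ℂ] Covec V) :
    tensorActL k (z • A) = z • tensorActL k A := by
  ext1 α; simp [tensorAct_smul]

theorem tensorActL_sub (k : ℕ) (A B : Covec V →L[ℂ] Covec V) :
    tensorActL k (A - B) = tensorActL k A - tensorActL k B := by
  ext1 α
  exact DFunLike.congr_fun (map_sub (tensorActₗ (V := V) k) A B) α

theorem tensorActL_neg (k : ℕ) (A : Covec V →L[ℂ] Covec V) :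
    tensorActL k (-A) = -tensorActL k A := by
  ext1 α
  exact DFunLike.congr_fun (map_neg (tensorActₗ (V := V) k) A) α

theorem tensorActL_bracket (k : ℕ) (A B : Covec V →L[ℂ] Covec V) :
    tensorActL k A * tensorActL k B - tensorActL k B * tensorActL k A =
      tensorActL k (A * B - B * A) := by
  ext1 α
  exact tensorAct_commutator A B k α

/-- The grading operator of the Hodge decomposition defined by `J`. -/
def grading (𝒥 : E → V →L[ℝ] V) (k : ℕ) (t : E) : Form V k →L[ℂ] Form V k :=
  tensorActL k (proj10 (𝒥 t))

omit [FiniteDimensional ℝ V] in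
theorem proj10_eq (J : V →L[ℝ] V) : proj10 J = (1 / 2 : ℂ) • 1 + -(Complex.I / 2) • pull J := by
  rw [proj10]; module

omit [NormedAddCommGroup E] [NormedSpace ℂ E] in
theorem grading_eq (𝒥 : E → V →L[ℝ] V) (k : ℕ) (t : E) : grading 𝒥 k t =
    tensorActL k ((1 / 2 : ℂ) • 1) + -(Complex.I / 2) • tensorActL k (pull (𝒥 t)) := by
  rw [grading, proj10_eq, tensorActL_add, tensorActL_smul k (-(Complex.I / 2))]

section Algebra

variable {R : Type*} [Ring R] [Algebra ℂ R] {j x P σ σ' : R} (hj : j * j = -1)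
  (hx : j * x = -(x * j)) (hP : P = (1 / 2 : ℂ) • 1 + -(Complex.I / 2) • j)
include hj hx hP

/-- With j and x the pullbacks by J and by its derivative, σ = -(i/2) x P and σ' = (i/2) x (1 - P),
where xP = (1 - P)x by anticommutation. The four products with P follow: σ maps ∧^{1,0} to ∧^{0,1}
and σ' does the reverse. -/
theorem proj_mul_lower (hσ : σ = -(Complex.I / 4) • x - (1 / 4 : ℂ) • (x * j)) : P * σ = 0 := by
  have h1 : j * (x * j) = x := by rw [← mul_assoc, hx, neg_mul, mul_assoc, hj]; simp
  rw [hP, hσ]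
  simp only [add_mul, mul_sub, smul_mul_assoc, mul_smul_comm, one_mul, hx, h1]
  match_scalars <;> first
    | ring1
    | linear_combination (1 / 8 : ℂ) * Complex.I_sq
    | linear_combination (-1 / 8 : ℂ) * Complex.I_sq

omit hx in
theorem lower_mul_proj (hσ : σ = -(Complex.I / 4) • x - (1 / 4 : ℂ) • (x * j)) : σ * P = σ := by
  rw [hP, hσ]
  simp only [mul_add, sub_mul, smul_mul_assoc, mul_smul_comm, mul_one, mul_assoc, hj,
    mul_neg]
  match_scalars <;> first
    | ring1
    | linear_combination (1 / 8 : ℂ) * Complex.I_sq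

theorem proj_mul_raise (hσ : σ' = (Complex.I / 4) • x - (1 / 4 : ℂ) • (x * j)) : P * σ' = σ' := by
  have h1 : j * (x * j) = x := by rw [← mul_assoc, hx, neg_mul, mul_assoc, hj]; simp
  rw [hP, hσ]
  simp only [add_mul, mul_sub, smul_mul_assoc, mul_smul_comm, one_mul, hx, h1]
  match_scalars <;> first
    | ring1
    | linear_combination (1 / 8 : ℂ) * Complex.I_sq

omit hx in
theorem raise_mul_proj (hσ : σ' = (Complex.I / 4) • x - (1 / 4 : ℂ) • (x * j)) : σ' * P = 0 := by
  rw [hP, hσ]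
  simp only [mul_add, sub_mul, smul_mul_assoc, mul_smul_comm, mul_one, mul_assoc, hj,
    mul_neg]
  match_scalars <;> first
    | ring1
    | linear_combination (1 / 8 : ℂ) * Complex.I_sq
    | linear_combination (-1 / 8 : ℂ) * Complex.I_sq

end Algebra

section Brackets

omit [FiniteDimensional ℝ V]

variable {J X : V →L[ℝ] V} (hJ : J * J = -1) (hX : X * J = -(J * X))
include hJ hX

theorem proj10_mul_ksOf : proj10 J * ksOf J X = 0 :=
  proj_mul_lower (j := pull J) (x := pull X) (by rw [pull_mul, hJ, pull_neg, pull_one])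
    (by rw [pull_mul, pull_mul, hX, pull_neg]) (proj10_eq J) rfl

omit hX in
theorem ksOf_mul_proj10 : ksOf J X * proj10 J = ksOf J X :=
  lower_mul_proj (j := pull J) (x := pull X) (by rw [pull_mul, hJ, pull_neg, pull_one])
    (proj10_eq J) rfl

theorem proj10_mul_ksOfConj : proj10 J * ksOfConj J X = ksOfConj J X :=
  proj_mul_raise (j := pull J) (x := pull X) (by rw [pull_mul, hJ, pull_neg, pull_one])
    (by rw [pull_mul, pull_mul, hX, pull_neg]) (proj10_eq J) rfl

omit hX in
theorem ksOfConj_mul_proj10 : ksOfConj J X * proj10 J = 0 :=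
  raise_mul_proj (j := pull J) (x := pull X) (by rw [pull_mul, hJ, pull_neg, pull_one])
    (proj10_eq J) rfl

theorem proj10_bracket_ksOf : proj10 J * ksOf J X - ksOf J X * proj10 J = -ksOf J X := by
  rw [proj10_mul_ksOf hJ hX, ksOf_mul_proj10 hJ]
  exact zero_sub (ksOf J X)

theorem proj10_bracket_ksOfConj :
    proj10 J * ksOfConj J X - ksOfConj J X * proj10 J = ksOfConj J X := by
  rw [proj10_mul_ksOfConj hJ hX, ksOfConj_mul_proj10 hJ]
  exact sub_zero (ksOfConj J X)

end Brackets

namespace IsHolomorphicFamily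

variable {ω : LinearMap.BilinForm ℝ V} {Ω : Set E} {𝒥 : E → V →L[ℝ] V}
  (H : IsHolomorphicFamily ω Ω 𝒥)
include H

omit [FiniteDimensional ℝ V] in
theorem mul_self {t : E} (ht : t ∈ Ω) : 𝒥 t * 𝒥 t = -1 := by
  ext x
  simpa using (H.mem t ht).1 x

omit [FiniteDimensional ℝ V] in
theorem differentiableAt {t : E} (ht : t ∈ Ω) : DifferentiableAt ℝ 𝒥 t :=
  (H.smooth.contDiffAt (H.isOpen.mem_nhds ht)).differentiableAt (by simp)

omit [FiniteDimensional ℝ V] in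
-- The derivative of J² = -1.
theorem fderiv_mul {t : E} (ht : t ∈ Ω) (v : E) :
    fderiv ℝ 𝒥 t v * 𝒥 t = -(𝒥 t * fderiv ℝ 𝒥 t v) := by
  have hd := H.differentiableAt ht
  have h1 : (fun s => 𝒥 s * 𝒥 s) =ᶠ[nhds t] fun _ => -1 :=
    Filter.eventuallyEq_of_mem (H.isOpen.mem_nhds ht) fun s hs => H.mul_self hs
  have h2 := congrArg (fun L : E →L[ℝ] V →L[ℝ] V => L v) h1.fderiv_eq
  rw [fderiv_fun_mul' hd hd] at h2
  rw [eq_neg_iff_add_eq_zero, add_comm]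
  simpa using h2

theorem fderiv_proj10 {t : E} (ht : t ∈ Ω) (v : E) :
    fderiv ℝ (fun s => proj10 (𝒥 s)) t v = -(Complex.I / 2) • pull (fderiv ℝ 𝒥 t v) :=
  (smoothOn_and_fderiv_affine H.isOpen H.smooth pull pull_add pull_smul _ _
    fun s => proj10_eq (𝒥 s)).2 t ht v

theorem smooth_proj10 : SmoothOn (fun s => proj10 (𝒥 s)) Ω :=
  (smoothOn_and_fderiv_affine H.isOpen H.smooth pull pull_add pull_smul _ _
    fun s => proj10_eq (𝒥 s)).1

theorem smooth_grading (k : ℕ) : SmoothOn (grading 𝒥 k) Ω :=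
  (smoothOn_and_fderiv_affine H.isOpen H.smooth (fun S => tensorActL k (pull S))
    (fun S T => by rw [pull_add, tensorActL_add]) (fun r S => by rw [pull_smul, tensorActL_smul])
    _ _ (grading_eq 𝒥 k)).1

theorem fderiv_grading (k : ℕ) {t : E} (ht : t ∈ Ω) (v : E) :
    fderiv ℝ (grading 𝒥 k) t v = -(Complex.I / 2) • tensorActL k (pull (fderiv ℝ 𝒥 t v)) :=
  (smoothOn_and_fderiv_affine H.isOpen H.smooth (fun S => tensorActL k (pull S))
    (fun S T => by rw [pull_add, tensorActL_add]) (fun r S => by rw [pull_smul, tensorActL_smul])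
    _ _ (grading_eq 𝒥 k)).2 t ht v

/-- Holomorphy replaces J'(iv) by J J'(v), so the Wirtinger derivative is expressed by J and J'(v)
alone. -/
theorem dz_proj10 {t : E} (ht : t ∈ Ω) (v : E) :
    dz (fun s => proj10 (𝒥 s)) t v = ksOf (𝒥 t) (fderiv ℝ 𝒥 t v) := by
  rw [dz, part10, trivialConn, trivialConn, H.fderiv_proj10 ht, H.fderiv_proj10 ht,
    H.holomorphic t ht, ksOf]
  match_scalars <;> first | ring1 | linear_combination (1 / 4 : ℂ) * Complex.I_sq

theorem dz_grading (k : ℕ) {t : E} (ht : t ∈ Ω) (v : E) :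
    dz (grading 𝒥 k) t v = tensorActL k (ksOf (𝒥 t) (fderiv ℝ 𝒥 t v)) := by
  rw [dz, part10, trivialConn, trivialConn, H.fderiv_grading k ht, H.fderiv_grading k ht,
    H.holomorphic t ht, ksOf, tensorActL_sub, tensorActL_smul, tensorActL_smul]
  match_scalars <;> first | ring1 | linear_combination (1 / 4 : ℂ) * Complex.I_sq

theorem dzbar_grading (k : ℕ) {t : E} (ht : t ∈ Ω) (v : E) :
    dzbar (grading 𝒥 k) t v = -tensorActL k (ksOfConj (𝒥 t) (fderiv ℝ 𝒥 t v)) := by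
  rw [dzbar, part01, trivialConn, trivialConn, H.fderiv_grading k ht, H.fderiv_grading k ht,
    H.holomorphic t ht, ksOfConj, tensorActL_sub, tensorActL_smul, tensorActL_smul]
  match_scalars <;> first | ring1 | linear_combination (-1 / 4 : ℂ) * Complex.I_sq

theorem isGradingFamily (k : ℕ) : IsGradingFamily Ω (grading 𝒥 k) where
  isOpen := H.isOpen
  smooth := H.smooth_grading k
  lower t ht v := by
    rw [H.dz_grading k ht, grading, tensorActL_bracket,
      proj10_bracket_ksOf (H.mul_self ht) (H.fderiv_mul ht v), tensorActL_neg]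
  raise t ht v := by
    rw [H.dzbar_grading k ht, grading, mul_neg, neg_mul, ← neg_sub', tensorActL_bracket,
      proj10_bracket_ksOfConj (H.mul_self ht) (H.fderiv_mul ht v)]

end IsHolomorphicFamily

end Family

/-! ### The Kodaira–Nirenberg–Spencer tensor -/

section Compl

variable {V : Type*} [NormedAddCommGroup V] [NormedSpace ℝ V] [FiniteDimensional ℝ V]
variable {ω : LinearMap.BilinForm ℝ V} {J J' : V →L[ℝ] V}

/-- For η in the intersection, nondegeneracy writes Re η as ω(y, ·). Then ω(y, J'y) = -Im η(y) and
ω(y, Jy) = Im η(y) cannot both be positive, so y = 0. -/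
theorem disjoint_forms10_forms01 (hω : ω.Nondegenerate) (hJ' : J' ∈ compatibleJ ω)
    (hJ : J ∈ compatibleJ ω) : Disjoint (forms10 J') (forms01 J) := by
  rw [Submodule.disjoint_def]
  intro η h h'
  let a : V →ₗ[ℝ] ℝ := Complex.reLm ∘ₗ η.toLinearMap
  have ha : ∀ x, a x = (η x).re := fun _ => rfl
  obtain ⟨y, hy⟩ : ∃ y, ω y = a :=
    ⟨(LinearMap.BilinForm.toDual ω hω).symm a, by
      ext x; exact LinearMap.BilinForm.apply_toDual_symm_apply (hB := hω) a x⟩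
  have h1 : ω y (J' y) = -(η y).im := by
    rw [hy, ha, h y]; simp
  have h2 : ω y (J y) = (η y).im := by
    rw [hy, ha, h' y]; simp
  have hy0 : y = 0 := by
    by_contra hne
    have := hJ'.2.2 y hne
    have := hJ.2.2 y hne
    linarith
  have hre : ∀ x, (η x).re = 0 := by
    intro x
    rw [← ha, ← hy, hy0]
    simp
  ext x
  refine Complex.ext (hre x) ?_
  have := hre (J x)
  rw [h' x] at this
  simpa using this

theorem isCompl_forms10_forms01 (hω : ω.Nondegenerate) (hJ' : J' ∈ compatibleJ ω)
    (hJ : J ∈ compatibleJ ω) : IsCompl (forms10 J') (forms01 J) := by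
  have hd := disjoint_forms10_forms01 hω hJ' hJ
  have hd' := disjoint_forms10_forms01 hω hJ hJ'
  refine ⟨hd, ?_⟩
  rw [Submodule.disjoint_def] at hd hd'
  -- The values of P'P + (1 - P) lie in the sum of the two subspaces. Disjointness, used for (J', J)
  -- and for (J, J'), makes it injective, hence surjective in finite dimension.
  let B : Covec V →ₗ[ℂ] Covec V := (proj10 J' * proj10 J + (1 - proj10 J)).toLinearMap
  have hB : ∀ η, B η = proj10 J' (proj10 J η) + (η - proj10 J η) := fun _ => rfl
  have hinj : Function.Injective B := by
    rw [injective_iff_map_eq_zero]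
    intro η h
    rw [hB] at h
    have h1 : proj10 J' (proj10 J η) = 0 := by
      refine hd _ (proj10_mem hJ'.1 _) ?_
      rw [eq_neg_of_add_eq_zero_left h]
      exact Submodule.neg_mem _ (sub_proj10_mem hJ.1 η)
    rw [h1, zero_add, sub_eq_zero] at h
    rw [h]
    refine hd' _ (proj10_mem hJ.1 η) ?_
    have := sub_proj10_mem hJ'.1 (proj10 J η)
    rwa [h1, sub_zero] at this
  rw [codisjoint_iff, eq_top_iff]
  intro η _
  obtain ⟨η', rfl⟩ := LinearMap.surjective_of_injective hinj η
  rw [hB]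
  exact Submodule.add_mem_sup (proj10_mem hJ'.1 _) (sub_proj10_mem hJ.1 η')

omit [FiniteDimensional ℝ V] in
theorem projAlong_forms10 (hJ : ∀ x, J (J x) = -x) :
    projAlong (forms10 J) (forms01 J) = (proj10 J).toLinearMap := by
  rw [projAlong, dif_pos (isCompl_forms hJ)]
  ext1 η
  conv_lhs => rw [← add_sub_cancel (proj10 J η) η, map_add,
    Submodule.projection_apply_of_mem_left _ (proj10_mem hJ η),
    Submodule.projection_apply_of_mem_right _ (sub_proj10_mem hJ η), add_zero]
  rfl

omit [FiniteDimensional ℝ V] in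
theorem proj10_mul_self (hJ : ∀ x, J (J x) = -x) : proj10 J * proj10 J = proj10 J := by
  refine ContinuousLinearMap.ext fun η => ?_
  change proj10 J (proj10 J η) = proj10 J η
  rw [proj10_of_mem (proj10_mem hJ η)]

/-- The tensor is characterized by its graph: η + Φη is of type (1,0) for J' whenever η is of type
(1,0) for J. -/
theorem kns_mem (hω : ω.Nondegenerate) (hJ' : J' ∈ compatibleJ ω)
    (hJ : J ∈ compatibleJ ω) (η : Covec V) :
    kns J' J η ∈ forms01 J ∧ proj10 J η + kns J' J η ∈ forms10 J' := by
  have hc := (isCompl_forms10_forms01 hω hJ' hJ).symm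
  have h : kns J' J η = -(Submodule.projection _ _ hc (proj10 J η)) := by
    change (-(projAlong (forms01 J) (forms10 J') ∘ₗ projAlong (forms10 J) (forms01 J))) η = _
    rw [projAlong_forms10 hJ.1, projAlong, dif_pos hc]
    rfl
  rw [h]
  refine ⟨Submodule.neg_mem _ (Submodule.projection_apply_mem _ _), ?_⟩
  have h2 := Submodule.projection_add_projection_eq_self hc (proj10 J η)
  nth_rewrite 1 [← h2]
  rw [add_neg_cancel_comm]
  exact Submodule.projection_apply_mem _ _

theorem kns_eq_of_mem (hω : ω.Nondegenerate) (hJ' : J' ∈ compatibleJ ω)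
    (hJ : J ∈ compatibleJ ω) {η ζ : Covec V} (hη : η ∈ forms10 J) (hζ : ζ ∈ forms01 J)
    (h : η + ζ ∈ forms10 J') : kns J' J η = ζ := by
  obtain ⟨h1, h2⟩ := kns_mem hω hJ' hJ η
  rw [proj10_of_mem hη] at h2
  have hd := disjoint_forms10_forms01 hω hJ' hJ
  rw [Submodule.disjoint_def] at hd
  have h3 := Submodule.sub_mem _ h2 h
  rw [add_sub_add_left_eq_sub] at h3
  exact sub_eq_zero.1 (hd _ h3 (Submodule.sub_mem _ h1 hζ))

/-- The conditions PΦ = 0 and (1 - P')(P + Φ) = 0 combine into one linear equation for Φ whose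
coefficients are affine in P'. At J' = J the left factor is 1 and the right side 0, so Φ can be
differentiated there. -/
theorem kns_mul_eq (hω : ω.Nondegenerate) (hJ' : J' ∈ compatibleJ ω) (hJ : J ∈ compatibleJ ω) :
    (proj10 J + (1 - proj10 J') * (1 - proj10 J)) * kns J' J =
      -((1 - proj10 J') * proj10 J) := by
  ext1 η
  obtain ⟨h1, h2⟩ := kns_mem hω hJ' hJ η
  have h3 := proj10_of_mem h2
  rw [map_add] at h3
  change proj10 J (kns J' J η) + ((kns J' J η - proj10 J (kns J' J η)) -
    proj10 J' (kns J' J η - proj10 J (kns J' J η))) = -(proj10 J η - proj10 J' (proj10 J η))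
  rw [proj10_of_mem01 h1, sub_zero, zero_add, neg_sub, sub_eq_sub_iff_add_eq_add, add_comm, ← h3,
    add_comm]

end Compl

/-! ### Differentiating an implicitly defined operator -/

section Derivative

variable {E : Type*} [NormedAddCommGroup E] [NormedSpace ℝ E]
variable {R : Type*} [NormedRing R] [NormedAlgebra ℝ R] [CompleteSpace R]

/-- If `B Φ = c` near `t` with `B t = 1` and `c t = 0` then `Φ' = c'` at `t`. -/
theorem fderiv_eq_of_mul_eq {B c Φ : E → R} {t : E} (hB : DifferentiableAt ℝ B t)
    (hc : DifferentiableAt ℝ c t) (hB1 : B t = 1) (hc0 : c t = 0)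
    (h : ∀ᶠ s in nhds t, B s * Φ s = c s) : fderiv ℝ Φ t = fderiv ℝ c t := by
  have hu : ∀ᶠ s in nhds t, IsUnit (B s) :=
    hB.continuousAt.eventually_mem (by
      rw [hB1]; exact Units.isOpen.mem_nhds isUnit_one)
  -- Since B is invertible near t, Φ = B⁻¹c there; as c(t) = 0, the derivative of B⁻¹ does not
  -- contribute.
  have hΦ : Φ =ᶠ[nhds t] fun s => Ring.inverse (B s) * c s := by
    filter_upwards [h, hu] with s hs hus
    rw [← hs, ← mul_assoc, Ring.inverse_mul_cancel _ hus, one_mul]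
  have hinv : DifferentiableAt ℝ Ring.inverse (B t) := by
    rw [hB1]; exact (hasFDerivAt_ringInverse (𝕜 := ℝ) (1 : Rˣ)).differentiableAt
  rw [hΦ.fderiv_eq, fderiv_fun_mul' (show DifferentiableAt ℝ (fun s => Ring.inverse (B s)) t from hinv.comp t hB) hc, hc0]
  ext v
  simp [hB1]

/-- The derivative of the map measuring the deviation of the range of the idempotent `P s` from
the range of `P t`. -/
theorem dz_eq_of_mul_eq {E : Type*} [NormedAddCommGroup E] [NormedSpace ℂ E] {R : Type*}
    [NormedRing R] [NormedAlgebra ℂ R] [CompleteSpace R] {P Φ : E → R} {t : E} {p : R}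
    (hP : DifferentiableAt ℝ P t) (hp : P t = p) (hid : p * p = p)
    (h : ∀ᶠ s in nhds t, (p + (1 - P s) * (1 - p)) * Φ s = -((1 - P s) * p)) (v : E) :
    dz Φ t v = dz P t v * p := by
  have h1 : fderiv ℝ Φ t = fderiv ℝ (fun s => -((1 - P s) * p)) t := by
    refine fderiv_eq_of_mul_eq (B := fun s => p + (1 - P s) * (1 - p)) ?_ ?_ ?_ ?_ h
    · exact ((hP.const_sub 1).mul_const _).const_add _
    · exact ((hP.const_sub 1).mul_const _).fun_neg
    · rw [hp, mul_sub, sub_mul, sub_mul, hid]; simp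
    · rw [hp, sub_mul, hid]; simp
  have h2 : ∀ v, fderiv ℝ (fun s => -((1 - P s) * p)) t v = fderiv ℝ P t v * p := by
    intro v
    have := ((((hP.hasFDerivAt).const_sub 1).mul_const' p).fun_neg).fderiv
    refine (congrArg (fun L : E →L[ℝ] R => L v) this).trans ?_
    simp
  rw [dz, part10, trivialConn, trivialConn, h1, h2, h2, dz, part10, trivialConn, trivialConn,
    smul_mul_assoc, sub_mul, smul_mul_assoc]

end Derivative

/-! ### The Higgs field as the derivative of the grading operator -/

section Family

variable {V : Type*} [NormedAddCommGroup V] [NormedSpace ℝ V] [FiniteDimensional ℝ V]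
variable {E : Type*} [NormedAddCommGroup E] [NormedSpace ℂ E]
variable {ω : LinearMap.BilinForm ℝ V} {Ω : Set E} {𝒥 : E → V →L[ℝ] V}

namespace IsHolomorphicFamily

variable (H : IsHolomorphicFamily ω Ω 𝒥)
include H

theorem ksTensor_eq (hω : ω.Nondegenerate) {t : E} (ht : t ∈ Ω) (v : E) :
    ksTensor 𝒥 t v = ksOf (𝒥 t) (fderiv ℝ 𝒥 t v) := by
  -- Differentiating Φ gives (∂P)P, and ∂P already equals (∂P)P.
  rw [← ksOf_mul_proj10 (H.mul_self ht), ← H.dz_proj10 ht]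
  refine dz_eq_of_mul_eq (P := fun s => proj10 (𝒥 s)) (Φ := fun s => kns (𝒥 s) (𝒥 t))
    (H.smooth_proj10.differentiableAt H.isOpen ht) rfl (proj10_mul_self (H.mem t ht).1) ?_ v
  filter_upwards [H.isOpen.mem_nhds ht] with s hs
  exact kns_mul_eq hω (H.mem s hs) (H.mem t ht)

theorem higgsField_eq (hω : ω.Nondegenerate) (k : ℕ) {t : E} (ht : t ∈ Ω) (v : E) (α : Form V k) :
    higgsField 𝒥 k t v α = dz (grading 𝒥 k) t v α := by
  rw [higgsField, H.ksTensor_eq hω ht, H.dz_grading k ht]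
  rfl

end IsHolomorphicFamily

/-- The coframe and the pullbacks by J and X are real, so conjugation only affects the scalar
coefficients. -/
theorem conjForm_tensorAct (J X : V →L[ℝ] V) {k : ℕ} (α : Form V k) :
    conjForm (tensorAct (ksOf J X) k (conjForm α)) = tensorAct (ksOfConj J X) k α := by
  ext x
  change (starRingEnd ℂ) (tensorAct (ksOf J X) k (conjForm α) x) = _
  simp only [tensorAct_apply, map_sum, map_mul]
  refine Finset.sum_congr rfl fun l _ => Finset.sum_congr rfl fun a _ => ?_
  congr 1
  · simp [ksOf, ksOfConj, coframe_apply, map_ofNat]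
    ring
  · exact Complex.conj_conj _

theorem IsHolomorphicFamily.higgsFieldConj_eq (H : IsHolomorphicFamily ω Ω 𝒥)
    (hω : ω.Nondegenerate) (k : ℕ) {t : E} (ht : t ∈ Ω) (v : E) (α : Form V k) :
    higgsFieldConj 𝒥 k t v α = -dzbar (grading 𝒥 k) t v α := by
  rw [higgsFieldConj, higgsField, H.ksTensor_eq hω ht, conjForm_tensorAct, H.dzbar_grading k ht]
  simp

end Family

/-! ### The Hodge connection -/

section HodgeConn

variable {V : Type*} [NormedAddCommGroup V] [NormedSpace ℝ V] [FiniteDimensional ℝ V]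
variable {E : Type*} [NormedAddCommGroup E] [NormedSpace ℂ E]
variable {ω : LinearMap.BilinForm ℝ V} {Ω : Set E} {𝒥 : E → V →L[ℝ] V}

theorem aeval_tensorActL (k : ℕ) (A : Covec V →L[ℂ] Covec V) (q : Polynomial ℂ) (α : Form V k) :
    Polynomial.aeval (tensorActL k A) q α = Polynomial.aeval (tensorAct A k) q α := by
  induction q using Polynomial.induction_on' with
  | add p q hp hq => simp only [map_add, add_apply, LinearMap.add_apply, hp, hq]
  | monomial n z =>
    simp only [Polynomial.aeval_monomial, ← Algebra.smul_def, smul_apply, LinearMap.smul_apply]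
    congr 1
    induction n with
    | zero => rfl
    | succ n ih =>
      rw [pow_succ', pow_succ']
      change tensorAct A k ((tensorActL k A ^ n) α) = tensorAct A k ((tensorAct A k ^ n) α)
      rw [ih]

/-- An operator with [N, A] = -A lowers the eigenvalue of N by one. -/
theorem tensorAct_mem_formsPQ_of_bracket {J : V →L[ℝ] V} (hJ : ∀ x, J (J x) = -x)
    {A : Covec V →L[ℂ] Covec V} (hA : proj10 J * A - A * proj10 J = -A) {k p : ℕ} (hp : p < k)
    {α : Form V k} (hα : α ∈ formsPQ J k (p + 1)) : tensorAct A k α ∈ formsPQ J k p := by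
  rw [mem_formsPQ_iff hJ hp.le]
  rw [mem_formsPQ_iff hJ hp] at hα
  have h := tensorAct_commutator (proj10 J) A k α
  rw [hA, hα, map_smul, sub_eq_iff_eq_add] at h
  have h2 : tensorAct (-A) k α = -tensorAct A k α :=
    DFunLike.congr_fun (map_neg (tensorActₗ (V := V) k) A) α
  rw [h, h2]
  push_cast
  module

theorem tensorAct_mem_formsPQ_succ_of_bracket {J : V →L[ℝ] V} (hJ : ∀ x, J (J x) = -x)
    {A : Covec V →L[ℂ] Covec V} (hA : proj10 J * A - A * proj10 J = A) {k p : ℕ} (hp : p < k)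
    {α : Form V k} (hα : α ∈ formsPQ J k p) : tensorAct A k α ∈ formsPQ J k (p + 1) := by
  rw [mem_formsPQ_iff hJ hp]
  rw [mem_formsPQ_iff hJ hp.le] at hα
  have h := tensorAct_commutator (proj10 J) A k α
  rw [hA, hα, map_smul, sub_eq_iff_eq_add] at h
  rw [h]
  push_cast
  module

/-- The extreme types p = 0 and p = k, where a shift would leave the range of types: there A
annihilates every factor of a generator. -/
theorem tensorAct_eq_zero_of_mem {J : V →L[ℝ] V} {A : Covec V →L[ℂ] Covec V} {k p : ℕ}
    (hA : (∀ η ∈ forms01 J, A η = 0) ∧ p = 0 ∨ (∀ η ∈ forms10 J, A η = 0) ∧ p = k)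
    {α : Form V k} (hα : α ∈ formsPQ J k p) : tensorAct A k α = 0 := by
  suffices formsPQ J k p ≤ LinearMap.ker (tensorAct A k) from this hα
  refine Submodule.span_le.2 ?_
  rintro _ ⟨c, hc, rfl⟩
  rw [SetLike.mem_coe, LinearMap.mem_ker]
  have hc' : ∀ i, A (c i) = 0 := by
    intro i
    have := hc i
    rcases hA with ⟨h, rfl⟩ | ⟨h, rfl⟩
    · exact h _ (by simpa using this)
    · exact h _ (by simpa using this)
  clear hα hA hc α
  induction k with
  | zero => rfl
  | succ k ih =>
    rw [wedgeAll, tensorAct_wedge, hc' 0, ih (Fin.tail c) fun i => hc' i.succ, wedge_zero_left,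
      wedge_zero_right, add_zero]

omit [FiniteDimensional ℝ V] in
theorem ksOf_of_mem01 {J : V →L[ℝ] V} {η : Covec V} (hη : η ∈ forms01 J) (X : V →L[ℝ] V) :
    ksOf J X η = 0 := by
  ext x
  have h := hη (X x)
  simp [ksOf, h]
  ring

omit [FiniteDimensional ℝ V] in
theorem ksOfConj_of_mem10 {J : V →L[ℝ] V} {η : Covec V} (hη : η ∈ forms10 J) (X : V →L[ℝ] V) :
    ksOfConj J X η = 0 := by
  ext x
  have h := hη (X x)
  simp [ksOfConj, h]
  ring

namespace IsHolomorphicFamily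

variable (H : IsHolomorphicFamily ω Ω 𝒥)
include H

theorem projPQ_eq {k p : ℕ} (hp : p ≤ k) {t : E} (ht : t ∈ Ω) (α : Form V k) :
    projPQ (𝒥 t) k p α = Polynomial.aeval (grading 𝒥 k t) (typePoly k p) α := by
  rw [projPQ_eq_aeval (H.mem t ht).1 hp, grading, aeval_tensorActL]

theorem smoothOn_projPQ {k p : ℕ} (hp : p ≤ k) {u : E → Form V k} (hu : SmoothOn u Ω) :
    SmoothOn (fun s => projPQ (𝒥 s) k p (u s)) Ω :=
  ((((H.isGradingFamily k).aeval (typePoly k p)).1).clm_apply hu).congr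
    fun t ht => H.projPQ_eq hp ht (u t)

theorem projPQ_dz {k p : ℕ} (hp : p ≤ k) {t : E} (ht : t ∈ Ω) (v : E) {α : Form V k}
    (hα : α ∈ formsPQ (𝒥 t) k p) : projPQ (𝒥 t) k p (dz (grading 𝒥 k) t v α) = 0 := by
  have hJ := (H.mem t ht).1
  rw [H.dz_grading k ht, tensorActL_apply]
  rcases p with _ | p
  · rw [tensorAct_eq_zero_of_mem (Or.inl ⟨fun η hη => ?_, rfl⟩) hα, map_zero]
    exact ksOf_of_mem01 hη _
  · rw [projPQ_of_mem hJ hp (q := p) (by omega) (tensorAct_mem_formsPQ_of_bracket hJ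
      (proj10_bracket_ksOf (H.mul_self ht) (H.fderiv_mul ht v)) hp hα), if_neg (by omega)]

theorem projPQ_dzbar {k p : ℕ} (hp : p ≤ k) {t : E} (ht : t ∈ Ω) (v : E) {α : Form V k}
    (hα : α ∈ formsPQ (𝒥 t) k p) : projPQ (𝒥 t) k p (dzbar (grading 𝒥 k) t v α) = 0 := by
  have hJ := (H.mem t ht).1
  rw [H.dzbar_grading k ht, neg_apply, tensorActL_apply, map_neg, neg_eq_zero]
  rcases hp.eq_or_lt with rfl | hp'
  · rw [tensorAct_eq_zero_of_mem (Or.inr ⟨fun η hη => ?_, rfl⟩) hα, map_zero]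
    exact ksOfConj_of_mem10 hη _
  · rw [projPQ_of_mem hJ hp (q := p + 1) hp' (tensorAct_mem_formsPQ_succ_of_bracket hJ
      (proj10_bracket_ksOfConj (H.mul_self ht) (H.fderiv_mul ht v)) hp' hα), if_neg (by omega)]

/-- The connection ∇ - ∂N + ∂̄N commutes with π, being π polynomial in N. Applied to πu, its
correction terms change the type and are removed by the outer π, leaving π∇π. -/
theorem projPQ_fderiv {k p : ℕ} (hp : p ≤ k) {u : E → Form V k} (hu : SmoothOn u Ω) {t : E}
    (ht : t ∈ Ω) (v : E) :
    projPQ (𝒥 t) k p (trivialConn (fun s => projPQ (𝒥 s) k p (u s)) t v) =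
      projPQ (𝒥 t) k p (gradedConn (grading 𝒥 k) u t v) := by
  have hJ := (H.mem t ht).1
  have hG := H.isGradingFamily k
  have h1 := (hG.aeval (typePoly k p)).2 u hu t ht v
  have h2 : fderiv ℝ (fun s => projPQ (𝒥 s) k p (u s)) t =
      fderiv ℝ (fun s => Polynomial.aeval (grading 𝒥 k s) (typePoly k p) (u s)) t :=
    (Filter.eventuallyEq_of_mem (H.isOpen.mem_nhds ht) fun s hs =>
      H.projPQ_eq hp hs (u s)).fderiv_eq
  rw [gradedConn, ← H.projPQ_eq hp ht, ← H.projPQ_eq hp ht] at h1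
  rw [trivialConn, h2, ← sub_eq_zero]
  have h3 := congrArg (projPQ (𝒥 t) k p) h1
  rw [map_add, map_sub, H.projPQ_dz hp ht v (projPQ_mem hJ hp _),
    H.projPQ_dzbar hp ht v (projPQ_mem hJ hp _), projPQ_of_mem hJ hp hp (projPQ_mem hJ hp _),
    if_pos rfl] at h3
  rw [← h3]
  abel

theorem hodgeConn_eq (k : ℕ) (u : E → Form V k) (hu : SmoothOn u Ω) (t : E) (ht : t ∈ Ω) (v : E) :
    hodgeConn 𝒥 k u t v = gradedConn (grading 𝒥 k) u t v := by
  rw [hodgeConn, Finset.sum_congr rfl fun p hp =>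
    H.projPQ_fderiv (Nat.lt_succ_iff.1 (Finset.mem_range.1 hp)) hu ht v,
    sum_projPQ (H.mem t ht).1]

/-- D commutes with N, so the eigenvalue equation N u = p u passes to D u. -/
theorem hodgeConn_mem {k p : ℕ} (hp : p ≤ k) {u : E → Form V k} (hu : SmoothOn u Ω)
    (hmem : ∀ t ∈ Ω, u t ∈ formsPQ (𝒥 t) k p) {t : E} (ht : t ∈ Ω) (v : E) :
    hodgeConn 𝒥 k u t v ∈ formsPQ (𝒥 t) k p := by
  have hG := H.isGradingFamily k
  rw [H.hodgeConn_eq k u hu t ht v, mem_formsPQ_iff (H.mem t ht).1 hp]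
  change grading 𝒥 k t _ = _
  rw [← hG.gradedConn_grading hu ht, ← gradedConn_const_smul hG _ hu ht]
  have : (fun s => grading 𝒥 k s (u s)) =ᶠ[nhds t] fun s => (p : ℂ) • u s :=
    Filter.eventuallyEq_of_mem (H.isOpen.mem_nhds ht) fun s hs =>
      (mem_formsPQ_iff (H.mem s hs).1 hp).1 (hmem s hs)
  rw [gradedConn, gradedConn, this.fderiv_eq, this.eq_of_nhds]

end IsHolomorphicFamily

end HodgeConn

/-! ### Smoothness and derivative of a sesquilinear monomial -/

section Terms

variable {E : Type*} [NormedAddCommGroup E] [NormedSpace ℂ E]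
variable {W : Type*} [NormedAddCommGroup W] [NormedSpace ℂ W]
variable {Ω : Set E}

theorem hasFDerivAt_sesquilinear_term {c : E → ℂ} {u w : E → W} (A B : W →L[ℂ] ℂ) {t : E}
    (hc : DifferentiableAt ℝ c t) (hu : DifferentiableAt ℝ u t) (hw : DifferentiableAt ℝ w t) :
    ∃ L : E →L[ℝ] ℂ, HasFDerivAt (fun s => c s * A (u s) * (starRingEnd ℂ) (B (w s))) L t ∧
      ∀ v, L v = fderiv ℝ c t v * A (u t) * (starRingEnd ℂ) (B (w t)) +
        c t * A (fderiv ℝ u t v) * (starRingEnd ℂ) (B (w t)) +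
        c t * A (u t) * (starRingEnd ℂ) (B (fderiv ℝ w t v)) := by
  have h1 := (A.restrictScalars ℝ).hasFDerivAt.comp t hu.hasFDerivAt
  have h2 := (Complex.conjCLE : ℂ →L[ℝ] ℂ).hasFDerivAt.comp t
    ((B.restrictScalars ℝ).hasFDerivAt.comp t hw.hasFDerivAt)
  refine ⟨_, (hc.hasFDerivAt.mul h1).mul h2, fun v => ?_⟩
  simp
  ring

theorem smoothOn_sesquilinear_term {c : E → ℂ} {u w : E → W} (A B : W →L[ℂ] ℂ)
    (hc : SmoothOn c Ω) (hu : SmoothOn u Ω) (hw : SmoothOn w Ω) :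
    SmoothOn (fun s => c s * A (u s) * (starRingEnd ℂ) (B (w s))) Ω :=
  (ContDiffOn.mul hc ((A.restrictScalars ℝ).contDiff.comp_contDiffOn hu)).mul
    ((Complex.conjCLE : ℂ →L[ℝ] ℂ).contDiff.comp_contDiffOn
      ((B.restrictScalars ℝ).contDiff.comp_contDiffOn hw))

end Terms

/-! ### Matrix identities for adjoints and for the variation of the metric -/

section Metric

variable {V : Type*} [NormedAddCommGroup V] [NormedSpace ℝ V] [FiniteDimensional ℝ V]
variable {E : Type*} [NormedAddCommGroup E] [NormedSpace ℂ E] {Ω : Set E}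

theorem smoothOn_tensorForm {G : E → FrameMatrix V} (hG : ∀ a c, SmoothOn (fun s => G s a c) Ω)
    {k : ℕ} {u w : E → Form V k} (hu : SmoothOn u Ω) (hw : SmoothOn w Ω) :
    SmoothOn (fun s => tensorForm (G s) (u s) (w s)) Ω := by
  unfold tensorForm
  refine ContDiffOn.sum fun f _ => ContDiffOn.sum fun e _ => ?_
  exact smoothOn_sesquilinear_term (LinearMap.toContinuousLinearMap (component f))
    (LinearMap.toContinuousLinearMap (component e))
    (contDiffOn_prod fun l _ => hG (f l) (e l)) hu hw

theorem fderiv_tensorForm {G : E → FrameMatrix V} {t : E}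
    (hG : ∀ a c, DifferentiableAt ℝ (fun s => G s a c) t) {k : ℕ} {u w : E → Form V k}
    (hu : DifferentiableAt ℝ u t) (hw : DifferentiableAt ℝ w t) (v : E) :
    fderiv ℝ (fun s => tensorForm (G s) (u s) (w s)) t v =
      ∑ m, slotForm (G t) (Matrix.of fun a c => fderiv ℝ (fun s => G s a c) t v) m (u t) (w t) +
        tensorForm (G t) (fderiv ℝ u t v) (w t) + tensorForm (G t) (u t) (fderiv ℝ w t v) := by
  have hc : ∀ f e : Fin k → Fin (Module.finrank ℝ V), HasFDerivAt (𝕜 := ℝ)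
      (fun s => ∏ l, G s (f l) (e l)) _ t := fun f e =>
    HasFDerivAt.finsetProd (u := Finset.univ) fun l _ => (hG (f l) (e l)).hasFDerivAt
  have h : ∀ f e : Fin k → Fin (Module.finrank ℝ V), ∃ L : E →L[ℝ] ℂ, _ := fun f e =>
    hasFDerivAt_sesquilinear_term (LinearMap.toContinuousLinearMap (component f))
      (LinearMap.toContinuousLinearMap (component e)) (hc f e).differentiableAt hu hw
  choose L hL hLv using h
  have hsum : HasFDerivAt (fun s => tensorForm (G s) (u s) (w s)) (∑ f, ∑ e, L f e) t :=
    HasFDerivAt.fun_sum fun f _ => HasFDerivAt.fun_sum fun e _ => hL f e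
  rw [hsum.fderiv]
  simp only [sum_apply, hLv, (hc _ _).fderiv, Finset.sum_add_distrib,
    LinearMap.coe_toContinuousLinearMap', smul_apply, smul_eq_mul, Finset.sum_mul]
  congr 2
  simp only [slotForm, Matrix.of_apply]
  conv_rhs => rw [Finset.sum_comm]
  refine Finset.sum_congr rfl fun f _ => ?_
  conv_rhs => rw [Finset.sum_comm]

/-- The matrix of a real endomorphism in the standard basis of `V`. -/
def frameMatrix (S : V →L[ℝ] V) :
    Matrix (Fin (Module.finrank ℝ V)) (Fin (Module.finrank ℝ V)) ℝ :=
  LinearMap.toMatrix (Module.finBasis ℝ V) (Module.finBasis ℝ V) S.toLinearMap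

theorem frameMatrix_apply (S : V →L[ℝ] V) (a c : Fin (Module.finrank ℝ V)) :
    frameMatrix S a c = (Module.finBasis ℝ V).repr (S (Module.finBasis ℝ V c)) a :=
  LinearMap.toMatrix_apply _ _ _ _ _

theorem frameMatrix_mul (S T : V →L[ℝ] V) :
    frameMatrix (S * T) = frameMatrix S * frameMatrix T :=
  LinearMap.toMatrix_mul _ _ _

theorem frameMatrix_neg (S : V →L[ℝ] V) : frameMatrix (-S) = -frameMatrix S :=
  map_neg (LinearMap.toMatrix (Module.finBasis ℝ V) (Module.finBasis ℝ V)) S.toLinearMap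

theorem frameMatrix_one : frameMatrix (1 : V →L[ℝ] V) = 1 := LinearMap.toMatrix_one _

theorem covecMatrix_pull (S : V →L[ℝ] V) :
    covecMatrix (pull S) = (frameMatrix S).map Complex.ofReal := by
  ext a c
  simp [covecMatrix, frameMatrix_apply, coframe_apply]

/-- The matrix of `ω` in the standard basis of `V`. -/
def formMatrix (ω : LinearMap.BilinForm ℝ V) :
    Matrix (Fin (Module.finrank ℝ V)) (Fin (Module.finrank ℝ V)) ℝ :=
  Matrix.of fun a c => ω (Module.finBasis ℝ V a) (Module.finBasis ℝ V c)

theorem formMatrix_mul (ω : LinearMap.BilinForm ℝ V) (S : V →L[ℝ] V) :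
    formMatrix ω * frameMatrix S = gram ω S := by
  ext a c
  simp only [Matrix.mul_apply, formMatrix, gram, Matrix.of_apply, frameMatrix_apply]
  conv_rhs => rw [← (Module.finBasis ℝ V).sum_repr (S (Module.finBasis ℝ V c)), map_sum]
  simp only [map_smul, smul_eq_mul, mul_comm]

theorem covecMatrix_sub_smul (z w : ℂ) (A B : Covec V →L[ℂ] Covec V) :
    covecMatrix (z • A - w • B) = z • covecMatrix A - w • covecMatrix B := by
  ext a c; simp [covecMatrix]

theorem covecMatrix_add (A B : Covec V →L[ℂ] Covec V) :
    covecMatrix (A + B) = covecMatrix A + covecMatrix B := by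
  ext a c; simp [covecMatrix]

theorem covecMatrix_smul (z : ℂ) (A : Covec V →L[ℂ] Covec V) :
    covecMatrix (z • A) = z • covecMatrix A := by
  ext a c; simp [covecMatrix]

theorem map_ofReal_mul {ι : Type*} [Fintype ι] (S T : Matrix ι ι ℝ) :
    (S * T).map Complex.ofReal = S.map Complex.ofReal * T.map Complex.ofReal := by
  ext a c; simp [Matrix.mul_apply]

theorem map_ofReal_mul_conjTranspose {ι : Type*} [Fintype ι] {S G : Matrix ι ι ℝ}
    (hG : G.transpose = G) {ε : ℝ} (h : (S * G).transpose = ε • (S * G)) :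
    G.map Complex.ofReal * (S.map Complex.ofReal).conjTranspose =
      (ε : ℂ) • (S.map Complex.ofReal * G.map Complex.ofReal) := by
  have h1 : (S.map Complex.ofReal).conjTranspose = S.transpose.map Complex.ofReal := by
    ext a c; simp
  rw [h1, ← map_ofReal_mul, ← map_ofReal_mul]
  nth_rewrite 1 [← hG]
  rw [← Matrix.transpose_mul, h]
  ext a c; simp

section Compatible

variable {ω : LinearMap.BilinForm ℝ V} {J : V →L[ℝ] V} (hJ : J ∈ compatibleJ ω)
include hJ

omit [FiniteDimensional ℝ V] in
theorem mul_self_of_mem : J * J = -1 := by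
  ext x
  simpa using hJ.1 x

theorem isUnit_det_formMatrix : IsUnit (formMatrix ω).det := by
  have h := (Matrix.isUnit_iff_isUnit_det _).1 (gram_posDef hJ).isUnit
  rw [← formMatrix_mul, Matrix.det_mul] at h
  exact isUnit_of_mul_isUnit_left h

/-- From G = ΩJ and J⁻¹ = -J. The inverse Gram matrix becomes linear in J, so differentiating the
metric amounts to replacing J by its derivative. -/
theorem gram_inv : (gram ω J)⁻¹ = -(frameMatrix J * (formMatrix ω)⁻¹) := by
  refine Matrix.inv_eq_right_inv ?_
  rw [← formMatrix_mul, mul_neg, mul_assoc, ← mul_assoc (frameMatrix J), ← frameMatrix_mul,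
    mul_self_of_mem hJ, frameMatrix_neg, frameMatrix_one]
  simp [Matrix.mul_nonsing_inv _ (isUnit_det_formMatrix hJ)]

theorem gram_inv_isHermitian : ((gram ω J)⁻¹.map Complex.ofReal).IsHermitian := by
  have h := (gram_posDef hJ).inv.isHermitian
  ext a c
  have := h.apply a c
  simp only [star_trivial] at this
  simp [this]

/-- XΩ⁻¹ = Ω⁻¹(ΩX)Ω⁻¹ with ΩX symmetric and Ω⁻¹ antisymmetric. -/
theorem mul_inv_isSymm (hω : ω.IsAlt) {X : V →L[ℝ] V} (hX : ∀ x y, ω x (X y) = ω y (X x)) :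
    (frameMatrix X * (formMatrix ω)⁻¹).transpose = frameMatrix X * (formMatrix ω)⁻¹ := by
  have hu := isUnit_det_formMatrix hJ
  have h1 : (formMatrix ω).transpose = -formMatrix ω := by
    ext a c
    exact (LinearMap.IsAlt.neg hω _ _).symm
  have h2 : (formMatrix ω * frameMatrix X).transpose = formMatrix ω * frameMatrix X := by
    rw [formMatrix_mul]
    ext a c
    exact hX _ _
  rw [Matrix.transpose_mul, h1] at h2
  rw [Matrix.transpose_mul, Matrix.transpose_nonsing_inv, h1,
    Matrix.inv_eq_right_inv (show -formMatrix ω * -(formMatrix ω)⁻¹ = 1 by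
      rw [neg_mul_neg, Matrix.mul_nonsing_inv _ hu])]
  have h3 : (frameMatrix X).transpose = -(formMatrix ω * frameMatrix X * (formMatrix ω)⁻¹) := by
    rw [← h2, mul_neg, neg_mul, neg_neg, mul_assoc, Matrix.mul_nonsing_inv _ hu, mul_one]
  rw [h3, neg_mul_neg, mul_assoc, ← mul_assoc, Matrix.nonsing_inv_mul _ hu, one_mul]

theorem frameMatrix_mul_gram_inv {X : V →L[ℝ] V} (hXJ : X * J = -(J * X)) :
    frameMatrix (J * X) * (gram ω J)⁻¹ = -(frameMatrix X * (formMatrix ω)⁻¹) := by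
  rw [gram_inv hJ, mul_neg, ← mul_assoc, ← frameMatrix_mul, mul_assoc, hXJ, mul_neg, ← mul_assoc,
    mul_self_of_mem hJ]
  simp

theorem gram_inv_transpose : (gram ω J)⁻¹.transpose = (gram ω J)⁻¹ := by
  ext a c
  simpa using (gram_posDef hJ).inv.isHermitian.apply a c

theorem frameMatrix_mul_gram_inv_transpose (hω : ω.IsAlt) {X : V →L[ℝ] V}
    (hXJ : X * J = -(J * X)) (hX : ∀ x y, ω x (X y) = ω y (X x)) :
    (frameMatrix (J * X) * (gram ω J)⁻¹).transpose = frameMatrix (J * X) * (gram ω J)⁻¹ := by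
  rw [frameMatrix_mul_gram_inv hJ hXJ, Matrix.transpose_neg, mul_inv_isSymm hJ hω hX]

omit hJ [FiniteDimensional ℝ V] in
theorem anticomm_mul {X : V →L[ℝ] V} (hXJ : X * J = -(J * X)) :
    J * X * J = -(J * (J * X)) := by
  rw [mul_assoc, hXJ, mul_neg]

omit [FiniteDimensional ℝ V] in
theorem eq_neg_mul_mul (X : V →L[ℝ] V) : X = -(J * (J * X)) := by
  rw [← mul_assoc, mul_self_of_mem hJ]; simp

/-- X and JX are both self-adjoint for the metric, so passing to the adjoint only conjugates the
scalar coefficients of `ksOf`. -/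
theorem covecMatrix_ksOf_adjoint (hω : ω.IsAlt) {X : V →L[ℝ] V} (hXJ : X * J = -(J * X))
    (hX : ∀ x y, ω x (X y) = ω y (X x)) (hX' : ∀ x y, ω x ((J * X) y) = ω y ((J * X) x)) :
    covecMatrix (ksOf J X) * (gram ω J)⁻¹.map Complex.ofReal =
      (gram ω J)⁻¹.map Complex.ofReal * (covecMatrix (ksOfConj J X)).conjTranspose := by
  have hG := gram_inv_transpose hJ
  have h1 := frameMatrix_mul_gram_inv_transpose hJ hω hXJ hX
  -- Writing X = -J(JX) reduces the claim for X to the same lemma applied to JX.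
  have h2 : (frameMatrix X * (gram ω J)⁻¹).transpose = frameMatrix X * (gram ω J)⁻¹ := by
    have := frameMatrix_mul_gram_inv_transpose hJ hω (anticomm_mul hXJ) hX'
    rw [eq_neg_mul_mul hJ X, frameMatrix_neg, neg_mul, Matrix.transpose_neg, this]
  have h3 := map_ofReal_mul_conjTranspose hG (ε := 1) (by rw [h1, one_smul])
  have h4 := map_ofReal_mul_conjTranspose hG (ε := 1) (by rw [h2, one_smul])
  rw [Complex.ofReal_one, one_smul] at h3 h4
  rw [ksOf, ksOfConj, covecMatrix_sub_smul, covecMatrix_sub_smul, covecMatrix_pull,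
    covecMatrix_pull, Matrix.conjTranspose_sub, Matrix.conjTranspose_smul,
    Matrix.conjTranspose_smul, mul_sub, sub_mul, Matrix.mul_smul, Matrix.mul_smul, h3, h4,
    Matrix.smul_mul, Matrix.smul_mul]
  congr 2
  · simp [neg_div]
  · simp

/-- J is skew-adjoint and enters with an imaginary coefficient, so the projection is self-adjoint.
-/
theorem covecMatrix_proj10_adjoint (hω : ω.IsAlt) :
    covecMatrix (proj10 J) * (gram ω J)⁻¹.map Complex.ofReal =
      (gram ω J)⁻¹.map Complex.ofReal * (covecMatrix (proj10 J)).conjTranspose := by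
  have hG := gram_inv_transpose hJ
  have h1 : frameMatrix J * (gram ω J)⁻¹ = (formMatrix ω)⁻¹ := by
    rw [gram_inv hJ, mul_neg, ← mul_assoc, ← frameMatrix_mul, mul_self_of_mem hJ,
      frameMatrix_neg, frameMatrix_one]
    simp
  have h2 : (frameMatrix J * (gram ω J)⁻¹).transpose =
      (-1 : ℝ) • (frameMatrix J * (gram ω J)⁻¹) := by
    have h3 : (formMatrix ω).transpose = -formMatrix ω := by
      ext a c
      exact (LinearMap.IsAlt.neg hω _ _).symm
    rw [h1, Matrix.transpose_nonsing_inv, h3, neg_one_smul]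
    exact Matrix.inv_eq_right_inv
      (by rw [neg_mul_neg, Matrix.mul_nonsing_inv _ (isUnit_det_formMatrix hJ)])
  have h4 := map_ofReal_mul_conjTranspose hG h2
  have h5 := map_ofReal_mul_conjTranspose (S := 1) hG (ε := 1) (by rw [one_mul, hG, one_smul])
  rw [Complex.ofReal_one, one_smul] at h5
  rw [proj10_eq, covecMatrix_add, covecMatrix_smul, covecMatrix_smul, covecMatrix_pull,
    ← pull_one, covecMatrix_pull, frameMatrix_one, Matrix.conjTranspose_add,
    Matrix.conjTranspose_smul, Matrix.conjTranspose_smul, mul_add, add_mul, Matrix.mul_smul,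
    Matrix.mul_smul, h4, h5, Matrix.smul_mul, Matrix.smul_mul, smul_smul]
  congr 2
  · simp
  · simp [neg_div]

/-- The variation of the inverse Gram matrix. -/
theorem gram_inv_variation (hω : ω.IsAlt) {X : V →L[ℝ] V} (hXJ : X * J = -(J * X))
    (hX : ∀ x y, ω x (X y) = ω y (X x)) :
    (-(frameMatrix X * (formMatrix ω)⁻¹)).map Complex.ofReal =
      -(covecMatrix (ksOf J X + ksOfConj J X) * (gram ω J)⁻¹.map Complex.ofReal +
        (gram ω J)⁻¹.map Complex.ofReal *
          (covecMatrix (ksOf J X + ksOfConj J X)).conjTranspose) := by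
  have hG := gram_inv_transpose hJ
  have h1 := frameMatrix_mul_gram_inv_transpose hJ hω hXJ hX
  have h3 := map_ofReal_mul_conjTranspose hG (ε := 1) (by rw [h1, one_smul])
  -- The terms in X cancel and the real multiple -1/2 of JX remains; each of the two summands of the
  -- right-hand side then supplies half of the variation.
  have h4 : ksOf J X + ksOfConj J X = (-1 / 2 : ℂ) • pull (J * X) := by
    rw [ksOf, ksOfConj]; module
  rw [Complex.ofReal_one, one_smul] at h3
  rw [← frameMatrix_mul_gram_inv hJ hXJ, h4, covecMatrix_smul, covecMatrix_pull,
    Matrix.conjTranspose_smul, Matrix.mul_smul, h3, Matrix.smul_mul, map_ofReal_mul, ← add_smul]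
  have : (-1 / 2 : ℂ) + star (-1 / 2 : ℂ) = -1 := by
    simp
  rw [this, neg_one_smul, neg_neg]

end Compatible

end Metric

/-! ### Orthogonality, metric compatibility and the flat Higgs bundle -/

section Metric

variable {V : Type*} [NormedAddCommGroup V] [NormedSpace ℝ V] [FiniteDimensional ℝ V]
variable {E : Type*} [NormedAddCommGroup E] [NormedSpace ℂ E]

theorem tensorForm_sub_left (G : FrameMatrix V) {k : ℕ} (α α' β : Form V k) :
    tensorForm G (α - α') β = tensorForm G α β - tensorForm G α' β := by
  simp [tensorForm, mul_sub, sub_mul, Finset.sum_sub_distrib]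

theorem tensorForm_sub_right (G : FrameMatrix V) {k : ℕ} (α β β' : Form V k) :
    tensorForm G α (β - β') = tensorForm G α β - tensorForm G α β' := by
  simp [tensorForm, mul_sub, Finset.sum_sub_distrib]

theorem tensorForm_smul_right (G : FrameMatrix V) {k : ℕ} (z : ℂ) (α β : Form V k) :
    tensorForm G α (z • β) = (starRingEnd ℂ) z * tensorForm G α β := by
  simp only [tensorForm, map_smul, smul_eq_mul, Finset.mul_sum, map_mul]
  exact Finset.sum_congr rfl fun f _ => Finset.sum_congr rfl fun e _ => by ring

theorem slotForm_neg_add (G K K' : FrameMatrix V) {k : ℕ} (m : Fin k) (α β : Form V k) :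
    slotForm G (-(K + K')) m α β = -(slotForm G K m α β + slotForm G K' m α β) := by
  simp only [slotForm, Matrix.neg_apply, Matrix.add_apply, ← Finset.sum_add_distrib,
    ← Finset.sum_neg_distrib]
  exact Finset.sum_congr rfl fun f _ => Finset.sum_congr rfl fun e _ => by ring

theorem formInner_adjoint {ω : LinearMap.BilinForm ℝ V} {J : V →L[ℝ] V} (hJ : J ∈ compatibleJ ω)
    {A B : Covec V →L[ℂ] Covec V}
    (h : covecMatrix A * (gram ω J)⁻¹.map Complex.ofReal =
      (gram ω J)⁻¹.map Complex.ofReal * (covecMatrix B).conjTranspose) {k : ℕ} (α β : Form V k) :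
    formInner ω J (tensorAct A k α) β = formInner ω J α (tensorAct B k β) := by
  rw [formInner_eq, formInner_eq, tensorForm_adjoint (gram_inv_isHermitian hJ) h]

/-- Forms of different type are orthogonal. -/
theorem formInner_eq_zero {ω : LinearMap.BilinForm ℝ V} (hω : ω.IsAlt) {J : V →L[ℝ] V}
    (hJ : J ∈ compatibleJ ω) {k p p' : ℕ} (hp : p ≤ k) (hp' : p' ≤ k) (hne : p ≠ p')
    {α β : Form V k} (hα : α ∈ formsPQ J k p) (hβ : β ∈ formsPQ J k p') :
    formInner ω J α β = 0 := by
  rw [mem_formsPQ_iff hJ.1 hp] at hα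
  rw [mem_formsPQ_iff hJ.1 hp'] at hβ
  -- Self-adjointness of N gives (p - p')⟨α, β⟩ = 0.
  have h := formInner_adjoint hJ (covecMatrix_proj10_adjoint hJ hω) α β
  rw [hα, hβ, formInner_eq, formInner_eq, tensorForm_smul_left, tensorForm_smul_right, map_natCast]
    at h
  rw [formInner_eq]
  have hne' : (p : ℂ) - (p' : ℂ) ≠ 0 := sub_ne_zero.2 (by exact_mod_cast hne)
  refine mul_left_cancel₀ hne' ?_
  linear_combination h

namespace IsHolomorphicFamily

variable {ω : LinearMap.BilinForm ℝ V} {Ω : Set E} {𝒥 : E → V →L[ℝ] V}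
  (H : IsHolomorphicFamily ω Ω 𝒥)
include H

theorem symm_fderiv {t : E} (ht : t ∈ Ω) (v : E) (x y : V) :
    ω x (fderiv ℝ 𝒥 t v y) = ω y (fderiv ℝ 𝒥 t v x) := by
  have h := (smoothOn_and_fderiv_affine H.isOpen H.smooth
    (fun S => ((ω x (S y) - ω y (S x) : ℝ) : ℂ)) (fun S T => by simp; ring)
    (fun r S => by simp; ring) (f := fun s => ((ω x (𝒥 s y) - ω y (𝒥 s x) : ℝ) : ℂ)) 0 1
    fun s => by simp).2 t ht v
  have h0 : (fun s => ((ω x (𝒥 s y) - ω y (𝒥 s x) : ℝ) : ℂ)) =ᶠ[nhds t] fun _ => 0 :=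
    Filter.eventuallyEq_of_mem (H.isOpen.mem_nhds ht) fun s hs => by
      simp [(H.mem s hs).2.1 x y]
  rw [h0.fderiv_eq] at h
  simp only [fderiv_fun_const, Pi.zero_apply, zero_apply, one_smul] at h
  exact sub_eq_zero.1 (by exact_mod_cast h.symm)

/-- By holomorphy JX is itself a derivative of the family, in the direction iv. -/
theorem symm_mul_fderiv {t : E} (ht : t ∈ Ω) (v : E) (x y : V) :
    ω x ((𝒥 t * fderiv ℝ 𝒥 t v) y) = ω y ((𝒥 t * fderiv ℝ 𝒥 t v) x) := by
  rw [← H.holomorphic t ht]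
  exact H.symm_fderiv ht _ x y

theorem inverseGram_entry (a c : Fin (Module.finrank ℝ V)) :
    SmoothOn (fun s => (-(frameMatrix (𝒥 s) * (formMatrix ω)⁻¹)).map Complex.ofReal a c) Ω ∧
      ∀ t ∈ Ω, ∀ v, fderiv ℝ
        (fun s => (-(frameMatrix (𝒥 s) * (formMatrix ω)⁻¹)).map Complex.ofReal a c) t v =
          (-(frameMatrix (fderiv ℝ 𝒥 t v) * (formMatrix ω)⁻¹)).map Complex.ofReal a c := by
  have h := smoothOn_and_fderiv_affine H.isOpen H.smooth
    (fun S => (-(frameMatrix S * (formMatrix ω)⁻¹)).map Complex.ofReal a c)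
    (fun S T => by
      simp [Matrix.mul_apply, frameMatrix_apply, add_mul, Finset.sum_add_distrib]; ring)
    (fun r S => by simp [Matrix.mul_apply, frameMatrix_apply, Finset.mul_sum, mul_assoc])
    (f := fun s => (-(frameMatrix (𝒥 s) * (formMatrix ω)⁻¹)).map Complex.ofReal a c) 0 1
    fun s => by rw [zero_add, one_smul]
  exact ⟨h.1, fun t ht v => by rw [h.2 t ht v, one_smul]⟩

theorem hodgeMetric_eq (k : ℕ) {t : E} (ht : t ∈ Ω) (α β : Form V k) :
    hodgeMetric ω 𝒥 k t α β = (1 / (k.factorial : ℂ)) *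
      tensorForm ((-(frameMatrix (𝒥 t) * (formMatrix ω)⁻¹)).map Complex.ofReal) α β := by
  rw [hodgeMetric, formInner_eq, gram_inv (H.mem t ht)]

theorem isHermitianMetric (k : ℕ) : IsHermitianMetric Ω (hodgeMetric ω 𝒥 k) where
  smooth u w hu hw := by
    have h := (smoothOn_tensorForm (fun a c => (H.inverseGram_entry a c).1) hu hw).csmul
      (1 / (k.factorial : ℂ))
    exact h.congr fun t ht => H.hodgeMetric_eq k ht _ _
  add_left t ht a b c := by
    simp only [hodgeMetric, formInner_eq, tensorForm_add_left, mul_add]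
  smul_left t ht z a b := by
    simp only [hodgeMetric, formInner_eq, tensorForm_smul_left]
    ring
  conj_symm t ht a b := by
    simp only [hodgeMetric, formInner_eq, map_mul,
      tensorForm_conj (gram_inv_isHermitian (H.mem t ht))]
    simp
  pos t ht a ha := by
    have hg := gram_posDef (H.mem t ht)
    have h1 := tensorForm_pos hg.inv.posSemidef
      (Matrix.nonsing_inv_mul _ ((Matrix.isUnit_iff_isUnit_det _).1 hg.isUnit)) ha
    have h2 : (1 / (k.factorial : ℂ)) = ((1 / (k.factorial : ℝ) : ℝ) : ℂ) := by push_cast; rfl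
    rw [hodgeMetric, formInner_eq, h2, Complex.re_ofReal_mul]
    positivity

theorem hodgeMetric_compatible (hω : ω.IsAlt) (k : ℕ) {u w : E → Form V k} (hu : SmoothOn u Ω)
    (hw : SmoothOn w Ω) {t : E} (ht : t ∈ Ω) (v : E) :
    fderiv ℝ (fun s => hodgeMetric ω 𝒥 k s (u s) (w s)) t v =
      hodgeMetric ω 𝒥 k t (hodgeConn 𝒥 k u t v) (w t) +
        hodgeMetric ω 𝒥 k t (u t) (hodgeConn 𝒥 k w t v) := by
  have hJ := H.mem t ht
  set X := fderiv ℝ 𝒥 t v with hX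
  -- The correction in D is -(θ + θ̄), matching the shape of `gram_inv_variation`; the product rule
  -- for the metric then closes by cancellation.
  have hD : ∀ u : E → Form V k, SmoothOn u Ω → hodgeConn 𝒥 k u t v =
      fderiv ℝ u t v - tensorAct (ksOf (𝒥 t) X + ksOfConj (𝒥 t) X) k (u t) := by
    intro u hu
    rw [H.hodgeConn_eq k u hu t ht v, gradedConn, H.dz_grading k ht, H.dzbar_grading k ht,
      tensorAct_add, LinearMap.add_apply, neg_apply, tensorActL_apply, tensorActL_apply, hX]
    abel
  have h1 : (fun s => hodgeMetric ω 𝒥 k s (u s) (w s)) =ᶠ[nhds t] fun s =>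
      (1 / (k.factorial : ℂ)) • tensorForm
        ((-(frameMatrix (𝒥 s) * (formMatrix ω)⁻¹)).map Complex.ofReal) (u s) (w s) :=
    Filter.eventuallyEq_of_mem (H.isOpen.mem_nhds ht) fun s hs => H.hodgeMetric_eq k hs _ _
  have hG := fun a c => (H.inverseGram_entry a c).1.differentiableAt H.isOpen ht
  have hG' : (Matrix.of fun a c => fderiv ℝ
      (fun s => (-(frameMatrix (𝒥 s) * (formMatrix ω)⁻¹)).map Complex.ofReal a c) t v) =
      (-(frameMatrix X * (formMatrix ω)⁻¹)).map Complex.ofReal := by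
    ext a c
    exact (H.inverseGram_entry a c).2 t ht v
  have hdu := hu.differentiableAt H.isOpen ht
  have hdw := hw.differentiableAt H.isOpen ht
  have hd := ((smoothOn_tensorForm (fun a c => (H.inverseGram_entry a c).1) hu
    hw).differentiableAt H.isOpen ht)
  rw [h1.fderiv_eq, fderiv_fun_const_smul hd, smul_apply,
    fderiv_tensorForm (G := fun s => (-(frameMatrix (𝒥 s) * (formMatrix ω)⁻¹)).map Complex.ofReal)
      hG hdu hdw, hG', gram_inv_variation hJ hω (H.fderiv_mul ht v) (H.symm_fderiv ht v),
    hD u hu, hD w hw, hodgeMetric, hodgeMetric, formInner_eq, formInner_eq, ← gram_inv hJ,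
    tensorForm_sub_left, tensorForm_sub_right, tensorForm_tensorAct_left,
    tensorForm_tensorAct_right (gram_inv_isHermitian hJ)]
  simp only [slotForm_neg_add, Finset.sum_neg_distrib, Finset.sum_add_distrib, smul_eq_mul]
  ring

theorem theta_adjoint (hω : ω.IsAlt) (hω' : ω.Nondegenerate) (k : ℕ) {t : E} (ht : t ∈ Ω) (v : E)
    (α β : Form V k) : hodgeMetric ω 𝒥 k t (higgsField 𝒥 k t v α) β =
      hodgeMetric ω 𝒥 k t α (higgsFieldConj 𝒥 k t v β) := by
  rw [H.higgsField_eq hω' k ht, H.higgsFieldConj_eq hω' k ht, H.dz_grading k ht,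
    H.dzbar_grading k ht, neg_apply, neg_neg]
  exact formInner_adjoint (H.mem t ht) (covecMatrix_ksOf_adjoint (H.mem t ht) hω
    (H.fderiv_mul ht v) (H.symm_fderiv ht v) (H.symm_mul_fderiv ht v)) α β

theorem trivialConn_eq (hω' : ω.Nondegenerate) (k : ℕ) {u : E → Form V k} (hu : SmoothOn u Ω)
    {t : E} (ht : t ∈ Ω) (v : E) : trivialConn u t v =
      hodgeConn 𝒥 k u t v + higgsField 𝒥 k t v (u t) + higgsFieldConj 𝒥 k t v (u t) := by
  rw [H.hodgeConn_eq k u hu t ht v, H.higgsField_eq hω' k ht, H.higgsFieldConj_eq hω' k ht,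
    gradedConn, trivialConn]
  abel

theorem smoothOn_dz_grading (k : ℕ) (v : E) {u : E → Form V k} (hu : SmoothOn u Ω) :
    SmoothOn (fun s => dz (grading 𝒥 k) s v (u s)) Ω :=
  ((H.smooth_grading k).dz H.isOpen v).clm_apply hu

/-- The Higgs field is identified with ∂N only over Ω; this allows the substitution inside D. -/
theorem hodgeConn_congr (k : ℕ) {u u' : E → Form V k} (hu : SmoothOn u Ω)
    (h : ∀ s ∈ Ω, u' s = u s) {t : E} (ht : t ∈ Ω) (v : E) :
    hodgeConn 𝒥 k u' t v = hodgeConn 𝒥 k u t v := by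
  have h' : u' =ᶠ[nhds t] u := Filter.eventuallyEq_of_mem (H.isOpen.mem_nhds ht) h
  rw [H.hodgeConn_eq k u hu t ht v, H.hodgeConn_eq k u' (ContDiffOn.congr hu h) t ht v, gradedConn,
    gradedConn, h'.fderiv_eq, h'.eq_of_nhds]

theorem isFlatHiggsBundle (hω : ω.IsAlt) (hω' : ω.Nondegenerate) (k : ℕ) :
    IsFlatHiggsBundle Ω (hodgeMetric ω 𝒥 k) (hodgeConn 𝒥 k) (higgsField 𝒥 k)
      (higgsFieldConj 𝒥 k) where
  metric := H.isHermitianMetric k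
  chern :=
    { isConnection := (H.isGradingFamily k).isConnection (H.hodgeConn_eq k)
      integrable := (H.isGradingFamily k).squareZero_part01 (H.hodgeConn_eq k)
      compatible := fun _ _ hu hw _ ht v => H.hodgeMetric_compatible hω k hu hw ht v }
  theta_smooth v a := (H.smoothOn_dz_grading k v (contDiffOn_const (c := a))).congr
    fun t ht => H.higgsField_eq hω' k ht v a
  theta_add t ht v w := by
    ext1 α
    rw [LinearMap.add_apply, H.higgsField_eq hω' k ht, H.higgsField_eq hω' k ht,
      H.higgsField_eq hω' k ht, dz_add_dir, add_apply]
  theta_smul t ht z v := by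
    ext1 α
    rw [LinearMap.smul_apply, H.higgsField_eq hω' k ht, H.higgsField_eq hω' k ht, dz_smul_dir,
      smul_apply]
  theta_holomorphic u hu t ht v w := by
    have hc := H.hodgeConn_congr k (H.smoothOn_dz_grading k w hu)
      (fun s hs => H.higgsField_eq hω' k hs w (u s)) ht
    rw [H.higgsField_eq hω' k ht,
      ← (H.isGradingFamily k).holomorphic (H.hodgeConn_eq k) hu ht v w]
    simp only [part01, hc]
  theta_closed u hu t ht v w := by
    have hc := fun w => H.hodgeConn_congr k (H.smoothOn_dz_grading k w hu)
      (fun s hs => H.higgsField_eq hω' k hs w (u s)) ht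
    have h := (H.isGradingFamily k).closed (H.hodgeConn_eq k) hu ht v w
    rw [H.higgsField_eq hω' k ht, H.higgsField_eq hω' k ht]
    simp only [part10, hc] at h ⊢
    exact h
  theta_sq t ht v w := by
    ext1 α
    simp only [LinearMap.comp_apply, H.higgsField_eq hω' k ht]
    exact DFunLike.congr_fun ((H.isGradingFamily k).dz_mul_comm ht v w) α
  theta_adjoint t ht v a b := H.theta_adjoint hω hω' k ht v a b
  flat := (H.isGradingFamily k).flat fun u hu t ht v => (H.trivialConn_eq hω' k hu ht v).symm

theorem higgsField_eq_zero (hω' : ω.Nondegenerate) (k : ℕ) {t : E} (ht : t ∈ Ω) (v : E)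
    {α : Form V k} (hα : α ∈ formsPQ (𝒥 t) k 0) : higgsField 𝒥 k t v α = 0 := by
  rw [H.higgsField_eq hω' k ht, H.dz_grading k ht]
  exact tensorAct_eq_zero_of_mem (Or.inl ⟨fun η hη => ksOf_of_mem01 hη _, rfl⟩) hα

theorem higgsField_mem (hω' : ω.Nondegenerate) {k p : ℕ} (hp : p < k) {t : E} (ht : t ∈ Ω) (v : E)
    {α : Form V k} (hα : α ∈ formsPQ (𝒥 t) k (p + 1)) :
    higgsField 𝒥 k t v α ∈ formsPQ (𝒥 t) k p := by
  rw [H.higgsField_eq hω' k ht, H.dz_grading k ht]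
  exact tensorAct_mem_formsPQ_of_bracket (H.mem t ht).1
    (proj10_bracket_ksOf (H.mul_self ht) (H.fderiv_mul ht v)) hp hα

end IsHolomorphicFamily

end Metric

/-! ### Injectivity of the Higgs field -/

section Admissible

variable {V : Type*} [NormedAddCommGroup V] [NormedSpace ℝ V] [FiniteDimensional ℝ V]

theorem form_eq_zero_of_coframe_wedge {j : ℕ} (hj : j < Module.finrank ℝ V) {γ : Form V j}
    (h : ∀ a, wedge (coframe V a) γ = 0) : γ = 0 := by
  have h1 := sum_curryLeft_wedge γ
  rw [Finset.sum_eq_zero fun a _ => by rw [h a]; rfl] at h1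
  refine (smul_eq_zero.1 h1.symm).resolve_left (sub_ne_zero.2 ?_)
  exact_mod_cast hj.ne'

/-- Induction downward in the degree: testing on e ∧ β with e in the coframe and moving e outward
shows that η ∧ ζ ∧ β is killed by all coframe wedges, hence zero below top degree. -/
theorem wedge_wedge_descend (η ζ : Covec V) {j : ℕ} (hj : j + 1 < Module.finrank ℝ V)
    (h : ∀ β : Form V j, wedge η (wedge ζ β) = 0) :
    wedge η (wedge ζ (ContinuousAlternatingMap.constOfIsEmpty ℝ V (Fin 0) (1 : ℂ))) = 0 := by
  induction j with
  | zero => exact h _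
  | succ j ih =>
    refine ih (by omega) fun β => form_eq_zero_of_coframe_wedge hj fun a => ?_
    rw [wedge_wedge_comm, wedge_wedge_comm (coframe V a) ζ, ← neg_one_smul ℂ (wedge ζ _),
      wedge_smul_right, h]
    exact (congrArg Neg.neg (smul_zero (A := Form V (j + 1 + 1 + 1)) (-1 : ℂ))).trans neg_zero

theorem tensorAct_injective {k : ℕ} (hk : 1 ≤ k) (hk' : k < Module.finrank ℝ V) {J : V →L[ℝ] V}
    {A : Covec V →L[ℂ] Covec V} (hA : ∀ η ∈ forms10 J, A η ∈ forms01 J) (h : tensorAct A k = 0)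
    {η : Covec V} (hη : η ∈ forms10 J) : A η = 0 := by
  obtain ⟨j, rfl⟩ : ∃ j, k = j + 1 := ⟨k - 1, by omega⟩
  -- The hypothesis is silent about the action of A on β, of degree k - 1; in the Leibniz rule for η
  -- ∧ β, a further wedge with η removes that term.
  have h1 : ∀ β : Form V j, wedge η (wedge (A η) β) = 0 := by
    intro β
    have := congrArg (wedge η) (tensorAct_wedge A η β)
    rwa [h, LinearMap.zero_apply, wedge_zero_right, wedge_add_right, wedge_wedge_self, add_zero,
      eq_comm] at this
  have h2 := wedge_wedge_descend η (A η) hk' h1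
  have h3 : ∀ x y, η x * A η y - η y * A η x = 0 := by
    intro x y
    have := DFunLike.congr_fun h2 ![x, y]
    simpa [wedge_apply, Fin.sum_univ_succ, Fin.removeNth, sub_eq_add_neg] using this
  by_contra hne
  obtain ⟨y, hy⟩ := DFunLike.ne_iff.1 hne
  refine hne ?_
  have h4 : η = 0 := by
    ext x
    -- Replacing x by Jx multiplies η(x) by i and Aη(x) by -i, so the two relations separate to η(x)
    -- Aη(y) = 0.
    have e1 := h3 x y
    have e2 := h3 (J x) y
    rw [hη, hA η hη] at e2
    have : η x * A η y = 0 := by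
      linear_combination (1 / 2 : ℂ) * e1 - (Complex.I / 2) * e2 +
        (1 / 2 : ℂ) * (η x * A η y + η y * A η x) * Complex.I_sq
    exact (mul_eq_zero.1 this).resolve_right hy
  rw [h4, map_zero]

omit [FiniteDimensional ℝ V] in
theorem ksOf_mem01 {J X : V →L[ℝ] V} (hJ : ∀ x, J (J x) = -x) (hXJ : X * J = -(J * X))
    (η : Covec V) : ksOf J X η ∈ forms01 J := by
  intro x
  have h1 : X (J x) = -J (X x) := DFunLike.congr_fun hXJ x
  simp [ksOf, h1, hJ]
  ring_nf
  simp
  ring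

omit [FiniteDimensional ℝ V] in
theorem ksOf_of_mem10 {J X : V →L[ℝ] V} {η : Covec V} (hη : η ∈ forms10 J) (x : V) :
    ksOf J X η x = -(Complex.I / 2) * η (X x) := by
  have h := hη (X x)
  simp [ksOf, h]
  ring

/-- For a real covector η, the real part of η(x) - iη(Jx) is η(x). -/
theorem eq_zero_of_forms10 {J : V →L[ℝ] V} (hJ : ∀ x, J (J x) = -x) {x : V}
    (h : ∀ η ∈ forms10 J, η x = 0) : x = 0 := by
  have hc : ∀ η : Covec V, conjCovec η = η → η x = 0 := by
    intro η hη
    have h1 := h _ (proj10_mem hJ η)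
    have h2 : η x - Complex.I * η (J x) = 0 := by
      rw [proj10_apply] at h1
      linear_combination 2 * h1
    have hr : ∀ y, (η y).im = 0 := fun y =>
      Complex.conj_eq_iff_im.1 (DFunLike.congr_fun hη y)
    have h3 := congrArg Complex.re h2
    simp [hr] at h3
    exact Complex.ext h3 (hr x)
  refine (Module.finBasis ℝ V).ext_elem fun a => ?_
  have h1 := hc (coframe V a) (by ext y; simp [conjCovec, coframe_apply])
  rw [coframe_apply] at h1
  simpa using h1

variable {E : Type*} [NormedAddCommGroup E] [NormedSpace ℂ E]
variable {ω : LinearMap.BilinForm ℝ V} {Ω : Set E} {𝒥 : E → V →L[ℝ] V}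

theorem IsHolomorphicFamily.isAdmissible (H : IsHolomorphicFamily ω Ω 𝒥) (hω : ω.Nondegenerate)
    (himm : ∀ t ∈ Ω, ∀ v, fderiv ℝ 𝒥 t v = 0 → v = 0) {k : ℕ} (hk : 1 ≤ k)
    (hk' : k < Module.finrank ℝ V) : IsAdmissible Ω (higgsField (V := V) 𝒥 k) := by
  intro t ht v w hvw
  have hJ := (H.mem t ht).1
  rw [← sub_eq_zero]
  refine himm t ht _ ?_
  have h0 : dz (grading 𝒥 k) t (v - w) = 0 := by
    have h1 : dz (grading 𝒥 k) t v = dz (grading 𝒥 k) t w := by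
      ext1 α
      rw [← H.higgsField_eq hω k ht, ← H.higgsField_eq hω k ht, hvw]
    have h2 := dz_add_dir (grading 𝒥 k) t (v - w) w
    rw [sub_add_cancel, h1] at h2
    have h3 := congrArg (fun A => A - dz (grading 𝒥 k) t w) h2
    simpa [sub_self] using h3.symm.trans (sub_self (dz (grading 𝒥 k) t w))
  rw [H.dz_grading k ht] at h0
  have h1 : tensorAct (ksOf (𝒥 t) (fderiv ℝ 𝒥 t (v - w))) k = 0 := by
    ext1 α
    exact DFunLike.congr_fun h0 α
  have h2 : ∀ η ∈ forms10 (𝒥 t), _ = _ := fun η hη => tensorAct_injective hk hk'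
    (fun η _ => ksOf_mem01 hJ (H.fderiv_mul ht (v - w)) η) h1 hη
  ext1 x
  refine eq_zero_of_forms10 hJ fun η hη => ?_
  have h3 := DFunLike.congr_fun (h2 η hη) x
  rw [ksOf_of_mem10 hη] at h3
  exact (mul_eq_zero.1 h3).resolve_left (by simp)

end Admissible

/-! ### Complex structures transported by a complex affine family -/

section Conjugation

variable {V : Type*} [NormedAddCommGroup V] [NormedSpace ℝ V]
variable {E : Type*} [NormedAddCommGroup E] [NormedSpace ℂ E]
variable {U : Type*} [NormedAddCommGroup U] [NormedSpace ℂ U] [CompleteSpace U]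

/-- The complex structure on `V` obtained by transporting multiplication by `i` along
`(1 + L t) ∘ Z`. -/
def transported (Z : V ≃L[ℝ] U) (L : E →L[ℂ] U →L[ℝ] U) (t : E) : V →L[ℝ] V :=
  (Z.symm : U →L[ℝ] V) ∘L (Ring.inverse (1 + L t) * (Complex.I • (1 + L t))) ∘L (Z : V →L[ℝ] U)

variable {Z : V ≃L[ℝ] U} {L : E →L[ℂ] U →L[ℝ] U} {Ω : Set E}

omit [CompleteSpace U] in
theorem apply_transported {t : E} (ht : IsUnit (1 + L t)) (x : V) :
    (1 + L t) (Z (transported Z L t x)) = Complex.I • (1 + L t) (Z x) := by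
  have h := DFunLike.congr_fun (Ring.mul_inverse_cancel _ ht) ((Complex.I • (1 + L t)) (Z x))
  simp only [transported, ContinuousLinearMap.comp_apply, mul_apply_eq_comp,
    ContinuousLinearEquiv.coe_coe, ContinuousLinearEquiv.apply_symm_apply] at h ⊢
  exact h

omit [CompleteSpace U] in
theorem injective_of_isUnit {A : U →L[ℝ] U} (hA : IsUnit A) : Function.Injective A := by
  intro x y hxy
  have h := congrArg (fun z => (Ring.inverse A : U →L[ℝ] U) z) hxy
  have h1 : ∀ z, Ring.inverse A (A z) = z := fun z => by
    have h2 := congrArg (fun B : U →L[ℝ] U => B z) (Ring.inverse_mul_cancel _ hA)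
    exact h2
  rwa [h1, h1] at h

omit [CompleteSpace U] in
theorem transported_transported {t : E} (ht : IsUnit (1 + L t)) (x : V) :
    transported Z L t (transported Z L t x) = -x := by
  apply Z.injective
  apply injective_of_isUnit ht
  rw [apply_transported ht, apply_transported ht, smul_smul, Complex.I_mul_I, map_neg, map_neg,
    neg_one_smul]

theorem smooth_transported (hΩ : ∀ t ∈ Ω, IsUnit (1 + L t)) :
    ContDiffOn ℝ ((⊤ : ℕ∞) : WithTop ℕ∞) (transported Z L) Ω := by
  have h0 : ContDiff ℝ ((⊤ : ℕ∞) : WithTop ℕ∞) fun t => 1 + L t := 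
    contDiff_const.add (L.restrictScalars ℝ).contDiff
  have h1 : ContDiffOn ℝ ((⊤ : ℕ∞) : WithTop ℕ∞) (fun t => Ring.inverse (1 + L t)) Ω := by
    intro t ht
    obtain ⟨a, ha⟩ := hΩ t ht
    have h2 := contDiffAt_ringInverse ℝ (n := ((⊤ : ℕ∞) : WithTop ℕ∞)) a
    rw [ha] at h2
    exact (h2.comp t h0.contDiffAt).contDiffWithinAt
  exact contDiffOn_const.clm_comp
    ((h1.mul (h0.const_smul Complex.I).contDiffOn).clm_comp contDiffOn_const)

/-- Differentiating (1 + L_t) Z J_t x = i (1 + L_t) Z x avoids the derivative of the inverse. -/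
theorem fderiv_transported (hΩ : ∀ t ∈ Ω, IsUnit (1 + L t)) (ho : IsOpen Ω) {t : E} (ht : t ∈ Ω)
    (v : E) (x : V) :
    (1 + L t) (Z (fderiv ℝ (transported Z L) t v x)) =
      Complex.I • L v (Z x) - L v (Z (transported Z L t x)) := by
  have hd : HasFDerivAt (transported Z L) (fderiv ℝ (transported Z L) t) t :=
    (((smooth_transported hΩ).contDiffAt (ho.mem_nhds ht)).differentiableAt (by simp)).hasFDerivAt
  have h0 : HasFDerivAt (fun s => 1 + L s) (L.restrictScalars ℝ) t :=
    (L.restrictScalars ℝ).hasFDerivAt.const_add 1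
  have h1 := h0.clm_apply (((Z : V →L[ℝ] U).hasFDerivAt).comp t
    (hd.clm_apply (hasFDerivAt_const x t)))
  have h2 := (h0.clm_apply (hasFDerivAt_const (Z x) t)).const_smul Complex.I
  have h3 : (fun s => (1 + L s) (Z (transported Z L s x))) =ᶠ[nhds t]
      fun s => Complex.I • (1 + L s) (Z x) :=
    Filter.eventuallyEq_of_mem (ho.mem_nhds ht) fun s hs => apply_transported (hΩ s hs) x
  have h4 := congrArg (fun A : E →L[ℝ] U => A v) (h1.unique (h2.congr_of_eventuallyEq h3))
  simp at h4
  rw [← h4]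
  simp

/-- The right side of `fderiv_transported` is complex linear in v, and (1 + L_t)Z intertwines J_t
with multiplication by i. -/
theorem fderiv_transported_I_smul (hΩ : ∀ t ∈ Ω, IsUnit (1 + L t)) (ho : IsOpen Ω)
    {t : E} (ht : t ∈ Ω) (v : E) :
    fderiv ℝ (transported Z L) t (Complex.I • v) =
      transported Z L t * fderiv ℝ (transported Z L) t v := by
  ext x
  apply Z.injective
  apply injective_of_isUnit (hΩ t ht)
  rw [fderiv_transported hΩ ho ht, mul_apply_eq_comp, apply_transported (hΩ t ht),
    fderiv_transported hΩ ho ht, map_smul, smul_sub]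
  rfl

end Conjugation

/-! ### The bounded symmetric domain -/

section Antilinear

variable {n : ℕ}

/-- The antilinear map `z ↦ t z̄` defined by a symmetric matrix, as a function of `t`. -/
def antilinear (n : ℕ) : symMatrices n →L[ℂ] (Fin n → ℂ) →L[ℝ] (Fin n → ℂ) :=
  LinearMap.toContinuousLinearMap
    { toFun := fun t => LinearMap.toContinuousLinearMap
        { toFun := fun z => (t : Matrix (Fin n) (Fin n) ℂ).mulVec (star z)
          map_add' := fun z w => by rw [star_add, Matrix.mulVec_add]
          map_smul' := fun r z => by
            rw [star_smul, star_trivial, Matrix.mulVec_smul, RingHom.id_apply] }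
      map_add' := fun s t => by
        ext1 z
        exact Matrix.add_mulVec (s : Matrix (Fin n) (Fin n) ℂ) t (star z)
      map_smul' := fun r t => by
        ext1 z
        exact Matrix.smul_mulVec r (t : Matrix (Fin n) (Fin n) ℂ) (star z) }

theorem antilinear_apply (t : symMatrices n) (z : Fin n → ℂ) :
    antilinear n t z = (t : Matrix (Fin n) (Fin n) ℂ).mulVec (star z) := rfl

/-- The real number `|w|² - |t w̄|²`. -/
def defect (t : symMatrices n) (w : Fin n → ℂ) : ℝ :=
  (w ⬝ᵥ star w - antilinear n t w ⬝ᵥ star (antilinear n t w)).re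

theorem defect_eq (t : symMatrices n) (w : Fin n → ℂ) :
    (defect t w : ℂ) = w ⬝ᵥ star w - antilinear n t w ⬝ᵥ star (antilinear n t w) := by
  have h : ∀ w : Fin n → ℂ, (w ⬝ᵥ star w).im = 0 := by
    intro w
    simp [dotProduct, Complex.mul_conj]
  refine Complex.ext rfl ?_
  rw [Complex.sub_im, h, h, Complex.ofReal_im, sub_zero]

theorem defect_real_smul (t : symMatrices n) (r : ℝ) (w : Fin n → ℂ) :
    defect t (r • w) = r ^ 2 * defect t w := by
  apply Complex.ofReal_injective
  push_cast
  rw [defect_eq, defect_eq, map_smul, star_smul, star_smul, star_trivial]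
  simp only [smul_dotProduct, dotProduct_smul, Complex.real_smul]
  ring

/-- For symmetric t the conjugate of t is its adjoint, so the quadratic form of 1 - t t̄ at w is
|w|² - |t w̄|². -/
theorem mem_bsd_iff (t : symMatrices n) : t ∈ bsd n ↔ ∀ w ≠ 0, 0 < defect t w := by
  have hs : (t : Matrix (Fin n) (Fin n) ℂ).transpose = t := t.2
  have hc : (t : Matrix (Fin n) (Fin n) ℂ).map (starRingEnd ℂ) =
      (t : Matrix (Fin n) (Fin n) ℂ).conjTranspose := by
    rw [Matrix.conjTranspose, hs]; rfl
  have h : ∀ w : Fin n → ℂ, star w ⬝ᵥ (1 - (t : Matrix (Fin n) (Fin n) ℂ) *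
      (t : Matrix (Fin n) (Fin n) ℂ).map (starRingEnd ℂ)).mulVec w = (defect t w : ℂ) := by
    intro w
    rw [defect_eq, Matrix.sub_mulVec, Matrix.one_mulVec, dotProduct_sub, dotProduct_comm,
      antilinear_apply, hc, Matrix.star_mulVec, star_star, ← Matrix.mulVec_mulVec,
      Matrix.dotProduct_mulVec, ← Matrix.mulVec_transpose, hs]
    congr 2
    rw [← Matrix.mulVec_transpose, Matrix.conjTranspose, hs, ← Matrix.transpose_map, hs]
  rw [bsd, Set.mem_ofPred_eq, Matrix.posDef_iff_dotProduct_mulVec]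
  simp only [h, Complex.zero_lt_real]
  refine ⟨fun h => fun w hw => h.2 hw, fun h => ⟨?_, fun w hw => h w hw⟩⟩
  rw [hc]
  exact Matrix.isHermitian_one.sub (Matrix.isHermitian_mul_conjTranspose_self _)

theorem isOpen_bsd (n : ℕ) : IsOpen (bsd n) := by
  -- By homogeneity positivity may be tested on the unit sphere, whose compactness gives openness.
  have h : bsd n = {t | ∀ w ∈ Metric.sphere (0 : Fin n → ℂ) 1, 0 < defect t w} := by
    ext t
    rw [mem_bsd_iff]
    refine ⟨fun h w hw => h w (ne_zero_of_mem_unit_sphere ⟨w, hw⟩), fun h w hw => ?_⟩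
    have h1 := h ((‖w‖⁻¹ : ℝ) • w) (by simp [norm_smul, hw])
    rw [defect_real_smul] at h1
    exact pos_of_mul_pos_right h1 (sq_nonneg _)
  rw [h, isOpen_iff_mem_nhds]
  intro t ht
  refine (isCompact_sphere _ _).eventually_forall_of_forall_eventually fun w hw => ?_
  have hc : Continuous fun z : symMatrices n × (Fin n → ℂ) => defect z.1 z.2 := by
    have h1 : Continuous fun z : symMatrices n × (Fin n → ℂ) => antilinear n z.1 z.2 :=
      ((antilinear n).continuous.comp continuous_fst).clm_apply continuous_snd
    exact Complex.continuous_re.comp ((continuous_snd.dotProduct continuous_snd.star).sub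
      (h1.dotProduct h1.star))
  exact hc.continuousAt.eventually (lt_mem_nhds (ht w hw))

theorem isUnit_one_add_antilinear {t : symMatrices n} (ht : t ∈ bsd n) :
    IsUnit (1 + antilinear n t) := by
  rw [mem_bsd_iff] at ht
  have hinj : Function.Injective (1 + antilinear n t : (Fin n → ℂ) →L[ℝ] (Fin n → ℂ)) := by
    refine (injective_iff_map_eq_zero _).2 fun z hz => ?_
    by_contra hne
    -- A kernel vector satisfies |t z̄| = |z|, so its defect vanishes.
    have h1 : antilinear n t z = -z := (eq_neg_of_add_eq_zero_right hz)
    have h2 := ht z hne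
    rw [defect, h1] at h2
    simp at h2
  let e := (LinearEquiv.ofInjectiveEndo
    (1 + antilinear n t : (Fin n → ℂ) →L[ℝ] (Fin n → ℂ)).toLinearMap hinj).toContinuousLinearEquiv
  exact ⟨ContinuousLinearEquiv.unitsEquiv _ _ |>.symm e, by ext1 z; rfl⟩

end Antilinear

/-! ### Coordinates of compatible complex structures -/

section Coordinates

variable {V : Type*} [NormedAddCommGroup V] [NormedSpace ℝ V]
variable {n : ℕ} {ω : LinearMap.BilinForm ℝ V} {Z : V ≃L[ℝ] (Fin n → ℂ)}

/-- The coordinate isomorphism defined by a unitary coframe. -/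
theorem IsUnitaryCoframe.exists_equiv [FiniteDimensional ℝ V] (hV : Module.finrank ℝ V = 2 * n)
    (hω : ω.Nondegenerate) {J₀ : V →L[ℝ] V} {ξ : Fin n → Covec V}
    (hξ : IsUnitaryCoframe ω J₀ ξ) : ∃ Z : V ≃L[ℝ] (Fin n → ℂ), ∀ x j, Z x j = ξ j x := by
  let f : V →ₗ[ℝ] (Fin n → ℂ) := LinearMap.pi fun j => (ξ j).toLinearMap
  have hf : Function.Injective f := by
    refine (injective_iff_map_eq_zero _).2 fun x hx => ?_
    have h0 : ∀ j, ξ j x = 0 := fun j => congrFun hx j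
    refine hω.1 x fun y => ?_
    have h1 := hξ.2 x y
    rw [Finset.sum_eq_zero fun j _ => by simp [conjCovec, h0 j], mul_zero] at h1
    exact_mod_cast h1
  have hd : Module.finrank ℝ V = Module.finrank ℝ (Fin n → ℂ) := by
    rw [hV, Module.finrank_pi_fintype]
    simp [Complex.finrank_real_complex, mul_comm]
  exact ⟨(LinearEquiv.ofInjectiveOfFinrankEq f hf hd).toContinuousLinearEquiv, fun x j => rfl⟩

theorem IsUnitaryCoframe.eq_dotProduct {J₀ : V →L[ℝ] V} {ξ : Fin n → Covec V}
    (hξ : IsUnitaryCoframe ω J₀ ξ) (hZ : ∀ x j, Z x j = ξ j x) (x y : V) :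
    (ω x y : ℂ) = Complex.I * (Z x ⬝ᵥ star (Z y) - Z y ⬝ᵥ star (Z x)) := by
  rw [hξ.2, dotProduct, dotProduct, ← Finset.sum_sub_distrib]
  simp only [Pi.star_apply, hZ]
  rfl

/-- The part of `Z ∘ J` which commutes with the complex structures. -/
def linearPart (Z : V ≃L[ℝ] (Fin n → ℂ)) (J : V →L[ℝ] V) : V →ₗ[ℝ] (Fin n → ℂ) :=
  (((Z : V →L[ℝ] (Fin n → ℂ)) ∘L J) + Complex.I • (Z : V →L[ℝ] (Fin n → ℂ))).toLinearMap

/-- The part of `-Z ∘ J` which anticommutes with the complex structures. -/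
def antilinearPart (Z : V ≃L[ℝ] (Fin n → ℂ)) (J : V →L[ℝ] V) : V →ₗ[ℝ] (Fin n → ℂ) :=
  (Complex.I • (Z : V →L[ℝ] (Fin n → ℂ)) - ((Z : V →L[ℝ] (Fin n → ℂ)) ∘L J)).toLinearMap

theorem linearPart_apply (J : V →L[ℝ] V) (x : V) :
    linearPart Z J x = Z (J x) + Complex.I • Z x := rfl

theorem antilinearPart_apply (J : V →L[ℝ] V) (x : V) :
    antilinearPart Z J x = Complex.I • Z x - Z (J x) := rfl

theorem four_mul_apply (hZ : ∀ x y, (ω x y : ℂ) =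
    Complex.I * (Z x ⬝ᵥ star (Z y) - Z y ⬝ᵥ star (Z x))) (J : V →L[ℝ] V) (x y : V) :
    4 * (ω x (J y) : ℂ) =
      (linearPart Z J x + antilinearPart Z J x) ⬝ᵥ
          star (linearPart Z J y - antilinearPart Z J y) +
        (linearPart Z J y - antilinearPart Z J y) ⬝ᵥ
          star (linearPart Z J x + antilinearPart Z J x) := by
  have h1 : linearPart Z J x + antilinearPart Z J x = (2 * Complex.I) • Z x := by
    rw [linearPart_apply, antilinearPart_apply]; module
  have h2 : linearPart Z J y - antilinearPart Z J y = (2 : ℂ) • Z (J y) := by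
    rw [linearPart_apply, antilinearPart_apply]; module
  rw [h1, h2, hZ]
  simp only [star_smul, smul_dotProduct, dotProduct_smul, smul_eq_mul]
  simp
  ring

theorem transport_iff (J : V →L[ℝ] V) (t : symMatrices n) (x : V) :
    (1 + antilinear n t) (Z (J x)) = Complex.I • (1 + antilinear n t) (Z x) ↔
      antilinearPart Z J x = antilinear n t (linearPart Z J x) := by
  have h : antilinear n t (linearPart Z J x) =
      antilinear n t (Z (J x)) - Complex.I • antilinear n t (Z x) := by
    simp only [antilinear_apply, linearPart_apply, star_add, star_smul, Matrix.mulVec_add,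
      Matrix.mulVec_smul]
    simp [sub_eq_add_neg]
  rw [h, antilinearPart_apply]
  have h1 : ∀ z : Fin n → ℂ, (1 + antilinear n t) z = z + antilinear n t z := fun z => rfl
  rw [h1, h1, smul_add, sub_eq_sub_iff_add_eq_add, add_comm (Complex.I • Z x), eq_comm,
    add_comm (Z (J x))]

theorem antilinear_dotProduct (t : symMatrices n) (w z : Fin n → ℂ) :
    antilinear n t w ⬝ᵥ star z = antilinear n t z ⬝ᵥ star w := by
  rw [antilinear_apply, antilinear_apply, dotProduct_comm, Matrix.dotProduct_mulVec,
    ← Matrix.mulVec_transpose, t.2]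

/-- In the expansion of `four_mul_apply` only the cross terms between linear and antilinear parts
could break the symmetry, and they cancel because t is symmetric. -/
theorem apply_comm_of_transport (hZ : ∀ x y, (ω x y : ℂ) =
    Complex.I * (Z x ⬝ᵥ star (Z y) - Z y ⬝ᵥ star (Z x))) {J : V →L[ℝ] V} {t : symMatrices n}
    (h : ∀ x, antilinearPart Z J x = antilinear n t (linearPart Z J x)) (x y : V) :
    ω x (J y) = ω y (J x) := by
  have h1 := four_mul_apply hZ J x y
  have h2 := four_mul_apply hZ J y x
  have h3 := antilinear_dotProduct t (linearPart Z J x) (linearPart Z J y)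
  have h4 := congrArg star h3
  rw [← Matrix.star_dotProduct_star, ← Matrix.star_dotProduct_star, star_star, star_star] at h4
  rw [← h, ← h] at h3 h4
  simp only [star_add, star_sub, add_dotProduct, sub_dotProduct, dotProduct_add,
    dotProduct_sub] at h1 h2
  have h5 : (4 : ℂ) * ω x (J y) = 4 * ω y (J x) := by
    rw [h1, h2]
    linear_combination 2 * h3 + 2 * h4
  exact_mod_cast mul_left_cancel₀ (four_ne_zero) h5

theorem two_mul_apply_self (hZ : ∀ x y, (ω x y : ℂ) =
    Complex.I * (Z x ⬝ᵥ star (Z y) - Z y ⬝ᵥ star (Z x))) {J : V →L[ℝ] V} {t : symMatrices n}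
    {x : V} (h : antilinearPart Z J x = antilinear n t (linearPart Z J x)) :
    2 * ω x (J x) = defect t (linearPart Z J x) := by
  have h1 := four_mul_apply hZ J x x
  apply Complex.ofReal_injective
  rw [defect_eq, ← h]
  simp only [star_add, star_sub, add_dotProduct, sub_dotProduct, dotProduct_add,
    dotProduct_sub] at h1
  push_cast
  linear_combination (1 / 2 : ℂ) * h1

theorem eq_zero_of_linearPart {J : V →L[ℝ] V} {t : symMatrices n} {x : V}
    (h : antilinearPart Z J x = antilinear n t (linearPart Z J x)) (hx : linearPart Z J x = 0) :
    x = 0 := by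
  rw [hx, map_zero, antilinearPart_apply, sub_eq_zero] at h
  rw [linearPart_apply, ← h, ← two_smul ℂ, smul_smul] at hx
  exact Z.map_eq_zero_iff.1 ((smul_eq_zero.1 hx).resolve_left (by simp))

theorem linearPart_injective_of_mem (hZ : ∀ x y, (ω x y : ℂ) =
    Complex.I * (Z x ⬝ᵥ star (Z y) - Z y ⬝ᵥ star (Z x))) {J : V →L[ℝ] V}
    (hJ : J ∈ compatibleJ ω) : Function.Injective (linearPart Z J) := by
  refine (injective_iff_map_eq_zero _).2 fun x hx => ?_
  by_contra hne
  have h1 := hJ.2.2 x hne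
  have h2 := four_mul_apply hZ J x x
  rw [hx] at h2
  have h3 : ∀ w : Fin n → ℂ, 0 ≤ (w ⬝ᵥ star w).re := by
    intro w
    simp only [dotProduct, Pi.star_apply, RCLike.star_def, Complex.mul_conj, Complex.re_sum,
      Complex.ofReal_re]
    exact Finset.sum_nonneg fun i _ => Complex.normSq_nonneg _
  have h4 := congrArg Complex.re h2
  simp at h4
  linarith [h3 (antilinearPart Z J x)]

theorem linearPart_bijective [FiniteDimensional ℝ V] {J : V →L[ℝ] V}
    (h : Function.Injective (linearPart Z J)) : Function.Bijective (linearPart Z J) :=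
  ⟨h, (LinearMap.injective_iff_surjective_of_finrank_eq_finrank
    Z.toLinearEquiv.finrank_eq).1 h⟩

theorem linearPart_comp {J : V →L[ℝ] V} (hJ : ∀ x, J (J x) = -x) (x : V) :
    linearPart Z J (J x) = Complex.I • linearPart Z J x := by
  rw [linearPart_apply, linearPart_apply, hJ, map_neg, smul_add, smul_smul, Complex.I_mul_I]
  module

theorem antilinearPart_comp {J : V →L[ℝ] V} (hJ : ∀ x, J (J x) = -x) (x : V) :
    antilinearPart Z J (J x) = -Complex.I • antilinearPart Z J x := by
  rw [antilinearPart_apply, antilinearPart_apply, hJ, map_neg, smul_sub, smul_smul, neg_mul,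
    Complex.I_mul_I]
  module

/-- Every compatible complex structure has a coordinate. -/
theorem exists_coordinate [FiniteDimensional ℝ V] (hZ : ∀ x y, (ω x y : ℂ) =
    Complex.I * (Z x ⬝ᵥ star (Z y) - Z y ⬝ᵥ star (Z x))) {J : V →L[ℝ] V}
    (hJ : J ∈ compatibleJ ω) :
    ∃ t ∈ bsd n, ∀ x, antilinearPart Z J x = antilinear n t (linearPart Z J x) := by
  have hb := linearPart_bijective (linearPart_injective_of_mem hZ hJ)
  let e := LinearEquiv.ofBijective (linearPart Z J) hb
  have he : ∀ x, e x = linearPart Z J x := fun _ => rfl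
  -- The linear part intertwines J with i and the antilinear part with -i, so w ↦ `antilinearPart`
  -- of the preimage of w̄ is complex linear and has a matrix.
  have hI : ∀ w, antilinearPart Z J (e.symm (star (Complex.I • w))) =
      Complex.I • antilinearPart Z J (e.symm (star w)) := by
    intro w
    have h1 : star (Complex.I • w) = e (-J (e.symm (star w))) := by
      rw [he, map_neg, linearPart_comp hJ.1, ← he, e.apply_symm_apply, star_smul]
      simp
    rw [h1, e.symm_apply_apply, map_neg, antilinearPart_comp hJ.1, neg_smul, neg_neg]
  let T : (Fin n → ℂ) →ₗ[ℂ] (Fin n → ℂ) :=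
    { toFun := fun w => antilinearPart Z J (e.symm (star w))
      map_add' := fun w z => by rw [star_add, map_add, map_add]
      map_smul' := fun z w => by
        have hr : ∀ (r : ℝ) (w : Fin n → ℂ), antilinearPart Z J (e.symm (star (r • w))) =
            r • antilinearPart Z J (e.symm (star w)) := fun r w => by
          rw [star_smul, star_trivial, map_smul, map_smul]
        have hz : ∀ w : Fin n → ℂ, z • w = z.re • w + z.im • (Complex.I • w) := by
          intro w
          conv_lhs => rw [← Complex.re_add_im z]
          rw [add_smul, mul_smul]
          rfl
        rw [hz, star_add, map_add, map_add, hr, hr, hI, RingHom.id_apply, ← hz] }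
  have hT : ∀ w, (LinearMap.toMatrix' T).mulVec w = antilinearPart Z J (e.symm (star w)) :=
    fun w => LinearMap.toMatrix'_mulVec T w
  have hM : ∀ x, antilinearPart Z J x = (LinearMap.toMatrix' T).mulVec (star (linearPart Z J x)) := by
    intro x
    rw [hT, star_star, ← he, e.symm_apply_apply]
  have hB : ∀ x y, antilinearPart Z J x ⬝ᵥ star (linearPart Z J y) =
      antilinearPart Z J y ⬝ᵥ star (linearPart Z J x) := by
    have key : ∀ x y, (antilinearPart Z J x ⬝ᵥ star (linearPart Z J y) -
        antilinearPart Z J y ⬝ᵥ star (linearPart Z J x)) +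
        (linearPart Z J y ⬝ᵥ star (antilinearPart Z J x) -
          linearPart Z J x ⬝ᵥ star (antilinearPart Z J y)) = 0 := by
      intro x y
      have h1 := four_mul_apply hZ J x y
      have h2 := four_mul_apply hZ J y x
      rw [hJ.2.1 x y] at h1
      simp only [star_add, star_sub, add_dotProduct, sub_dotProduct, dotProduct_add,
        dotProduct_sub] at h1 h2
      linear_combination (1 / 2 : ℂ) * h2 - (1 / 2 : ℂ) * h1
    intro x y
    -- Replacing x by Jx multiplies the first bracket of `key` by -i and the second by i, so each
    -- bracket vanishes separately.
    have h1 := key x y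
    have h2 := key (J x) y
    rw [linearPart_comp hJ.1, antilinearPart_comp hJ.1] at h2
    simp only [star_smul, smul_dotProduct, dotProduct_smul, smul_eq_mul] at h2
    simp at h2
    linear_combination (1 / 2 : ℂ) * h1 + (Complex.I / 2) * h2 +
      (1 / 2 : ℂ) * (antilinearPart Z J x ⬝ᵥ star (linearPart Z J y) -
        antilinearPart Z J y ⬝ᵥ star (linearPart Z J x) -
        (linearPart Z J y ⬝ᵥ star (antilinearPart Z J x) -
          linearPart Z J x ⬝ᵥ star (antilinearPart Z J y))) * Complex.I_sq
  have hs : LinearMap.toMatrix' T ∈ symMatrices n := by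
    have h1 : ∀ w z, (LinearMap.toMatrix' T).mulVec w ⬝ᵥ z =
        (LinearMap.toMatrix' T).mulVec z ⬝ᵥ w := by
      intro w z
      have := hB (e.symm (star w)) (e.symm (star z))
      rw [← hT, ← hT, ← he, ← he, e.apply_symm_apply, e.apply_symm_apply, star_star, star_star]
        at this
      exact this
    change (LinearMap.toMatrix' T).transpose = LinearMap.toMatrix' T
    ext j k
    have := h1 (Pi.single j 1) (Pi.single k 1)
    simpa using this
  have hM' : ∀ x, antilinearPart Z J x = antilinear n ⟨_, hs⟩ (linearPart Z J x) := hM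
  refine ⟨⟨_, hs⟩, (mem_bsd_iff _).2 fun w hw => ?_, hM'⟩
  obtain ⟨x, rfl⟩ := hb.2 w
  rw [← two_mul_apply_self hZ (hM' x)]
  have := hJ.2.2 x (by rintro rfl; exact hw (map_zero _))
  positivity

theorem eq_of_transport [FiniteDimensional ℝ V] {J : V →L[ℝ] V} {s t : symMatrices n}
    (hs : ∀ x, antilinearPart Z J x = antilinear n s (linearPart Z J x))
    (ht : ∀ x, antilinearPart Z J x = antilinear n t (linearPart Z J x)) : s = t := by
  have hb := linearPart_bijective (Z := Z) (J := J)
    ((injective_iff_map_eq_zero _).2 fun x hx => eq_zero_of_linearPart (hs x) hx)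
  have h : ∀ w : Fin n → ℂ, (s : Matrix (Fin n) (Fin n) ℂ).mulVec w =
      (t : Matrix (Fin n) (Fin n) ℂ).mulVec w := by
    intro w
    obtain ⟨x, hx⟩ := hb.2 (star w)
    have h1 := (hs x).symm.trans (ht x)
    rwa [hx, antilinear_apply, antilinear_apply, star_star] at h1
  exact Subtype.ext (Matrix.ext_of_mulVec_single fun j => h _)

end Coordinates

/-! ### The transported family as inverse of the coordinate -/

section Family

variable {V : Type*} [NormedAddCommGroup V] [NormedSpace ℝ V]
variable {n : ℕ} {ω : LinearMap.BilinForm ℝ V} {Z : V ≃L[ℝ] (Fin n → ℂ)}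

theorem antilinearPart_transported {t : symMatrices n} (ht : t ∈ bsd n) (x : V) :
    antilinearPart Z (transported Z (antilinear n) t) x =
      antilinear n t (linearPart Z (transported Z (antilinear n) t) x) :=
  (transport_iff _ t x).1 (apply_transported (isUnit_one_add_antilinear ht) x)

theorem transported_mem (hZ : ∀ x y, (ω x y : ℂ) =
    Complex.I * (Z x ⬝ᵥ star (Z y) - Z y ⬝ᵥ star (Z x))) {t : symMatrices n} (ht : t ∈ bsd n) :
    transported Z (antilinear n) t ∈ compatibleJ ω := by
  have h := antilinearPart_transported (Z := Z) ht
  refine ⟨transported_transported (isUnit_one_add_antilinear ht), apply_comm_of_transport hZ h,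
    fun x hx => ?_⟩
  have h1 := two_mul_apply_self hZ (h x)
  have h2 := (mem_bsd_iff t).1 ht _ fun h0 => hx (eq_zero_of_linearPart (h x) h0)
  linarith

variable [FiniteDimensional ℝ V]

theorem bijOn_transported (hZ : ∀ x y, (ω x y : ℂ) =
    Complex.I * (Z x ⬝ᵥ star (Z y) - Z y ⬝ᵥ star (Z x))) :
    Set.BijOn (transported Z (antilinear n)) (bsd n) (compatibleJ ω) := by
  refine ⟨fun t ht => transported_mem hZ ht, fun s hs t ht hst => ?_, fun J hJ => ?_⟩
  · have h := antilinearPart_transported (Z := Z) hs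
    rw [hst] at h
    exact eq_of_transport h (antilinearPart_transported ht)
  · obtain ⟨t, ht, h⟩ := exists_coordinate hZ hJ
    refine ⟨t, ht, ?_⟩
    ext x
    apply Z.injective
    apply injective_of_isUnit (isUnit_one_add_antilinear ht)
    exact (apply_transported (isUnit_one_add_antilinear ht) x).trans
      ((transport_iff J t x).2 (h x)).symm

omit [FiniteDimensional ℝ V] in
theorem isHolomorphicFamily_transported (hZ : ∀ x y, (ω x y : ℂ) =
    Complex.I * (Z x ⬝ᵥ star (Z y) - Z y ⬝ᵥ star (Z x))) :
    IsHolomorphicFamily ω (bsd n) (transported Z (antilinear n)) where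
  isOpen := isOpen_bsd n
  smooth := smooth_transported fun _ ht => isUnit_one_add_antilinear ht
  mem _ ht := transported_mem hZ ht
  holomorphic _ ht v :=
    fderiv_transported_I_smul (fun _ ht => isUnit_one_add_antilinear ht) (isOpen_bsd n) ht v

theorem immersion_transported {t : symMatrices n} (ht : t ∈ bsd n) {v : symMatrices n}
    (hv : fderiv ℝ (transported Z (antilinear n)) t v = 0) : v = 0 := by
  have h := antilinearPart_transported (Z := Z) ht
  set J := transported Z (antilinear n) t with hJ
  have hb := linearPart_bijective (Z := Z) (J := J)
    ((injective_iff_map_eq_zero _).2 fun x hx => eq_zero_of_linearPart (h x) hx)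
  -- When the derivative is zero, i L_v Zx = L_v ZJx; by antilinearity L_v kills ZJx + iZx, and
  -- these vectors fill ℂ^n.
  have h1 : ∀ x, antilinear n v (linearPart Z J x) = 0 := by
    intro x
    have h2 : (1 + antilinear n t) (Z ((0 : V →L[ℝ] V) x)) =
        Complex.I • antilinear n v (Z x) - antilinear n v (Z (J x)) := by
      rw [← hv]
      exact fderiv_transported (fun _ ht => isUnit_one_add_antilinear ht) (isOpen_bsd n) ht v x
    rw [zero_apply, map_zero, map_zero] at h2
    simp only [antilinear_apply, linearPart_apply, star_add, star_smul, Matrix.mulVec_add,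
      Matrix.mulVec_smul] at h2 ⊢
    simp only [RCLike.star_def, Complex.conj_I, neg_smul]
    rw [← sub_eq_add_neg, ← neg_eq_zero, neg_sub]
    exact h2.symm
  refine Subtype.ext (Matrix.ext_of_mulVec_single fun j => ?_)
  obtain ⟨x, hx⟩ := hb.2 (star (Pi.single j 1))
  have h2 := h1 x
  rw [hx, antilinear_apply, star_star] at h2
  rw [h2]
  exact (Matrix.zero_mulVec _).symm

theorem isKNSMatrix_transported (hω : ω.Nondegenerate) {J₀ : V →L[ℝ] V} (hJ₀ : J₀ ∈ compatibleJ ω)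
    {ξ : Fin n → Covec V} (hξ : IsUnitaryCoframe ω J₀ ξ) (hZξ : ∀ x j, Z x j = ξ j x)
    {t : symMatrices n} (ht : t ∈ bsd n) :
    IsKNSMatrix (transported Z (antilinear n) t) J₀ ξ t := by
  intro k
  have hmem := transported_mem (hξ.eq_dotProduct hZξ) ht
  have hconj : ∀ j, conjCovec (ξ j) ∈ forms01 J₀ := by
    intro j x
    have := congrArg (starRingEnd ℂ) (hξ.1 j x)
    rw [map_mul, Complex.conj_I] at this
    exact this
  refine kns_eq_of_mem hω hmem hJ₀ (hξ.1 k) (Submodule.sum_mem _ fun j _ =>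
    Submodule.smul_mem _ _ (hconj j)) fun x => ?_
  -- The k-th component of (1 + L_t)Z is ξ^k + ∑ t_{jk} ξ̄^j, using t = t^T; it is of type (1,0) for
  -- J_t, which is the graph condition characterizing Φ.
  have h : ∀ x, (ξ k + ∑ j, (t : Matrix (Fin n) (Fin n) ℂ) j k • conjCovec (ξ j)) x =
      ((1 + antilinear n t) (Z x)) k := by
    intro x
    have h1 : (1 + antilinear n t) (Z x) = Z x + antilinear n t (Z x) := rfl
    rw [h1, Pi.add_apply, hZξ, antilinear_apply, Matrix.mulVec, dotProduct]
    simp only [add_apply, sum_apply, smul_apply, smul_eq_mul]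
    congr 1
    refine Finset.sum_congr rfl fun j _ => ?_
    rw [Pi.star_apply, hZξ]
    have h2 : (t : Matrix (Fin n) (Fin n) ℂ) j k = (t : Matrix (Fin n) (Fin n) ℂ) k j :=
      congrFun (congrFun t.2 k) j
    rw [h2]
    rfl
  rw [h, h]
  exact congrFun (apply_transported (isUnit_one_add_antilinear ht) x) k

end Family

end HiggsJ

end

/-! ### The main theorem -/

theorem mainTheorem10 {V : Type*} [NormedAddCommGroup V] [NormedSpace ℝ V]
    [FiniteDimensional ℝ V] (n : ℕ) (hV : Module.finrank ℝ V = 2 * n)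
    (ω : LinearMap.BilinForm ℝ V) (hω_alt : ω.IsAlt) (hω : ω.Nondegenerate)
    (J₀ : V →L[ℝ] V) (hJ₀ : J₀ ∈ HiggsJ.compatibleJ ω)
    (ξ : Fin n → HiggsJ.Covec V) (hξ : HiggsJ.IsUnitaryCoframe ω J₀ ξ) :
    ∃ 𝒥 : HiggsJ.symMatrices n → V →L[ℝ] V,
      -- `𝒥` is the inverse of the global holomorphic coordinate on `𝒥(V, ω)` given by `J₀` and `ξ`
      Set.BijOn 𝒥 (HiggsJ.bsd n) (HiggsJ.compatibleJ ω) ∧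
      (∀ t ∈ HiggsJ.bsd n, HiggsJ.IsKNSMatrix (𝒥 t) J₀ ξ t) ∧
      ∀ k : ℕ, k ≤ 2 * n →
        -- `ℋ^k` is the direct sum of the `ℋ^{p,q}`, which are smooth subbundles
        (∀ t ∈ HiggsJ.bsd n,
          DirectSum.IsInternal fun p : Fin (k + 1) => HiggsJ.formsPQ (𝒥 t) k p) ∧
        (∀ p ≤ k, ∀ α : HiggsJ.Form V k,
          HiggsJ.SmoothOn (fun t => HiggsJ.projPQ (𝒥 t) k p α) (HiggsJ.bsd n)) ∧
        -- they are mutually orthogonal and preserved by `D`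
        (∀ t ∈ HiggsJ.bsd n, ∀ p ≤ k, ∀ p' ≤ k, p ≠ p' →
          ∀ α ∈ HiggsJ.formsPQ (𝒥 t) k p, ∀ β ∈ HiggsJ.formsPQ (𝒥 t) k p',
            HiggsJ.hodgeMetric ω 𝒥 k t α β = 0) ∧
        (∀ p ≤ k, ∀ u : HiggsJ.symMatrices n → HiggsJ.Form V k,
          HiggsJ.SmoothOn u (HiggsJ.bsd n) →
          (∀ t ∈ HiggsJ.bsd n, u t ∈ HiggsJ.formsPQ (𝒥 t) k p) →
          ∀ t ∈ HiggsJ.bsd n, ∀ v, HiggsJ.hodgeConn 𝒥 k u t v ∈ HiggsJ.formsPQ (𝒥 t) k p) ∧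
        -- `θ` has degree `(-1, 1)`
        (∀ t ∈ HiggsJ.bsd n, ∀ v, ∀ α ∈ HiggsJ.formsPQ (𝒥 t) k 0,
          HiggsJ.higgsField 𝒥 k t v α = 0) ∧
        (∀ t ∈ HiggsJ.bsd n, ∀ v, ∀ p < k, ∀ α ∈ HiggsJ.formsPQ (𝒥 t) k (p + 1),
          HiggsJ.higgsField 𝒥 k t v α ∈ HiggsJ.formsPQ (𝒥 t) k p) ∧
        -- `∇ = D + θ + θ̄`
        (∀ u : HiggsJ.symMatrices n → HiggsJ.Form V k, HiggsJ.SmoothOn u (HiggsJ.bsd n) →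
          ∀ t ∈ HiggsJ.bsd n, ∀ v, HiggsJ.trivialConn u t v =
            HiggsJ.hodgeConn 𝒥 k u t v + HiggsJ.higgsField 𝒥 k t v (u t) +
              HiggsJ.higgsFieldConj 𝒥 k t v (u t)) ∧
        -- flat Higgs bundle with Chern connection `D` and `θ^* = θ̄`
        HiggsJ.IsFlatHiggsBundle (HiggsJ.bsd n) (HiggsJ.hodgeMetric ω 𝒥 k)
          (HiggsJ.hodgeConn 𝒥 k) (HiggsJ.higgsField 𝒥 k) (HiggsJ.higgsFieldConj 𝒥 k) ∧
        -- admissibility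
        (1 ≤ k → k ≤ 2 * n - 1 →
          HiggsJ.IsAdmissible (HiggsJ.bsd n) (HiggsJ.higgsField (V := V) 𝒥 k)) := by
  open HiggsJ in
  obtain ⟨Z, hZξ⟩ := hξ.exists_equiv hV hω
  have hZ := hξ.eq_dotProduct hZξ
  have H := isHolomorphicFamily_transported hZ
  refine ⟨transported Z (antilinear n), bijOn_transported hZ,
    fun t ht => isKNSMatrix_transported hω hJ₀ hξ hZξ ht, fun k _ => ⟨?_, ?_, ?_, ?_, ?_, ?_, ?_,
      H.isFlatHiggsBundle hω_alt hω k, ?_⟩⟩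
  · exact fun t ht => isInternal_formsPQ (H.mem t ht).1 k
  · exact fun p hp α => H.smoothOn_projPQ hp contDiffOn_const
  · exact fun t ht p hp p' hp' hne α hα β hβ =>
      formInner_eq_zero hω_alt (H.mem t ht) hp hp' hne hα hβ
  · exact fun p hp u hu hmem t ht v => H.hodgeConn_mem hp hu hmem ht v
  · exact fun t ht v α hα => H.higgsField_eq_zero hω k ht v hα
  · exact fun t ht v p hp α hα => H.higgsField_mem hω hp ht v hα
  · exact fun u hu t ht v => H.trivialConn_eq hω k hu ht v
  · exact fun h1 h2 => H.isAdmissible hω (fun t ht v hv => immersion_transported ht hv) h1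
      (by omega)
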